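/- \textbf{Conventions.} Operads are symmetric, with inputs labelled by the elements of finite sets (the component of arity $n$ is the one of the label set $\{1,\dots,n\}$). For an operad $P$ in groupoids, an \emph{operad relative over $P$} is an operad in the category of right $P$-modules: a collection of groupoids $Q(A,B)$ ($A$ the set of open, $B$ the set of closed inputs) with functors $Q(A,B)\to Q(A',B')$ for bijections $A\cong A'$, $B\cong B'$, a right $P$-module structure $Q(A,B)\times\prod_{b}P(M_b)\to Q(A,\coprod_b M_b)$, a unit in $Q(\{*\},\varnothing)$ and compositions $\gamma:Q(A,B)\times\prod_{a}Q(K_a,L_a)\to Q(\coprod_a K_a,\,B\sqcup\coprod_a L_a)$, all functorial, equivariant, associative and unital, such that $\gamma$ is a morphism of right $P$-modules. \textbf{Parenthesized permutations and braids.} Let $\Omega_+(A)$ be the set of parenthesized words containing each letter of $A$ exactly once (the empty word $*$ if $A=\varnothing$); this is an operad by substitution, the empty word being a strict unit for concatenation. $PaP_+$ and $PaB_+$ are the operads in groupoids with objects $\Omega_+$. In $PaP_+(A)$ there is one morphism $u\to u'$ if the letters of $u$ and $u'$ occur in the same order, and none otherwise. A morphism $x\to x'$ in $PaB_+(B)$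 is a braid on $|B|$ strands whose starting points are labelled by the letters of $x$ in order and whose end points are labelled by those of $x'$; composition inserts braids into tubular neighbourhoods of the strands (insertion of $*$ deletes a strand). \textbf{Parenthesized shuffles.} Let $M_+(A,B)$ be the set of open-output operations, with open inputs $A$ and closed inputs $B$, of the unital two-coloured operad generated by binary products $\mu_c$ (closed) and $\mu_o$ (open) with strict units $*_c,*_o$ and a unary operation $f$ from closed to open with $f(*_c)=*_o$, each input being used exactly once. For $\mu\in M_+(A,B)$ the substitution $\mu(*_o,\dots,*_o)\in M_+(\varnothing,B)$ deletes the open letters, and $U$ forgets the symbols $f$, so that $U(\mu(*_o,\dots,*_o))\in\Omega_+(B)$. $PaSh_+(n,m)$ is the groupoid with objects $M_+(n,m)$ and exactly one morphism $\mu\to\mu'$ if the open, respectively closed, letters occur in the same order in $\mu$ and $\mu'$, and none otherwise. \textbf{The groupoids $PaPB'_+$.} $PaPB'_+(n,m)$ is the full subgroupoid of $$(PaP_+(n)\times PaB_+(m))\times_{\Sigma_n\times\Sigma_m}PaSh_+(n,m)$$ on the classes $[u,x,\mu]$ of objects such that $U(\mu(*_o,\dots,*_o))=x\cdot\tau$ for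 some $\tau\in\Sigma_m$. (Each class has exactly one representative in which the open letters and the closed letters of $\mu$ occur in increasing order. Below, $[u,x,\mu]$ denotes this representative, with the $i$-th open letter of $\mu$ replaced by the $i$-th letter of $u$ and the $i$-th closed letter of $\mu$ by the $i$-th letter of $x$; then $U(\mu(*_o,\dots,*_o))=x$.) \textbf{Structure.} The right $PaB_+$-module structure is $[u,x,\mu]\circ_i y=[u,\,x\circ_i y,\,\mu\circ_i y]$ (on the third entry only the parenthesizations of source and target of $y$ matter). For a morphism $[u,x,\mu]$ of $PaPB'_+(A,B)$ let $\rho[u,x,\mu]$ be the morphism of $PaB_+[A](B)=PaB_+(A\sqcup B)$, from the word in all letters obtained by dropping the symbols $f$ in the source of $\mu$ to the one obtained in the same way from the target, given by the braid: first all open strands move to the left, passing in front of the closed strands, no two strands of the same kind crossing; then the trivial braid on the open strands stands to the left of the braid $x$ on the closed strands; then the open strands move to their final places, again in front of the closed strands, no two strands of the same kind crossing. The composition is $$\gamma\bigl([u,x,\mu];([v_a,y_a,\nu_a])_{a}\bigr)=\bigl[\,u(v_a)_a,\ \rho[u,x,\mu](y_a)_a,\ \mu(\nu_a)_a\,\bigr],$$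 where $\rho[u,x,\mu](y_a)_a$ inserts $y_a$ into the strand $a$ (composition in the shifted operad $PaB_+[\cdot]$). The identity is $[\,1,\,*_c,\,1\,]\in PaPB'_+(1,0)$, the classes of the one-letter words. \textbf{Proposition.} $PaB_+$ is an operad in groupoids and, with this composition, this identity and this right $PaB_+$-module structure, $PaPB'_+$ is an operad relative over $PaB_+$. -/

import Mathlib

open CategoryTheory

noncomputable section

/-- Artin's relations between the standard generators `σ₀, …, σₙ₋₂` of the braid group. -/
def artinRels (n : ℕ) : Set (FreeGroup (Fin (n - 1))) :=
  {w | (∃ i j : Fin (n - 1), i.1 + 2 ≤ j.1 ∧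
          w = (FreeGroup.of i * FreeGroup.of j) * (FreeGroup.of j * FreeGroup.of i)⁻¹) ∨
       (∃ i j : Fin (n - 1), i.1 + 1 = j.1 ∧
          w = (FreeGroup.of i * FreeGroup.of j * FreeGroup.of i) *
            (FreeGroup.of j * FreeGroup.of i * FreeGroup.of j)⁻¹)}

/-- Artin's braid group on `n` strands. -/
abbrev BraidGroup (n : ℕ) : Type := PresentedGroup (artinRels n)

namespace BraidGroup

/-- The generator `σ i`: the strand at position `i` (positions are counted from `0`) crosses in
front of the strand at position `i + 1`. It is `1` by convention when there are no such strands. -/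
def σ (n i : ℕ) : BraidGroup n :=
  if h : i < n - 1 then PresentedGroup.of ⟨i, h⟩ else 1

theorem σ_far (n i j : ℕ) (h : i + 2 ≤ j) : σ n i * σ n j = σ n j * σ n i := by
  unfold σ
  split_ifs with h1 h2
  · exact PresentedGroup.mk_eq_mk_of_mul_inv_mem (rels := artinRels n)
      (x := FreeGroup.of ⟨i, h1⟩ * FreeGroup.of ⟨j, h2⟩)
      (y := FreeGroup.of ⟨j, h2⟩ * FreeGroup.of ⟨i, h1⟩) (Or.inl ⟨_, _, h, rfl⟩)
  all_goals simp

theorem σ_braid (n i : ℕ) (h : i + 2 < n) :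
    σ n i * σ n (i + 1) * σ n i = σ n (i + 1) * σ n i * σ n (i + 1) := by
  have h1 : i < n - 1 := by omega
  have h2 : i + 1 < n - 1 := by omega
  simp only [σ, h1, h2, dif_pos]
  exact PresentedGroup.mk_eq_mk_of_mul_inv_mem (rels := artinRels n)
      (x := FreeGroup.of ⟨i, h1⟩ * FreeGroup.of ⟨i + 1, h2⟩ * FreeGroup.of ⟨i, h1⟩)
      (y := FreeGroup.of ⟨i + 1, h2⟩ * FreeGroup.of ⟨i, h1⟩ * FreeGroup.of ⟨i + 1, h2⟩)
      (Or.inr ⟨⟨i, h1⟩, ⟨i + 1, h2⟩, rfl, rfl⟩)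

/-- The universal property of the braid group. -/
def lift {G : Type} [Group G] (n : ℕ) (s : ℕ → G)
    (far : ∀ i j, i + 2 ≤ j → j + 1 < n → s i * s j = s j * s i)
    (braid : ∀ i, i + 2 < n → s i * s (i + 1) * s i = s (i + 1) * s i * s (i + 1)) :
    BraidGroup n →* G :=
  PresentedGroup.toGroup (rels := artinRels n) (f := fun i => s i.1) (by
    rintro w (⟨i, j, h, rfl⟩ | ⟨i, j, h, rfl⟩)
    · have := far i j h (by omega)
      simp [this]
    · have := braid i (by omega)
      rw [h] at this
      simp [this])

theorem lift_σ {G : Type} [Group G] (n : ℕ) (s : ℕ → G) (far) (braid) (i : ℕ) (h : i + 1 < n) :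
    lift n s far braid (σ n i) = s i := by
  have h1 : i < n - 1 := by omega
  simp only [σ, h1, dif_pos, lift, PresentedGroup.toGroup.of]

theorem induction {n : ℕ} {C : BraidGroup n → Prop} (hσ : ∀ i, i + 1 < n → C (σ n i))
    (one : C 1) (mul : ∀ b c, C b → C c → C (b * c)) (inv : ∀ b, C b → C b⁻¹)
    (b : BraidGroup n) : C b := by
  have hb : b ∈ Subgroup.closure (Set.range (PresentedGroup.of (rels := artinRels n))) := by
    rw [PresentedGroup.closure_range_of]; trivial
  induction hb using Subgroup.closure_induction with
  | mem x hx =>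
    obtain ⟨i, rfl⟩ := hx
    have := hσ i.1 (by omega)
    simpa [σ] using this
  | one => exact one
  | mul x y _ _ hx hy => exact mul _ _ hx hy
  | inv x _ hx => exact inv _ hx

/-- The permutation underlying a braid: the strand which ends at position `p` starts at position
`perm n b p`. (Positions `≥ n` are fixed.) -/
def perm (n : ℕ) : BraidGroup n →* Equiv.Perm ℕ :=
  lift n (fun i => Equiv.swap i (i + 1))
    (fun i j h _ => (Equiv.Perm.disjoint_iff_eq_or_eq.2 (by
      intro x
      by_cases h1 : x = j ∨ x = j + 1
      · left; apply Equiv.swap_apply_of_ne_of_ne <;> omega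
      · right; apply Equiv.swap_apply_of_ne_of_ne <;> omega)).commute.eq)
    (fun i _ => by
      have e1 : Equiv.swap (i + 1) i * Equiv.swap (i + 2) (i + 1) * Equiv.swap (i + 1) i
          = Equiv.swap i (i + 2) :=
        Equiv.swap_mul_swap_mul_swap (by omega) (by omega)
      have e2 : Equiv.swap (i + 1) (i + 2) * Equiv.swap i (i + 1) * Equiv.swap (i + 1) (i + 2)
          = Equiv.swap (i + 2) i :=
        Equiv.swap_mul_swap_mul_swap (by omega) (by omega)
      rw [Equiv.swap_comm (i + 1) i, Equiv.swap_comm (i + 2) (i + 1),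
        Equiv.swap_comm i (i + 2)] at e1
      exact e1.trans e2.symm)

theorem perm_σ (n i : ℕ) (h : i + 1 < n) : perm n (σ n i) = Equiv.swap i (i + 1) :=
  lift_σ n _ _ _ i h

/-- The braid on `N` strands which is `b` on the strands at positions `k, …, k + n - 1`, and which is
trivial on the other strands (it is `1` by convention if `N < k + n`). -/
def place (n N k : ℕ) : BraidGroup n →* BraidGroup N :=
  if hN : k + n ≤ N then
    lift n (fun i => σ N (k + i)) (fun i j h _ => σ_far N _ _ (by omega))
      (fun i h => σ_braid N (k + i) (by omega))
  else 1

/-- The strand at position `k` moves to the right, in front of the next `b` strands. -/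
def pass (N k : ℕ) : ℕ → BraidGroup N
  | 0 => 1
  | b + 1 => pass N k b * σ N (k + b)

/-- The block of the `a` strands at positions `k, …, k + a - 1` moves to the right, in front of the
block of the next `b` strands; inside of each of the two blocks the strands stay parallel. -/
def cross (N k : ℕ) : ℕ → ℕ → BraidGroup N
  | 0, _ => 1
  | a + 1, b => pass N (k + a) b * cross N k a b

theorem cross_zero_right (N k a : ℕ) : cross N k a 0 = 1 := by
  induction a with
  | zero => rfl
  | succ a ih => simp [cross, pass, ih]

theorem pass_add (N k b c : ℕ) : pass N k (b + c) = pass N k b * pass N (k + b) c := by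
  induction c with
  | zero => simp [pass]
  | succ c ih => rw [← add_assoc, pass, pass, ih, mul_assoc, add_assoc]

theorem pass_far_left (N k b j : ℕ) (h : j + 2 ≤ k) :
    σ N j * pass N k b = pass N k b * σ N j := by
  induction b with
  | zero => simp [pass]
  | succ b ih => rw [pass, ← mul_assoc, ih, mul_assoc, mul_assoc, σ_far N j (k + b) (by omega)]

theorem pass_far_right (N k b j : ℕ) (h : k + b + 1 ≤ j) :
    σ N j * pass N k b = pass N k b * σ N j := by
  induction b with
  | zero => simp [pass]
  | succ b ih =>
    rw [pass, ← mul_assoc, ih (by omega), mul_assoc, mul_assoc, σ_far N (k + b) j (by omega)]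

theorem pass_slide (N k b j : ℕ) (h1 : k ≤ j) (h2 : j + 1 < k + b) (h3 : k + b < N) :
    σ N (j + 1) * pass N k b = pass N k b * σ N j := by
  induction b with
  | zero => omega
  | succ b ih =>
    rcases Nat.lt_or_ge (j + 1) (k + b) with h | h
    · rw [pass, ← mul_assoc, ih h (by omega), mul_assoc, mul_assoc, σ_far N j (k + b) (by omega)]
    · obtain ⟨c, rfl⟩ : ∃ c, b = c + 1 := ⟨b - 1, by omega⟩
      obtain rfl : j = k + c := by omega
      have e : k + (c + 1) = k + c + 1 := by omega
      have hb := σ_braid N (k + c) (by omega)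
      rw [pass, pass, e, ← mul_assoc, ← mul_assoc, pass_far_right N k c _ (by omega),
        mul_assoc, mul_assoc, ← mul_assoc (σ N (k + c + 1)), ← hb]
      simp only [mul_assoc]

theorem cross_add_right (N k a b c : ℕ) :
    cross N k a (b + c) = cross N k a b * cross N (k + b) a c := by
  induction a with
  | zero => simp [cross]
  | succ a ih =>
    have hc : ∀ c', pass N (k + a + b) c' * cross N k a b = cross N k a b * pass N (k + a + b) c' := by
      intro c'
      have : ∀ j, k + a + b ≤ j → ∀ a', a' ≤ a → σ N j * cross N k a' b = cross N k a' b * σ N j := by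
        intro j hj a'
        induction a' with
        | zero => simp [cross]
        | succ a' ih' =>
          intro ha
          rw [cross, ← mul_assoc, pass_far_right N _ _ _ (by omega), mul_assoc, ih' (by omega),
            mul_assoc]
      induction c' with
      | zero => simp [pass]
      | succ c' ihc =>
        rw [pass, mul_assoc, this _ (by omega) a le_rfl, ← mul_assoc, ihc, mul_assoc]
    have e : k + b + a = k + a + b := by omega
    rw [cross, cross, cross, ih, pass_add, e, mul_assoc, mul_assoc,
      ← mul_assoc (pass N (k + a + b) c), hc, mul_assoc]

theorem cross_slide (N k a b j : ℕ) (h1 : k ≤ j) (h2 : j + 1 < k + b) (h3 : k + a + b ≤ N) :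
    σ N (j + a) * cross N k a b = cross N k a b * σ N j := by
  induction a with
  | zero => simp [cross]
  | succ a ih =>
    rw [cross, ← add_assoc, ← mul_assoc, pass_slide N (k + a) b (j + a) (by omega) (by omega)
      (by omega), mul_assoc, ih (by omega), mul_assoc]

theorem pass_cross_slide (N k a b j c : ℕ) (h1 : k ≤ j) (h2 : j + c < k + b)
    (h3 : k + a + b ≤ N) :
    pass N (j + a) c * cross N k a b = cross N k a b * pass N j c := by
  induction c with
  | zero => simp [pass]
  | succ c ih =>
    have e : j + a + c = j + c + a := by omega
    rw [pass, pass, mul_assoc, e, cross_slide N k a b _ (by omega) (by omega) h3, ← mul_assoc,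
      ih (by omega), mul_assoc]

theorem cross_cross_slide (N k a b c : ℕ) (h3 : k + a + (b + c) ≤ N) :
    cross N (k + a) b c * cross N k a (b + c) = cross N k a (b + c) * cross N k b c := by
  have : ∀ b', b' ≤ b →
      cross N (k + a) b' c * cross N k a (b + c) = cross N k a (b + c) * cross N k b' c := by
    intro b'
    induction b' with
    | zero => simp [cross]
    | succ b' ih =>
      intro hb
      have e : k + a + b' = k + b' + a := by omega
      rw [cross, cross, mul_assoc, ih (by omega), ← mul_assoc, e,
        pass_cross_slide N k a (b + c) (k + b') c (by omega) (by omega) (by omega), mul_assoc]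
  exact this b le_rfl

theorem cross_braid (N k a b c : ℕ) (h : k + a + b + c ≤ N) :
    cross N k a b * cross N (k + b) a c * cross N k b c =
      cross N (k + a) b c * cross N k a c * cross N (k + c) a b := by
  rw [← cross_add_right, ← cross_cross_slide N k a b c (by omega), mul_assoc, ← cross_add_right,
    add_comm b c]

theorem σ_cross_far (N k a b j : ℕ) (h : k + a + b ≤ j) :
    σ N j * cross N k a b = cross N k a b * σ N j := by
  induction a with
  | zero => simp [cross]
  | succ a ih =>
    rw [cross, ← mul_assoc, pass_far_right N _ _ _ (by omega), mul_assoc, ih (by omega), mul_assoc]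

theorem cross_far (N k a b k' a' b' : ℕ) (h : k + a + b ≤ k') :
    cross N k a b * cross N k' a' b' = cross N k' a' b' * cross N k a b := by
  have hp : ∀ l c, k + a + b ≤ l →
      cross N k a b * pass N l c = pass N l c * cross N k a b := by
    intro l c hl
    induction c with
    | zero => simp [pass]
    | succ c ih => rw [pass, ← mul_assoc, ih, mul_assoc, mul_assoc, σ_cross_far _ _ _ _ _ (by omega)]
  induction a' with
  | zero => simp [cross]
  | succ a' ih => rw [cross, ← mul_assoc, hp _ _ (by omega), mul_assoc, ih, mul_assoc]

/-- Permutations act on functions of a sequence of widths by permuting the widths. -/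
def widthAct (H : Type) [Group H] : Equiv.Perm ℕ →* MulAut ((ℕ → ℕ) → H) where
  toFun π :=
    { toFun := fun f w => f (w ∘ π)
      invFun := fun f w => f (w ∘ π.symm)
      left_inv := fun f => by funext w; simp [Function.comp_assoc]
      right_inv := fun f => by funext w; simp [Function.comp_assoc]
      map_mul' := fun _ _ => rfl }
  map_one' := rfl
  map_mul' _ _ := rfl

/-- The cabling of `σ i`. -/
def cableσ (r N i : ℕ) (w : ℕ → ℕ) : BraidGroup N :=
  if ∑ p ∈ Finset.range r, w p ≤ N then
    cross N (∑ p ∈ Finset.range i, w p) (w i) (w (i + 1))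
  else 1

theorem sum_swap (w : ℕ → ℕ) (i r : ℕ) (h : i + 1 < r) :
    ∑ p ∈ Finset.range r, (w ∘ Equiv.swap i (i + 1)) p = ∑ p ∈ Finset.range r, w p := by
  refine Finset.sum_nbij' (Equiv.swap i (i + 1)) (Equiv.swap i (i + 1)) ?_ ?_ ?_ ?_ ?_
  · intro p hp
    simp only [Finset.mem_range, Equiv.swap_apply_def] at *
    split_ifs <;> omega
  · intro p hp
    simp only [Finset.mem_range, Equiv.swap_apply_def] at *
    split_ifs <;> omega
  all_goals simp

theorem sum_swap' (w : ℕ → ℕ) (i r : ℕ) (h : r ≤ i) :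
    ∑ p ∈ Finset.range r, (w ∘ Equiv.swap i (i + 1)) p = ∑ p ∈ Finset.range r, w p := by
  refine Finset.sum_congr rfl fun p hp => ?_
  simp only [Finset.mem_range] at hp
  rw [Function.comp, Equiv.swap_apply_of_ne_of_ne (by omega) (by omega)]

theorem sum_le_of_lt (w : ℕ → ℕ) {i r : ℕ} (h : i ≤ r) :
    ∑ p ∈ Finset.range i, w p ≤ ∑ p ∈ Finset.range r, w p :=
  Finset.sum_le_sum_of_subset (by simpa using h)

theorem cableσ_far (r N i j : ℕ) (h : i + 2 ≤ j) (hj : j + 1 < r) (w : ℕ → ℕ) :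
    cableσ r N i w * cableσ r N j (w ∘ Equiv.swap i (i + 1)) =
      cableσ r N j w * cableσ r N i (w ∘ Equiv.swap j (j + 1)) := by
  unfold cableσ
  rw [sum_swap w i r (by omega), sum_swap w j r (by omega), sum_swap w i j (by omega),
    sum_swap' w j i (by omega)]
  split_ifs with hw
  · simp only [Function.comp]
    rw [Equiv.swap_apply_of_ne_of_ne (a := i) (b := i + 1) (x := j) (by omega) (by omega),
      Equiv.swap_apply_of_ne_of_ne (a := i) (b := i + 1) (x := j + 1) (by omega) (by omega),
      Equiv.swap_apply_of_ne_of_ne (a := j) (b := j + 1) (x := i) (by omega) (by omega),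
      Equiv.swap_apply_of_ne_of_ne (a := j) (b := j + 1) (x := i + 1) (by omega) (by omega)]
    refine cross_far _ _ _ _ _ _ _ ?_
    have := sum_le_of_lt w h
    rw [Finset.sum_range_succ, Finset.sum_range_succ] at this
    exact this
  · rfl

theorem cableσ_braid (r N i : ℕ) (h : i + 2 < r) (w : ℕ → ℕ) :
    cableσ r N i w * cableσ r N (i + 1) (w ∘ Equiv.swap i (i + 1)) *
        cableσ r N i (w ∘ Equiv.swap i (i + 1) ∘ Equiv.swap (i + 1) (i + 2)) =
      cableσ r N (i + 1) w * cableσ r N i (w ∘ Equiv.swap (i + 1) (i + 2)) *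
        cableσ r N (i + 1) (w ∘ Equiv.swap (i + 1) (i + 2) ∘ Equiv.swap i (i + 1)) := by
  unfold cableσ
  rw [← Function.comp_assoc, ← Function.comp_assoc, sum_swap _ (i + 1) r (by omega),
    sum_swap _ i r (by omega), sum_swap _ (i + 1) r (by omega),
    sum_swap _ i r (by omega), sum_swap _ (i + 1) r (by omega)]
  split_ifs with hw
  · have h1 : Equiv.swap i (i + 1) (i + 2) = i + 2 :=
      Equiv.swap_apply_of_ne_of_ne (by omega) (by omega)
    have h2 : Equiv.swap (i + 1) (i + 2) i = i :=
      Equiv.swap_apply_of_ne_of_ne (by omega) (by omega)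
    rw [sum_swap' _ (i + 1) i (by omega), sum_swap' _ i i (by omega),
      sum_swap' _ (i + 1) i (by omega)]
    simp only [Finset.sum_range_succ, sum_swap' _ (i + 1) i (Nat.le_succ i),
      sum_swap' _ i i le_rfl]
    simp only [Function.comp, add_assoc, Nat.reduceAdd, h1, h2, Equiv.swap_apply_left,
      Equiv.swap_apply_right]
    refine cross_braid _ _ _ _ _ ?_
    have := sum_le_of_lt w (i := i + 3) h
    rw [Finset.sum_range_succ, Finset.sum_range_succ, Finset.sum_range_succ] at this
    omega
  · rfl

/-- Cabling, together with the underlying permutation, as a homomorphism. -/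
def cableHom (r N : ℕ) : BraidGroup r →* ((ℕ → ℕ) → BraidGroup N) ⋊[widthAct _] Equiv.Perm ℕ :=
  lift r (fun i => ⟨cableσ r N i, Equiv.swap i (i + 1)⟩)
    (fun i j h hj => by
      refine SemidirectProduct.ext ?_ ?_
      · funext w
        exact cableσ_far r N i j h hj w
      · have := congrArg (perm r) (σ_far r i j h)
        simpa [perm_σ r i (by omega), perm_σ r j hj] using this)
    (fun i h => by
      refine SemidirectProduct.ext ?_ ?_
      · funext w
        exact cableσ_braid r N i h w
      · have := congrArg (perm r) (σ_braid r i h)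
        simpa [perm_σ r i (by omega), perm_σ r (i + 1) (by omega)] using this)

/-- Cabling: the braid `cable r N b w` on `N = w 0 + ⋯ + w (r - 1)` strands is obtained from the
braid `b` on `r` strands by replacing, for every `p < r`, the strand which starts at position `p` by
`w p` parallel strands. In particular the strands with `w p = 0` are removed. (The total width `N` is
an argument of its own in order to avoid casts.) -/
def cable (r N : ℕ) (b : BraidGroup r) (w : ℕ → ℕ) : BraidGroup N := (cableHom r N b).left w

theorem cableHom_right (r N : ℕ) (b : BraidGroup r) : (cableHom r N b).right = perm r b := by
  have : (SemidirectProduct.rightHom).comp (cableHom r N) = perm r :=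
    PresentedGroup.ext fun i => by
      have h : i.1 + 1 < r := by omega
      have e : (PresentedGroup.of i : BraidGroup r) = σ r i.1 := by
        have h1 : i.1 < r - 1 := by omega
        simp [σ]
      rw [e, MonoidHom.comp_apply, cableHom, lift_σ _ _ _ _ _ h, perm_σ _ _ h]
      rfl
  exact DFunLike.congr_fun this b

theorem cable_σ (r N i : ℕ) (h : i + 1 < r) (w : ℕ → ℕ)
    (hw : ∑ p ∈ Finset.range r, w p ≤ N) :
    cable r N (σ r i) w = cross N (∑ p ∈ Finset.range i, w p) (w i) (w (i + 1)) := by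
  rw [cable, cableHom, lift_σ _ _ _ _ _ h]
  simp [cableσ, hw]

theorem cable_one (r N : ℕ) (w : ℕ → ℕ) : cable r N 1 w = 1 := by
  simp [cable]

theorem cable_mul (r N : ℕ) (b c : BraidGroup r) (w : ℕ → ℕ) :
    cable r N (b * c) w = cable r N b w * cable r N c (w ∘ perm r b) := by
  rw [cable, map_mul, SemidirectProduct.mul_left, Pi.mul_apply, ← cableHom_right r N]
  rfl

end BraidGroup

/-! ### Braids carry lists of labels to lists of labels -/

namespace BraidGroup

/-- The braid `b` starts with the points labelled by `l` (from left to right) and ends with the points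
labelled by `l'`. -/
def Carries {X : Type} {n : ℕ} (b : BraidGroup n) (l l' : List X) : Prop :=
  ∀ p, l'[p]? = l[perm n b p]?

section
variable {X : Type} {n : ℕ}

theorem Carries.one (l : List X) : Carries (1 : BraidGroup n) l l := fun p => by simp

theorem Carries.mul {b c : BraidGroup n} {l l' l'' : List X} (h : Carries b l l')
    (h' : Carries c l' l'') : Carries (b * c) l l'' := fun p => by
  rw [h' p, h, map_mul, Equiv.Perm.mul_apply]

theorem Carries.inv {b : BraidGroup n} {l l' : List X} (h : Carries b l l') :
    Carries b⁻¹ l' l := fun p => by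
  rw [h, map_inv, ← Equiv.Perm.mul_apply, mul_inv_cancel, Equiv.Perm.one_apply]

theorem Carries.map {Y : Type} {b : BraidGroup n} {l l' : List X} (h : Carries b l l') (f : X → Y) :
    Carries b (l.map f) (l'.map f) := fun p => by
  rw [List.getElem?_map, List.getElem?_map, h p]

theorem perm_of_ge (b : BraidGroup n) (p : ℕ) (hp : n ≤ p) : perm n b p = p := by
  induction b using BraidGroup.induction with
  | hσ i hi => rw [perm_σ n i hi, Equiv.swap_apply_of_ne_of_ne] <;> omega
  | one => simp
  | mul b c hb hc => rw [map_mul, Equiv.Perm.mul_apply, hc, hb]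
  | inv b hb => rw [map_inv, Equiv.Perm.inv_eq_iff_eq, hb]

theorem perm_lt (b : BraidGroup n) (p : ℕ) (hp : p < n) : perm n b p < n := by
  by_contra h
  have := (perm n b).injective (perm_of_ge b _ (not_lt.1 h))
  omega

theorem perm_place {N k : ℕ} (b : BraidGroup n) (h : k + n ≤ N) (p : ℕ) :
    perm N (place n N k b) p = if p < k then p else k + perm n b (p - k) := by
  induction b using BraidGroup.induction generalizing p with
  | hσ i hi =>
    rw [place, dif_pos h, lift_σ _ _ _ _ _ hi, perm_σ n i hi, perm_σ N (k + i) (by omega)]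
    simp only [Equiv.swap_apply_def]
    split_ifs <;> omega
  | one => simp only [map_one, Equiv.Perm.coe_one, id_eq]; split_ifs <;> omega
  | mul b c hb hc =>
    simp only [map_mul, Equiv.Perm.mul_apply, hb, hc]
    split_ifs
    · rfl
    · omega
    · simp
  | inv b hb =>
    rw [map_inv, map_inv, Equiv.Perm.inv_eq_iff_eq, hb]
    split_ifs
    · rfl
    · omega
    · simp; omega

theorem Carries.place {N k : ℕ} {b : BraidGroup n} {l l' : List X} (h : Carries b l l')
    (hl : l.length = n) (hl' : l'.length = n) (hN : k + n ≤ N) (pre post : List X)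
    (hk : pre.length = k) :
    Carries (place n N k b) (pre ++ l ++ post) (pre ++ l' ++ post) := fun p => by
  rw [perm_place b hN]
  split_ifs with hp
  · simp only [List.append_assoc]
    rw [List.getElem?_append_left (by omega), List.getElem?_append_left (by omega)]
  · simp only [List.append_assoc]
    rw [List.getElem?_append_right (l₁ := pre) (by omega),
      List.getElem?_append_right (l₁ := pre) (by omega)]
    have e : k + perm n b (p - k) - pre.length = perm n b (p - k) := by omega
    rw [e, hk]
    rcases Nat.lt_or_ge (p - k) n with hq | hq
    · have := perm_lt b _ hq
      rw [List.getElem?_append_left (by omega), List.getElem?_append_left (by omega), h]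
    · rw [perm_of_ge b _ hq, List.getElem?_append_right (by omega),
        List.getElem?_append_right (by omega), hl, hl']

theorem carries_σ {i : ℕ} (hi : i + 1 < n) (pre post : List X) (x y : X) (h : pre.length = i) :
    Carries (σ n i) (pre ++ x :: y :: post) (pre ++ y :: x :: post) := fun p => by
  subst h
  rw [perm_σ n _ hi, Equiv.swap_apply_def]
  split_ifs with h1 h2
  · subst h1; simp
  · subst h2; simp
  · rcases Nat.lt_or_ge p pre.length with h | h
    · rw [List.getElem?_append_left h, List.getElem?_append_left h]
    · obtain ⟨c, rfl⟩ : ∃ c, p = pre.length + (c + 2) := ⟨p - pre.length - 2, by omega⟩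
      rw [List.getElem?_append_right (by omega), List.getElem?_append_right (by omega)]
      simp

theorem carries_pass {N k : ℕ} (pre B post : List X) (x : X) (h : pre.length = k)
    (hN : k + B.length < N) :
    Carries (pass N k B.length) (pre ++ x :: (B ++ post)) (pre ++ (B ++ x :: post)) := by
  induction B using List.reverseRecOn generalizing post with
  | nil => exact Carries.one _
  | append_singleton B y ih =>
    simp only [List.length_append, List.length_cons, List.length_nil, zero_add, pass] at *
    have h1 := ih (y :: post) (by omega)
    have h2 := carries_σ (n := N) (i := k + B.length) (by omega) (pre ++ B) post x y (by simp [h])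
    refine Carries.mul (l' := pre ++ (B ++ x :: y :: post)) ?_ ?_
    · simpa using h1
    · simpa using h2

theorem carries_cross {N k : ℕ} (pre A B post : List X) (h : pre.length = k)
    (hN : k + A.length + B.length ≤ N) :
    Carries (cross N k A.length B.length) (pre ++ (A ++ (B ++ post)))
      (pre ++ (B ++ (A ++ post))) := by
  induction A using List.reverseRecOn generalizing post with
  | nil => exact Carries.one _
  | append_singleton A x ih =>
    simp only [List.length_append, List.length_cons, List.length_nil, zero_add, cross] at *
    have h1 := carries_pass (N := N) (k := k + A.length) (pre ++ A) B post x (by simp [h])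
      (by omega)
    have h2 := ih (x :: post) (by omega)
    refine Carries.mul (l' := pre ++ (A ++ (B ++ x :: post))) ?_ ?_
    · simpa using h1
    · simpa using h2

theorem sum_perm {r : ℕ} (b : BraidGroup r) (w : ℕ → ℕ) :
    ∑ p ∈ Finset.range r, (w ∘ perm r b) p = ∑ p ∈ Finset.range r, w p := by
  induction b using BraidGroup.induction generalizing w with
  | hσ i hi => rw [perm_σ r i hi, sum_swap w i r hi]
  | one => simp
  | mul b c hb hc =>
    have := hc (w ∘ perm r b)
    rw [map_mul, ← hb w, ← this]
    rfl
  | inv b hb =>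
    have := hb (w ∘ perm r b⁻¹)
    rw [← this]
    simp [Function.comp_def]

theorem length_flatMap_range (L : ℕ → List X) (r : ℕ) :
    ((List.range r).flatMap L).length = ∑ p ∈ Finset.range r, (L p).length := by
  induction r with
  | zero => simp
  | succ r ih => simp [List.range_succ, Finset.sum_range_succ, ih]

theorem range_split {r i : ℕ} (h : i + 1 < r) :
    ∃ l, List.range r = List.range i ++ i :: (i + 1) :: l ∧ ∀ p ∈ l, i + 2 ≤ p := by
  refine ⟨List.range' (i + 2) (r - (i + 2)), ?_, fun p hp => (List.mem_range'_1.1 hp).1⟩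
  have h1 : List.range' (i + 2) (r - (i + 2)) = List.range' (0 + 1 * (i + 2)) (r - (i + 2)) := by simp
  rw [show List.range i ++ i :: (i + 1) :: List.range' (i + 2) (r - (i + 2))
    = List.range (i + 2) ++ List.range' (i + 2) (r - (i + 2)) by
      simp [List.range_succ], List.range_eq_range', List.range_eq_range', h1,
      List.range'_append]
  congr 1
  omega

theorem carries_cable {r N : ℕ} (b : BraidGroup r) (L : ℕ → List X)
    (hN : ∑ p ∈ Finset.range r, (L p).length ≤ N) :
    Carries (cable r N b (fun p => (L p).length)) ((List.range r).flatMap L)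
      ((List.range r).flatMap (L ∘ perm r b)) := by
  induction b using BraidGroup.induction generalizing L with
  | hσ i hi =>
    rw [cable_σ r N i hi _ hN, perm_σ r i hi]
    obtain ⟨l, hl, hl2⟩ := range_split hi
    have e1 : (List.range i).flatMap (L ∘ Equiv.swap i (i + 1)) = (List.range i).flatMap L :=
      List.flatMap_congr fun p hp => by
        have := List.mem_range.1 hp
        rw [Function.comp, Equiv.swap_apply_of_ne_of_ne (by omega) (by omega)]
    have e2 : l.flatMap (L ∘ Equiv.swap i (i + 1)) = l.flatMap L :=
      List.flatMap_congr fun p hp => by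
        have := hl2 p hp
        rw [Function.comp, Equiv.swap_apply_of_ne_of_ne (by omega) (by omega)]
    rw [hl, List.flatMap_append, List.flatMap_append, e1, List.flatMap_cons, List.flatMap_cons,
      List.flatMap_cons, List.flatMap_cons, e2]
    have hs := sum_le_of_lt (fun p => (L p).length) (i := i + 2) hi
    rw [Finset.sum_range_succ, Finset.sum_range_succ] at hs
    have := carries_cross (N := N) (k := ∑ p ∈ Finset.range i, (L p).length)
      ((List.range i).flatMap L) (L i) (L (i + 1)) (l.flatMap L) (length_flatMap_range L i)
      (by omega)
    simpa using this
  | one => rw [cable_one]; simpa using Carries.one _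
  | mul b c hb hc =>
    rw [cable_mul]
    refine (hb L hN).mul ?_
    have := hc (L ∘ perm r b) (by
      have := sum_perm b (fun p => (L p).length)
      simp only [Function.comp_def] at *
      omega)
    rw [map_mul]
    exact this
  | inv b hb =>
    have h0 := sum_perm b⁻¹ (fun p => (L p).length)
    have h1 := hb (L ∘ perm r b⁻¹) (by
      simp only [Function.comp_def] at *
      omega)
    have h2 := cable_mul r N b⁻¹ b (fun p => (L p).length)
    rw [inv_mul_cancel, cable_one] at h2
    have h3 : cable r N b⁻¹ (fun p => (L p).length) =
        (cable r N b (fun p => ((L ∘ perm r b⁻¹) p).length))⁻¹ :=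
      eq_inv_of_mul_eq_one_left h2.symm
    rw [h3]
    have h4 : (L ∘ perm r b⁻¹) ∘ perm r b = L := by
      funext p; simp
    rw [h4] at h1
    exact h1.inv

end

/-- For a row of points of two kinds (left: "terrestrial", right: "aerial"): if `t` terrestrial points
followed by `a` aerial ones stand to the left of the row `l`, then `gather N t a l` is the braid which
brings all terrestrial points of the row to the left of all aerial points; terrestrial strands pass in
front of the aerial ones, and neither two terrestrial nor two aerial strands cross. -/
def gather {A B : Type} (N : ℕ) : ℕ → ℕ → List (A ⊕ B) → BraidGroup N
  | _, _, [] => 1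
  | t, a, Sum.inl _ :: l => (cross N t 1 a)⁻¹ * gather N (t + 1) a l
  | t, a, Sum.inr _ :: l => gather N t (a + 1) l

theorem carries_gather {A B : Type} {N : ℕ} (l T E : List (A ⊕ B))
    (h : T.length + E.length + l.length ≤ N) :
    Carries (gather N T.length E.length l) (T ++ (E ++ l))
      (T ++ ((l.filterMap Sum.getLeft?).map Sum.inl ++
        (E ++ (l.filterMap Sum.getRight?).map Sum.inr))) := by
  induction l generalizing T E with
  | nil => simpa [gather] using Carries.one _
  | cons c l ih =>
    rcases c with c | c
    · have h1 := ih (T ++ [Sum.inl c]) E (by simp at *; omega)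
      have h2 := (carries_cross (N := N) T [Sum.inl c] E l rfl (by simp at *; omega)).inv
      simp only [List.length_append, List.length_cons, List.length_nil, zero_add] at h1 h2
      refine Carries.mul h2 ?_
      simpa [List.filterMap_cons] using h1
    · have h1 := ih T (E ++ [Sum.inr c]) (by simp at *; omega)
      simp only [List.length_append, List.length_cons, List.length_nil, zero_add] at h1
      simpa [gather, List.filterMap_cons] using h1

/-- The braids `g a`, for the labels `a` in the list `l`, side by side, starting at position `k`. -/
def sideBySide {A : Type} (N : ℕ) (n : A → ℕ) (g : ∀ a, BraidGroup (n a)) : ℕ → List A → BraidGroup N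
  | _, [] => 1
  | k, a :: l => place (n a) N k (g a) * sideBySide N n g (k + n a) l

theorem carries_sideBySide {A X : Type} {N : ℕ} {n : A → ℕ} {g : ∀ a, BraidGroup (n a)}
    {L L' : A → List X} (hg : ∀ a, Carries (g a) (L a) (L' a)) (h : ∀ a, (L a).length = n a)
    (h' : ∀ a, (L' a).length = n a) (l : List A) (pre : List X)
    (hN : pre.length + (l.flatMap L).length ≤ N) :
    Carries (sideBySide N n g pre.length l) (pre ++ l.flatMap L) (pre ++ l.flatMap L') := by
  induction l generalizing pre with
  | nil => simpa [sideBySide] using Carries.one _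
  | cons a l ih =>
    simp only [List.flatMap_cons, List.length_append] at *
    have h1 := (hg a).place (N := N) (k := pre.length) (h a) (h' a) (by have := h a; omega) pre
      (l.flatMap L) rfl
    have h2 := ih (pre ++ L' a) (by simp only [List.length_append, h' a]; have := h a; omega)
    simp only [List.length_append, h' a] at h2
    refine Carries.mul (l' := pre ++ L' a ++ l.flatMap L) ?_ ?_
    · simpa using h1
    · simpa using h2

end BraidGroup

/-! ### Parenthesized words -/

/-- The free unital magma on `A`: parenthesized words in the letters `A`, including the empty word. -/
abbrev Mag (A : Type) : Type := WithOne (FreeMagma A)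

namespace Mag

/-- The word with one letter. -/
def of {A : Type} (a : A) : Mag A := (FreeMagma.of a : FreeMagma A)

/-- The universal property of the free unital magma. -/
def lift {A M : Type} [MulOneClass M] (f : A → M) : Mag A →* M := WithOne.lift (FreeMagma.lift f)

@[simp] theorem lift_of {A M : Type} [MulOneClass M] (f : A → M) (a : A) : lift f (of a) = f a := rfl

theorem induction {A : Type} {C : Mag A → Prop} (one : C 1) (of : ∀ a, C (of a))
    (mul : ∀ s t, C s → C t → C (s * t)) (t : Mag A) : C t := by
  induction t using WithOne.recOneCoe with
  | one => exact one
  | coe t =>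
    induction t using FreeMagma.recOnMul with
    | ih1 a => exact of a
    | ih2 s t hs ht => exact mul _ _ hs ht

/-- Replacement of the letters. -/
def map {A B : Type} (f : A → B) : Mag A →* Mag B := lift (fun a => of (f a))

/-- The letters of a word, from left to right. -/
def leaves {A : Type} (t : Mag A) : List A := FreeMonoid.toList (lift FreeMonoid.of t)

section
variable {A B : Type}

@[simp] theorem leaves_one : leaves (1 : Mag A) = [] := rfl

@[simp] theorem leaves_of (a : A) : leaves (of a) = [a] := rfl

@[simp] theorem leaves_mul (s t : Mag A) : leaves (s * t) = leaves s ++ leaves t := by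
  simp [leaves]

theorem leaves_lift (f : A → Mag B) (t : Mag A) :
    leaves (lift f t) = (leaves t).flatMap (fun a => leaves (f a)) := by
  induction t using Mag.induction with
  | one => simp
  | of a => simp
  | mul s t hs ht => simp [hs, ht]

@[simp] theorem leaves_map (f : A → B) (t : Mag A) : leaves (map f t) = (leaves t).map f := by
  rw [map, leaves_lift]
  simp [List.map_eq_flatMap]

@[simp] theorem map_of (f : A → B) (a : A) : map f (of a) = of (f a) := rfl

theorem lift_lift {C : Type} [MulOneClass C] (f : A → Mag B) (g : B → C) (t : Mag A) :
    lift g (lift f t) = lift (fun a => lift g (f a)) t := by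
  induction t using Mag.induction with
  | one => simp
  | of a => simp
  | mul s t hs ht => simp [hs, ht]

theorem lift_map {C : Type} [MulOneClass C] (f : A → B) (g : B → C) (t : Mag A) :
    lift g (map f t) = lift (fun a => g (f a)) t := by
  rw [map, lift_lift]; rfl

theorem map_lift {C : Type} (f : A → Mag B) (g : B → C) (t : Mag A) :
    map g (lift f t) = lift (fun a => map g (f a)) t := by
  rw [map, lift_lift]

theorem map_map {C : Type} (f : A → B) (g : B → C) (t : Mag A) :
    map g (map f t) = map (fun a => g (f a)) t := by
  rw [map, lift_map]; rfl

end

end Mag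

/-- Every label of `A` occurs in the list exactly once. -/
def IsLin {A : Type} (l : List A) : Prop := l.Nodup ∧ ∀ a, a ∈ l

theorem IsLin.length {A : Type} {l : List A} (h : IsLin l) : l.length = Nat.card A := by
  classical
  simpa using Nat.card_congr (List.Nodup.getEquivOfForallMemList l h.1 h.2)

theorem IsLin.map {A B : Type} {l : List A} (h : IsLin l) (e : A ≃ B) : IsLin (l.map e) :=
  ⟨h.1.map e.injective, fun b => List.mem_map.2 ⟨e.symm b, h.2 _, by simp⟩⟩

theorem IsLin.flatMap {A : Type} {K : A → Type} {l : List A} (h : IsLin l) {L : ∀ a, List (K a)}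
    (hL : ∀ a, IsLin (L a)) : IsLin (l.flatMap fun a => (L a).map (Sigma.mk a)) := by
  refine ⟨List.nodup_flatMap.2 ⟨fun a _ => (hL a).1.map sigma_mk_injective, ?_⟩, fun ⟨a, k⟩ => ?_⟩
  · refine h.1.imp fun {a b} hab => ?_
    simp only [Function.onFun, List.disjoint_left, List.mem_map, not_exists, not_and]
    rintro _ ⟨k, _, rfl⟩ k' _ h'
    exact hab (congrArg Sigma.fst h').symm
  · exact List.mem_flatMap.2 ⟨a, h.2 a, List.mem_map.2 ⟨k, (hL a).2 k, rfl⟩⟩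


theorem flatMap_range {A X : Type} (l : List A) (f : A → List X) (n : ℕ) (h : l.length = n) :
    (List.range n).flatMap (fun p => (l[p]?).elim [] f) = l.flatMap f := by
  subst h
  induction l with
  | nil => rfl
  | cons a l ih =>
    rw [List.length_cons, List.range_succ_eq_map, List.flatMap_cons, List.flatMap_map,
      List.flatMap_cons, ← ih]
    simp

/-! ### The operads `Ω₊`, `PaP₊` and `PaB₊` -/

/-- The set `Ω₊(A)` of operations of the unital magma operad with inputs labelled by the finite set
`A`: parenthesized words in which every letter of `A` occurs exactly once. (For `A` empty there is
exactly one, the empty word.) -/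
def OmegaPlus (A : Type) : Type := {t : Mag A // IsLin t.leaves}

namespace OmegaPlus

variable {A : Type}

/-- The order in which the labels occur in the word. -/
def order (x : OmegaPlus A) : List A := Mag.leaves x.1

/-- The symmetric group action, for bijections of label sets. -/
def relabel {B : Type} (e : A ≃ B) (x : OmegaPlus A) : OmegaPlus B :=
  ⟨Mag.map e x.1, by rw [Mag.leaves_map]; exact x.2.map e⟩

/-- The operadic unit. -/
def unit : OmegaPlus Unit := ⟨Mag.of (), by simp [IsLin]⟩

/-- The operadic composition: substitution of the word `y a` for the letter `a`. -/
def comp {K : A → Type} (x : OmegaPlus A) (y : ∀ a, OmegaPlus (K a)) : OmegaPlus (Σ a, K a) :=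
  ⟨Mag.lift (fun a => Mag.map (Sigma.mk a) (y a).1) x.1, by
    rw [Mag.leaves_lift]
    simp only [Mag.leaves_map]
    exact x.2.flatMap fun a => (y a).2⟩

theorem order_relabel {B : Type} (e : A ≃ B) (x : OmegaPlus A) :
    (x.relabel e).order = x.order.map e := Mag.leaves_map _ _

theorem order_comp {K : A → Type} (x : OmegaPlus A) (y : ∀ a, OmegaPlus (K a)) :
    (x.comp y).order = x.order.flatMap fun a => (y a).order.map (Sigma.mk a) := by
  simp [comp, order, Mag.leaves_lift]

theorem length_order (x : OmegaPlus A) : x.order.length = Nat.card A := x.2.length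

end OmegaPlus

/-- Objects of the groupoid `PaP₊(A)` of parenthesized permutations. -/
@[ext]
structure PaP (A : Type) where
  word : OmegaPlus A

/-- In `PaP₊` there is exactly one morphism between two parenthesizations of the same permutation,
and none between parenthesizations of different permutations. -/
instance (A : Type) : Groupoid (PaP A) where
  Hom u u' := PLift (u.word.order = u'.word.order)
  id _ := ⟨rfl⟩
  comp f g := ⟨f.down.trans g.down⟩
  inv f := ⟨f.down.symm⟩

namespace PaP

variable {A : Type}

def relabel {B : Type} (e : A ≃ B) (u : PaP A) : PaP B := ⟨u.word.relabel e⟩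

def relabelMap {B : Type} (e : A ≃ B) {u u' : PaP A} (f : u ⟶ u') : relabel e u ⟶ relabel e u' :=
  ⟨by
    have := f.down
    simp only [relabel, OmegaPlus.order_relabel, this]⟩

def unit : PaP Unit := ⟨OmegaPlus.unit⟩

def comp {K : A → Type} (u : PaP A) (v : ∀ a, PaP (K a)) : PaP (Σ a, K a) :=
  ⟨u.word.comp fun a => (v a).word⟩

def compMap {K : A → Type} {u u' : PaP A} {v v' : ∀ a, PaP (K a)} (f : u ⟶ u')
    (g : ∀ a, v a ⟶ v' a) : comp u v ⟶ comp u' v' :=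
  ⟨by
    have h1 := f.down
    have h2 := fun a => (g a).down
    simp only [comp, OmegaPlus.order_comp, h1, h2]⟩

end PaP

/-- Objects of the groupoid `PaB₊(A)` of parenthesized braids. -/
@[ext]
structure PaB (A : Type) where
  word : OmegaPlus A

/-- A morphism in `PaB₊(A)` is a braid on `|A|` strands which starts with the points labelled
as in the source, and ends with the points labelled as in the target. -/
instance (A : Type) : Groupoid (PaB A) where
  Hom x x' := {b : BraidGroup (Nat.card A) // b.Carries x.word.order x'.word.order}
  id _ := ⟨1, .one _⟩
  comp f g := ⟨f.1 * g.1, f.2.mul g.2⟩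
  inv f := ⟨f.1⁻¹, f.2.inv⟩
  id_comp _ := Subtype.ext (one_mul _)
  comp_id _ := Subtype.ext (mul_one _)
  assoc _ _ _ := Subtype.ext (mul_assoc _ _ _)
  inv_comp _ := Subtype.ext (inv_mul_cancel _)
  comp_inv _ := Subtype.ext (mul_inv_cancel _)

namespace PaB

variable {A : Type}

def relabel {B : Type} (e : A ≃ B) (x : PaB A) : PaB B := ⟨x.word.relabel e⟩

/-- Relabelling does not change the braid. (`place` only identifies the braid groups on `|A|` and on
`|B|` strands.) -/
def relabelMap {B : Type} (e : A ≃ B) {x x' : PaB A} (f : x ⟶ x') : relabel e x ⟶ relabel e x' :=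
  ⟨BraidGroup.place (Nat.card A) (Nat.card B) 0 f.1, by
    have := (f.2.map e).place (N := Nat.card B) (k := 0)
      (by rw [List.length_map, OmegaPlus.length_order])
      (by rw [List.length_map, OmegaPlus.length_order])
      (by rw [Nat.card_congr e, zero_add]) [] [] rfl
    simp only [List.nil_append, List.append_nil] at this
    rw [relabel, relabel, OmegaPlus.order_relabel, OmegaPlus.order_relabel]
    exact this⟩

def unit : PaB Unit := ⟨OmegaPlus.unit⟩

def comp {K : A → Type} (x : PaB A) (y : ∀ a, PaB (K a)) : PaB (Σ a, K a) :=
  ⟨x.word.comp fun a => (y a).word⟩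

/-- Composition of braids: the braids `g a` are inserted into the strands of the braid `f`, that is,
they are put side by side in the order of the source of `f`, and are followed by `f` with
the strand labelled by `a` replaced by `|K a|` parallel strands. -/
def compMap {K : A → Type} {x x' : PaB A} {y y' : ∀ a, PaB (K a)} (f : x ⟶ x')
    (g : ∀ a, y a ⟶ y' a) : comp x y ⟶ comp x' y' :=
  ⟨BraidGroup.sideBySide (Nat.card (Σ a, K a)) (fun a => Nat.card (K a)) (fun a => (g a).1) 0
        x.word.order *
      BraidGroup.cable (Nat.card A) (Nat.card (Σ a, K a)) f.1
        (fun p => (x.word.order[p]?).elim 0 fun a => Nat.card (K a)), by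
    have hx := x.word.length_order
    have hx' := x'.word.length_order
    have hlen : (x.word.order.flatMap
        fun a => (y a).word.order.map (Sigma.mk a)).length = Nat.card (Σ a, K a) := by
      rw [← OmegaPlus.order_comp]; exact OmegaPlus.length_order _
    have hlen' : (x.word.order.flatMap
        fun a => (y' a).word.order.map (Sigma.mk a)).length = Nat.card (Σ a, K a) := by
      rw [← OmegaPlus.order_comp _ fun a => (y' a).word]; exact OmegaPlus.length_order _
    rw [comp, comp, OmegaPlus.order_comp, OmegaPlus.order_comp]
    refine BraidGroup.Carries.mul (l' := x.word.order.flatMap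
        fun a => (y' a).word.order.map (Sigma.mk a)) ?_ ?_
    · have := BraidGroup.carries_sideBySide (N := Nat.card (Σ a, K a))
        (n := fun a => Nat.card (K a)) (g := fun a => (g a).1)
        (L := fun a => (y a).word.order.map (Sigma.mk a))
        (L' := fun a => (y' a).word.order.map (Sigma.mk a))
        (fun a => (g a).2.map _) (fun a => by rw [List.length_map, OmegaPlus.length_order])
        (fun a => by rw [List.length_map, OmegaPlus.length_order]) x.word.order []
        (by rw [hlen]; simp)
      simpa using this
    · have h := BraidGroup.carries_cable (N := Nat.card (Σ a, K a)) f.1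
        (fun p => (x.word.order[p]?).elim []
          fun a => (y' a).word.order.map (Sigma.mk a))
        (by rw [← BraidGroup.length_flatMap_range, flatMap_range _ _ _ hx, hlen'])
      have e : (fun p : ℕ => (x.word.order[p]?).elim []
          fun a => (y' a).word.order.map (Sigma.mk a)) ∘ BraidGroup.perm _ f.1 =
          fun p : ℕ => (x'.word.order[p]?).elim []
            fun a => (y' a).word.order.map (Sigma.mk a) := by
        funext p
        rw [f.2 p]
        rfl
      have e' : (fun p : ℕ => ((x.word.order[p]?).elim []
          fun a => (y' a).word.order.map (Sigma.mk a)).length) =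
          fun p : ℕ => (x.word.order[p]?).elim 0 fun a => Nat.card (K a) := by
        funext p
        rcases x.word.order[p]? with _ | a
        · rfl
        · simp [OmegaPlus.length_order]
      rw [e, flatMap_range _ _ _ hx, flatMap_range _ _ _ hx', e'] at h
      exact h⟩

end PaB

/-! ### The relative magma operad -/

/-- The free unital magma on the set of open letters `A` and of the symbols `f t`, for the nonempty
parenthesized words `t` in the closed letters `B`. This is the open part of the free pair of unital
magmas `M`, `N` with a map `f : M → N`, `f 1 = 1`, on generators `B` of `M` and `A` of `N`. -/
abbrev OMag (A B : Type) : Type := Mag (A ⊕ FreeMagma B)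

namespace OMag

variable {A B : Type}

/-- The map `f` from closed words to open words; `f 1 = 1`. -/
def f (t : Mag B) : OMag A B :=
  WithOne.recOneCoe (motive := fun _ => OMag A B) 1 (fun s => Mag.of (Sum.inr s)) t

/-- The parenthesized word in all letters which is obtained by dropping all the symbols `f`. -/
def flat : OMag A B →* Mag (A ⊕ B) :=
  Mag.lift (Sum.elim (fun a => Mag.of (Sum.inl a)) fun s => Mag.map Sum.inr (s : Mag B))

/-- Substitution of the empty word for all open letters, followed by dropping all symbols `f`: this is
`U (μ (*, …, *))`. -/
def closedPart : OMag A B →* Mag B := Mag.lift (Sum.elim (fun _ => 1) fun s => (s : Mag B))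

/-- Replacement of the letters. -/
def relabel {A' B' : Type} (g : A → A') (h : B → B') : OMag A B →* OMag A' B' :=
  Mag.lift (Sum.elim (fun a => Mag.of (Sum.inl (g a))) fun s => Mag.of (Sum.inr (FreeMagma.map h s)))

/-- Substitution of the open word `ν a` for the open letter `a`, for all `a`. -/
def substOpen {K L : A → Type} (μ : OMag A B) (ν : ∀ a, OMag (K a) (L a)) :
    OMag (Σ a, K a) (B ⊕ Σ a, L a) :=
  Mag.lift (Sum.elim (fun a => relabel (Sigma.mk a) (fun l => Sum.inr ⟨a, l⟩) (ν a))
    fun s => Mag.of (Sum.inr (FreeMagma.map Sum.inl s))) μ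

/-- Substitution of the closed word `t b` for the closed letter `b`, for all `b`. -/
def substClosed {M : B → Type} (μ : OMag A B) (t : ∀ b, Mag (M b)) : OMag A (Σ b, M b) :=
  Mag.lift (Sum.elim (fun a => Mag.of (Sum.inl a))
    fun s : FreeMagma B => f (Mag.lift (fun b => Mag.map (Sigma.mk b) (t b)) (s : Mag B))) μ

theorem coe_map {B' : Type} (h : B → B') (s : FreeMagma B) :
    ((FreeMagma.map h s : FreeMagma B') : Mag B') = Mag.map h (s : Mag B) := by
  induction s using FreeMagma.recOnMul with
  | ih1 b => rfl
  | ih2 s t hs ht => rw [map_mul, WithOne.coe_mul, hs, ht, WithOne.coe_mul, map_mul]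

theorem flat_of_inr (s : FreeMagma B) :
    flat (Mag.of (Sum.inr s) : OMag A B) = Mag.map Sum.inr (s : Mag B) := rfl

theorem flat_f (t : Mag B) : flat (f t : OMag A B) = Mag.map Sum.inr t := by
  induction t using WithOne.recOneCoe with
  | one => simp [f]
  | coe s => rfl

theorem closedPart_f (t : Mag B) : closedPart (f t : OMag A B) = t := by
  induction t using WithOne.recOneCoe with
  | one => simp [f]
  | coe s => rfl

theorem flat_relabel {A' B' : Type} (g : A → A') (h : B → B') (μ : OMag A B) :
    flat (relabel g h μ) = Mag.map (Sum.map g h) (flat μ) := by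
  rw [relabel, flat, flat, Mag.lift_lift, Mag.map_lift]
  congr 2
  funext c
  rcases c with a | s
  · rfl
  · simp [coe_map, Mag.map_map]

theorem closedPart_relabel {A' B' : Type} (g : A → A') (h : B → B') (μ : OMag A B) :
    closedPart (relabel g h μ) = Mag.map h (closedPart μ) := by
  rw [relabel, closedPart, closedPart, Mag.lift_lift, Mag.map_lift]
  congr 2
  funext c
  rcases c with a | s
  · simp
  · simp [coe_map]

theorem flat_substOpen {K L : A → Type} (μ : OMag A B) (ν : ∀ a, OMag (K a) (L a)) :
    flat (substOpen μ ν) =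
      Mag.lift (Sum.elim
        (fun a => Mag.map (Sum.map (Sigma.mk a) fun l => Sum.inr ⟨a, l⟩) (flat (ν a)))
        fun b => Mag.of (Sum.inr (Sum.inl b))) (flat μ) := by
  conv_rhs => enter [2]; rw [flat]
  rw [substOpen, Mag.lift_lift]
  conv_lhs => rw [flat, Mag.lift_lift]
  congr 2
  funext c
  rcases c with a | s
  · exact flat_relabel _ _ _
  · simp only [Sum.elim_inr, Mag.lift_of, coe_map, Mag.map_map, Mag.lift_map]
    rfl

theorem closedPart_substOpen {K L : A → Type} (μ : OMag A B) (ν : ∀ a, OMag (K a) (L a)) :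
    closedPart (substOpen μ ν) =
      Mag.lift (Sum.elim
        (fun a => Mag.map (fun l => Sum.inr ⟨a, l⟩) (closedPart (ν a)))
        fun b => Mag.of (Sum.inl b)) (flat μ) := by
  rw [substOpen, flat, Mag.lift_lift]
  conv_lhs => rw [closedPart, Mag.lift_lift]
  congr 2
  funext c
  rcases c with a | s
  · exact closedPart_relabel _ _ _
  · simp only [Sum.elim_inr, Mag.lift_of, coe_map, Mag.lift_map]
    rfl

theorem flat_substClosed {M : B → Type} (μ : OMag A B) (t : ∀ b, Mag (M b)) :
    flat (substClosed μ t) =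
      Mag.lift (Sum.elim (fun a => Mag.of (Sum.inl a))
        fun b => Mag.map (fun m => Sum.inr ⟨b, m⟩) (t b)) (flat μ) := by
  conv_rhs => enter [2]; rw [flat]
  rw [substClosed, Mag.lift_lift]
  conv_lhs => rw [flat, Mag.lift_lift]
  congr 2
  funext c
  rcases c with a | s
  · rfl
  · refine (flat_f _).trans ?_
    simp only [Sum.elim_inr, Mag.lift_map, Mag.map_lift, Mag.map_map]

theorem closedPart_substClosed {M : B → Type} (μ : OMag A B) (t : ∀ b, Mag (M b)) :
    closedPart (substClosed μ t) =
      Mag.lift (fun b => Mag.map (Sigma.mk b) (t b)) (closedPart μ) := by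
  conv_rhs => enter [2]; rw [closedPart]
  rw [substClosed, Mag.lift_lift]
  conv_lhs => rw [closedPart, Mag.lift_lift]
  congr 2
  funext c
  rcases c with a | s
  · simp
  · exact closedPart_f _

theorem leaves_closedPart (μ : OMag A B) :
    (closedPart μ).leaves = (flat μ).leaves.filterMap Sum.getRight? := by
  induction μ using Mag.induction with
  | one => simp
  | of c =>
    rcases c with a | s
    · rfl
    · rw [flat_of_inr, Mag.leaves_map, List.filterMap_map]
      change _ = List.filterMap some _
      rw [List.filterMap_some]
      rfl
  | mul s t hs ht => simp [hs, ht, List.filterMap_append]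

end OMag

/-- The set of operations with open output of the unital relative magma operad on the generators
`μ_c`, `f`, `μ_o`, with open inputs labelled by `A` and closed inputs labelled by `B`: words in which
every letter of `A` and of `B` occurs exactly once. -/
def MagmaMagma (A B : Type) : Type := {μ : OMag A B // IsLin (OMag.flat μ).leaves}

namespace MagmaMagma

variable {A B : Type}

/-- The word in all letters. -/
def flat (μ : MagmaMagma A B) : OmegaPlus (A ⊕ B) := ⟨OMag.flat μ.1, μ.2⟩

/-- The order of the open (terrestrial) letters. -/
def openOrder (μ : MagmaMagma A B) : List A := μ.flat.order.filterMap Sum.getLeft?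

/-- The order of the closed (aerial) letters. -/
def closedOrder (μ : MagmaMagma A B) : List B := μ.flat.order.filterMap Sum.getRight?

theorem _root_.IsLin.filterMap_right {l : List (A ⊕ B)} (h : IsLin l) :
    IsLin (l.filterMap Sum.getRight?) := by
  refine ⟨h.1.filterMap ?_, fun b => List.mem_filterMap.2 ⟨Sum.inr b, h.2 _, rfl⟩⟩
  rintro (a | b) (a' | b') <;> simp [eq_comm]

/-- `U (μ (*, …, *))`. -/
def closedPart (μ : MagmaMagma A B) : OmegaPlus B :=
  ⟨OMag.closedPart μ.1, by rw [OMag.leaves_closedPart]; exact μ.2.filterMap_right⟩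

theorem order_closedPart (μ : MagmaMagma A B) : μ.closedPart.order = μ.closedOrder :=
  OMag.leaves_closedPart _

def relabel {A' B' : Type} (e : A ≃ A') (e' : B ≃ B') (μ : MagmaMagma A B) : MagmaMagma A' B' :=
  ⟨OMag.relabel e e' μ.1, by
    rw [OMag.flat_relabel, Mag.leaves_map]
    exact μ.2.map (e.sumCongr e')⟩

def unit : MagmaMagma Unit Empty := ⟨Mag.of (Sum.inl ()), by
  refine ⟨List.nodup_singleton _, fun c => ?_⟩
  rcases c with ⟨⟩ | ⟨⟨⟩⟩
  exact List.mem_singleton.2 rfl⟩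

def comp {K L : A → Type} (μ : MagmaMagma A B) (ν : ∀ a, MagmaMagma (K a) (L a)) :
    MagmaMagma (Σ a, K a) (B ⊕ Σ a, L a) :=
  ⟨OMag.substOpen μ.1 fun a => (ν a).1, by
    rw [OMag.flat_substOpen, Mag.leaves_lift]
    have := μ.2
    refine ⟨List.nodup_flatMap.2 ⟨?_, ?_⟩, ?_⟩
    · rintro (a | b) _
      · simp only [Sum.elim_inl, Mag.leaves_map]
        refine (ν a).2.1.map ?_
        refine Sum.map_injective.2 ⟨sigma_mk_injective, fun l l' h => ?_⟩
        exact sigma_mk_injective (Sum.inr_injective h)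
      · exact List.nodup_singleton _
    · refine this.1.imp fun {c c'} hcc => ?_
      rcases c with a | b <;> rcases c' with a' | b' <;>
        simp only [Function.onFun, Sum.elim_inl, Sum.elim_inr, Mag.leaves_map, Mag.leaves_of,
          List.disjoint_left, List.mem_map, not_exists, not_and, List.mem_singleton] <;>
        rintro x hx
      · obtain ⟨d, _, rfl⟩ := hx
        rintro d' _ h
        rcases d with k | l <;> rcases d' with k' | l' <;> simp at h hcc <;> tauto
      · obtain ⟨d, _, rfl⟩ := hx
        rcases d with k | l <;> simp
      · subst hx
        rintro d' _ h
        rcases d' with k' | l' <;> simp at h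
      · subst hx
        simpa using hcc
    · rintro (⟨a, k⟩ | b | ⟨a, l⟩)
      · exact List.mem_flatMap.2 ⟨Sum.inl a, this.2 _, by
          simpa using (ν a).2.2 (Sum.inl k)⟩
      · exact List.mem_flatMap.2 ⟨Sum.inr b, this.2 _, by simp⟩
      · exact List.mem_flatMap.2 ⟨Sum.inl a, this.2 _, by
          simpa using (ν a).2.2 (Sum.inr l)⟩⟩

def act {M : B → Type} (μ : MagmaMagma A B) (t : ∀ b, OmegaPlus (M b)) :
    MagmaMagma A (Σ b, M b) :=
  ⟨OMag.substClosed μ.1 fun b => (t b).1, by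
    rw [OMag.flat_substClosed, Mag.leaves_lift]
    have := μ.2
    refine ⟨List.nodup_flatMap.2 ⟨?_, ?_⟩, ?_⟩
    · rintro (a | b) _
      · exact List.nodup_singleton _
      · simp only [Sum.elim_inr, Mag.leaves_map]
        exact (t b).2.1.map fun l l' h => sigma_mk_injective (Sum.inr_injective h)
    · refine this.1.imp fun {c c'} hcc => ?_
      rcases c with a | b <;> rcases c' with a' | b' <;>
        simp only [Function.onFun, Sum.elim_inl, Sum.elim_inr, Mag.leaves_map, Mag.leaves_of,
          List.disjoint_left, List.mem_map, not_exists, not_and, List.mem_singleton] <;>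
        rintro x hx
      · subst hx
        simpa using hcc
      · subst hx
        simp
      · obtain ⟨d, _, rfl⟩ := hx
        simp
      · obtain ⟨d, _, rfl⟩ := hx
        rintro d' _ h
        simp at h hcc
        tauto
    · rintro (a | ⟨b, m⟩)
      · exact List.mem_flatMap.2 ⟨Sum.inl a, this.2 _, by simp⟩
      · exact List.mem_flatMap.2 ⟨Sum.inr b, this.2 _, by
          simpa using (t b).2.2 m⟩⟩

theorem openOrder_relabel {A' B' : Type} (e : A ≃ A') (e' : B ≃ B') (μ : MagmaMagma A B) :
    (μ.relabel e e').openOrder = μ.openOrder.map e := by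
  simp only [openOrder, relabel, flat, OmegaPlus.order, OMag.flat_relabel, Mag.leaves_map,
    List.filterMap_map, List.map_filterMap]
  refine List.filterMap_congr fun c _ => ?_
  rcases c with a | b <;> rfl

theorem openOrder_comp {K L : A → Type} (μ : MagmaMagma A B) (ν : ∀ a, MagmaMagma (K a) (L a)) :
    (μ.comp ν).openOrder = μ.openOrder.flatMap fun a => (ν a).openOrder.map (Sigma.mk a) := by
  simp only [openOrder, comp, flat, OmegaPlus.order, OMag.flat_substOpen, Mag.leaves_lift]
  generalize (OMag.flat μ.1).leaves = l
  induction l with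
  | nil => rfl
  | cons c l ih =>
    rw [List.flatMap_cons, List.filterMap_append, ih]
    rcases c with a | b
    · simp only [Sum.elim_inl, Mag.leaves_map, List.filterMap_map, List.filterMap_cons,
        Sum.getLeft?, List.flatMap_cons, List.map_filterMap]
      congr 1
      refine List.filterMap_congr fun c _ => ?_
      rcases c with a | b <;> rfl
    · simp [List.filterMap_cons]

theorem openOrder_act {M : B → Type} (μ : MagmaMagma A B) (t : ∀ b, OmegaPlus (M b)) :
    (μ.act t).openOrder = μ.openOrder := by
  simp only [openOrder, act, flat, OmegaPlus.order, OMag.flat_substClosed, Mag.leaves_lift]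
  generalize (OMag.flat μ.1).leaves = l
  induction l with
  | nil => rfl
  | cons c l ih =>
    rw [List.flatMap_cons, List.filterMap_append, ih]
    rcases c with a | b
    · simp
    · simp [List.filterMap_cons, List.filterMap_map]

end MagmaMagma

/-! ### Operads and relative operads in groupoids -/

/-- The data of a symmetric operad in groupoids, with inputs labelled by the elements of (finite) sets:
groupoids `P(A)`, functors `P(A) → P(B)` for the bijections `A ≃ B`, a unit in `P({∗})`, and compositions
`P(A) × ∏ₐ P(Kₐ) → P(∐ₐ Kₐ)`. -/
structure OperadData where
  Obj : Type → Type
  grpd : ∀ A, Groupoid (Obj A)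
  relabel {A B : Type} (e : A ≃ B) : Obj A → Obj B
  relabelMap {A B : Type} (e : A ≃ B) {x x' : Obj A} (f : x ⟶ x') : relabel e x ⟶ relabel e x'
  unit : Obj Unit
  comp {A : Type} {K : A → Type} (x : Obj A) (y : ∀ a, Obj (K a)) : Obj (Σ a, K a)
  compMap {A : Type} {K : A → Type} {x x' : Obj A} {y y' : ∀ a, Obj (K a)}
    (f : x ⟶ x') (g : ∀ a, y a ⟶ y' a) : comp x y ⟶ comp x' y'

attribute [instance] OperadData.grpd

/-- The axioms of a symmetric operad in groupoids. All equations between morphisms are stated together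
with the equations between their sources and targets. -/
structure IsOperad (P : OperadData) : Prop where
  relabelMap_id {A B : Type} [Finite A] (e : A ≃ B) (x : P.Obj A) :
    P.relabelMap e (𝟙 x) = 𝟙 (P.relabel e x)
  relabelMap_comp {A B : Type} [Finite A] (e : A ≃ B) {x x' x'' : P.Obj A}
    (f : x ⟶ x') (f' : x' ⟶ x'') :
    P.relabelMap e (f ≫ f') = P.relabelMap e f ≫ P.relabelMap e f'
  relabel_refl {A : Type} [Finite A] (x : P.Obj A) : P.relabel (Equiv.refl A) x = x
  relabelMap_refl {A : Type} [Finite A] {x x' : P.Obj A} (f : x ⟶ x') :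
    HEq (P.relabelMap (Equiv.refl A) f) f
  relabel_trans {A B C : Type} [Finite A] (e : A ≃ B) (e' : B ≃ C) (x : P.Obj A) :
    P.relabel (e.trans e') x = P.relabel e' (P.relabel e x)
  relabelMap_trans {A B C : Type} [Finite A] (e : A ≃ B) (e' : B ≃ C) {x x' : P.Obj A}
    (f : x ⟶ x') : HEq (P.relabelMap (e.trans e') f) (P.relabelMap e' (P.relabelMap e f))
  compMap_id {A : Type} {K : A → Type} [Finite A] [∀ a, Finite (K a)] (x : P.Obj A)
    (y : ∀ a, P.Obj (K a)) : P.compMap (𝟙 x) (fun a => 𝟙 (y a)) = 𝟙 (P.comp x y)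
  compMap_comp {A : Type} {K : A → Type} [Finite A] [∀ a, Finite (K a)] {x x' x'' : P.Obj A}
    {y y' y'' : ∀ a, P.Obj (K a)} (f : x ⟶ x') (f' : x' ⟶ x'') (g : ∀ a, y a ⟶ y' a)
    (g' : ∀ a, y' a ⟶ y'' a) :
    P.compMap (f ≫ f') (fun a => g a ≫ g' a) = P.compMap f g ≫ P.compMap f' g'
  comp_relabel_left {A A' : Type} {K : A' → Type} [Finite A] [∀ a, Finite (K a)] (e : A ≃ A')
    (x : P.Obj A) (y : ∀ a, P.Obj (K a)) :
    P.relabel (Equiv.sigmaCongrLeft e) (P.comp x fun a => y (e a)) = P.comp (P.relabel e x) y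
  compMap_relabel_left {A A' : Type} {K : A' → Type} [Finite A] [∀ a, Finite (K a)] (e : A ≃ A')
    {x x' : P.Obj A} {y y' : ∀ a, P.Obj (K a)} (f : x ⟶ x') (g : ∀ a, y a ⟶ y' a) :
    HEq (P.relabelMap (Equiv.sigmaCongrLeft e) (P.compMap f fun a => g (e a)))
      (P.compMap (P.relabelMap e f) g)
  comp_relabel_right {A : Type} {K K' : A → Type} [Finite A] [∀ a, Finite (K a)]
    (e : ∀ a, K a ≃ K' a) (x : P.Obj A) (y : ∀ a, P.Obj (K a)) :
    P.relabel (Equiv.sigmaCongrRight e) (P.comp x y) = P.comp x fun a => P.relabel (e a) (y a)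
  compMap_relabel_right {A : Type} {K K' : A → Type} [Finite A] [∀ a, Finite (K a)]
    (e : ∀ a, K a ≃ K' a) {x x' : P.Obj A} {y y' : ∀ a, P.Obj (K a)} (f : x ⟶ x')
    (g : ∀ a, y a ⟶ y' a) :
    HEq (P.relabelMap (Equiv.sigmaCongrRight e) (P.compMap f g))
      (P.compMap f fun a => P.relabelMap (e a) (g a))
  unit_comp {K : Type} [Finite K] (y : P.Obj K) :
    P.relabel (Equiv.uniqueSigma fun _ : Unit => K) (P.comp P.unit fun _ => y) = y
  unit_compMap {K : Type} [Finite K] {y y' : P.Obj K} (g : y ⟶ y') :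
    HEq (P.relabelMap (Equiv.uniqueSigma fun _ : Unit => K)
      (P.compMap (𝟙 P.unit) fun _ => g)) g
  comp_unit {A : Type} [Finite A] (x : P.Obj A) :
    P.relabel (Equiv.sigmaPUnit A) (P.comp x fun _ => P.unit) = x
  compMap_unit {A : Type} [Finite A] {x x' : P.Obj A} (f : x ⟶ x') :
    HEq (P.relabelMap (Equiv.sigmaPUnit A) (P.compMap f fun _ => 𝟙 P.unit)) f
  comp_assoc {A : Type} {K : A → Type} {M : ∀ a, K a → Type} [Finite A] [∀ a, Finite (K a)]
    [∀ a k, Finite (M a k)] (x : P.Obj A) (y : ∀ a, P.Obj (K a)) (z : ∀ a k, P.Obj (M a k)) :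
    P.relabel (Equiv.sigmaAssoc M) (P.comp (P.comp x y) fun i => z i.1 i.2) =
      P.comp x fun a => P.comp (y a) (z a)
  compMap_assoc {A : Type} {K : A → Type} {M : ∀ a, K a → Type} [Finite A] [∀ a, Finite (K a)]
    [∀ a k, Finite (M a k)] {x x' : P.Obj A} {y y' : ∀ a, P.Obj (K a)}
    {z z' : ∀ a k, P.Obj (M a k)} (f : x ⟶ x') (g : ∀ a, y a ⟶ y' a)
    (h : ∀ a k, z a k ⟶ z' a k) :
    HEq (P.relabelMap (Equiv.sigmaAssoc M) (P.compMap (P.compMap f g) fun i => h i.1 i.2))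
      (P.compMap f fun a => P.compMap (g a) (h a))

/-- The data of an operad in the category of right modules over `P`: groupoids `Q(A, B)`, with open
inputs labelled by `A` and closed inputs labelled by `B`, the symmetric group actions, the right
`P`-module structure `Q(A, B) × ∏_b P(M_b) → Q(A, ∐_b M_b)`, the unit in `Q({∗}, ∅)`, and the compositions
`Q(A, B) × ∏ₐ Q(Kₐ, Lₐ) → Q(∐ₐ Kₐ, B ⊔ ∐ₐ Lₐ)`. -/
structure RelativeOperadData (P : OperadData) where
  Obj : Type → Type → Type
  grpd : ∀ A B, Groupoid (Obj A B)
  relabel {A A' B B' : Type} (e : A ≃ A') (e' : B ≃ B') : Obj A B → Obj A' B'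
  relabelMap {A A' B B' : Type} (e : A ≃ A') (e' : B ≃ B') {p p' : Obj A B} (f : p ⟶ p') :
    relabel e e' p ⟶ relabel e e' p'
  act {A B : Type} {M : B → Type} (p : Obj A B) (y : ∀ b, P.Obj (M b)) : Obj A (Σ b, M b)
  actMap {A B : Type} {M : B → Type} {p p' : Obj A B} {y y' : ∀ b, P.Obj (M b)} (f : p ⟶ p')
    (g : ∀ b, y b ⟶ y' b) : act p y ⟶ act p' y'
  unit : Obj Unit Empty
  comp {A B : Type} {K L : A → Type} (p : Obj A B) (q : ∀ a, Obj (K a) (L a)) :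
    Obj (Σ a, K a) (B ⊕ Σ a, L a)
  compMap {A B : Type} {K L : A → Type} {p p' : Obj A B} {q q' : ∀ a, Obj (K a) (L a)}
    (f : p ⟶ p') (g : ∀ a, q a ⟶ q' a) : comp p q ⟶ comp p' q'

attribute [instance] RelativeOperadData.grpd

/-- `B ⊔ ∐ₐ Lₐ ⊔ ∐ₐ ∐ₖ L'ₐₖ ≃ B ⊔ ∐ₐ (Lₐ ⊔ ∐ₖ L'ₐₖ)`, for the closed inputs in the associativity
axiom. -/
def closedAssoc {A B : Type} {K L : A → Type} (L' : ∀ a, K a → Type) :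
    ((B ⊕ Σ a, L a) ⊕ Σ i : Σ a, K a, L' i.1 i.2) ≃ (B ⊕ Σ a, (L a ⊕ Σ k, L' a k)) :=
  (Equiv.sumAssoc _ _ _).trans
    (Equiv.sumCongr (Equiv.refl B)
      ((Equiv.sumCongr (Equiv.refl _) (Equiv.sigmaAssoc L')).trans
        (Equiv.sigmaSumDistrib L fun a => Σ k, L' a k).symm))

/-- `B ⊔ ∐ₐ ∅ ≃ B`, for the closed inputs in the unit axiom. -/
def sumEmptyFamily (A B : Type) : (B ⊕ Σ _ : A, Empty) ≃ B :=
  haveI : IsEmpty (Σ _ : A, Empty) := ⟨fun i => i.2.elim⟩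
  Equiv.sumEmpty _ _

/-- The label sets for the action on a composite. -/
abbrev sumLabels {A B : Type} {L : A → Type} (M : B → Type) (M' : ∀ a, L a → Type) :
    (B ⊕ Σ a, L a) → Type :=
  Sum.elim M fun i => M' i.1 i.2

/-- The family over `B ⊔ ∐ₐ Lₐ` which consists of a family over `B` and of families over the `Lₐ`. -/
def sumFamily {A B : Type} {L : A → Type} {M : B → Type} {M' : ∀ a, L a → Type}
    (F : Type → Type) (y : ∀ b, F (M b)) (z : ∀ a l, F (M' a l)) :
    ∀ c, F (sumLabels M M' c)
  | Sum.inl b => y b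
  | Sum.inr i => z i.1 i.2

def sumFamilyMap {P : OperadData} {A B : Type} {L : A → Type} {M : B → Type}
    {M' : ∀ a, L a → Type} {y y' : ∀ b, P.Obj (M b)} {z z' : ∀ a l, P.Obj (M' a l)}
    (g : ∀ b, y b ⟶ y' b) (h : ∀ a l, z a l ⟶ z' a l) :
    ∀ c, sumFamily P.Obj y z c ⟶ sumFamily P.Obj y' z' c
  | Sum.inl b => g b
  | Sum.inr i => h i.1 i.2

def sumLabelsEquiv {A B : Type} {L : A → Type} (M : B → Type) (M' : ∀ a, L a → Type) :
    (Σ c, sumLabels M M' c) ≃ (Σ b, M b) ⊕ Σ a, Σ l, M' a l :=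
  (Equiv.sumSigmaDistrib _).trans (Equiv.sumCongr (Equiv.refl _) (Equiv.sigmaAssoc M'))

/-- The axioms of an operad in the category of right modules over the operad `P`, that is, of a
relative operad over `P`. -/
structure IsRelativeOperad {P : OperadData} (Q : RelativeOperadData P) : Prop where
  isOperad : IsOperad P
  -- the symmetric group actions
  relabelMap_id {A A' B B' : Type} [Finite A] [Finite B] (e : A ≃ A') (e' : B ≃ B')
    (p : Q.Obj A B) : Q.relabelMap e e' (𝟙 p) = 𝟙 (Q.relabel e e' p)
  relabelMap_comp {A A' B B' : Type} [Finite A] [Finite B] (e : A ≃ A') (e' : B ≃ B')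
    {p p' p'' : Q.Obj A B} (f : p ⟶ p') (f' : p' ⟶ p'') :
    Q.relabelMap e e' (f ≫ f') = Q.relabelMap e e' f ≫ Q.relabelMap e e' f'
  relabel_refl {A B : Type} [Finite A] [Finite B] (p : Q.Obj A B) :
    Q.relabel (Equiv.refl A) (Equiv.refl B) p = p
  relabelMap_refl {A B : Type} [Finite A] [Finite B] {p p' : Q.Obj A B} (f : p ⟶ p') :
    HEq (Q.relabelMap (Equiv.refl A) (Equiv.refl B) f) f
  relabel_trans {A A' A'' B B' B'' : Type} [Finite A] [Finite B] (e : A ≃ A') (d : A' ≃ A'')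
    (e' : B ≃ B') (d' : B' ≃ B'') (p : Q.Obj A B) :
    Q.relabel (e.trans d) (e'.trans d') p = Q.relabel d d' (Q.relabel e e' p)
  relabelMap_trans {A A' A'' B B' B'' : Type} [Finite A] [Finite B] (e : A ≃ A') (d : A' ≃ A'')
    (e' : B ≃ B') (d' : B' ≃ B'') {p p' : Q.Obj A B} (f : p ⟶ p') :
    HEq (Q.relabelMap (e.trans d) (e'.trans d') f) (Q.relabelMap d d' (Q.relabelMap e e' f))
  -- the right module structure
  actMap_id {A B : Type} {M : B → Type} [Finite A] [Finite B] [∀ b, Finite (M b)]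
    (p : Q.Obj A B) (y : ∀ b, P.Obj (M b)) :
    Q.actMap (𝟙 p) (fun b => 𝟙 (y b)) = 𝟙 (Q.act p y)
  actMap_comp {A B : Type} {M : B → Type} [Finite A] [Finite B] [∀ b, Finite (M b)]
    {p p' p'' : Q.Obj A B} {y y' y'' : ∀ b, P.Obj (M b)} (f : p ⟶ p') (f' : p' ⟶ p'')
    (g : ∀ b, y b ⟶ y' b) (g' : ∀ b, y' b ⟶ y'' b) :
    Q.actMap (f ≫ f') (fun b => g b ≫ g' b) = Q.actMap f g ≫ Q.actMap f' g'
  act_relabel_left {A A' B B' : Type} {M : B' → Type} [Finite A] [Finite B] [∀ b, Finite (M b)]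
    (e : A ≃ A') (e' : B ≃ B') (p : Q.Obj A B) (y : ∀ b, P.Obj (M b)) :
    Q.relabel e (Equiv.sigmaCongrLeft e') (Q.act p fun b => y (e' b)) =
      Q.act (Q.relabel e e' p) y
  actMap_relabel_left {A A' B B' : Type} {M : B' → Type} [Finite A] [Finite B]
    [∀ b, Finite (M b)] (e : A ≃ A') (e' : B ≃ B') {p p' : Q.Obj A B} {y y' : ∀ b, P.Obj (M b)}
    (f : p ⟶ p') (g : ∀ b, y b ⟶ y' b) :
    HEq (Q.relabelMap e (Equiv.sigmaCongrLeft e') (Q.actMap f fun b => g (e' b)))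
      (Q.actMap (Q.relabelMap e e' f) g)
  act_relabel_right {A B : Type} {M M' : B → Type} [Finite A] [Finite B] [∀ b, Finite (M b)]
    (d : ∀ b, M b ≃ M' b) (p : Q.Obj A B) (y : ∀ b, P.Obj (M b)) :
    Q.relabel (Equiv.refl A) (Equiv.sigmaCongrRight d) (Q.act p y) =
      Q.act p fun b => P.relabel (d b) (y b)
  actMap_relabel_right {A B : Type} {M M' : B → Type} [Finite A] [Finite B] [∀ b, Finite (M b)]
    (d : ∀ b, M b ≃ M' b) {p p' : Q.Obj A B} {y y' : ∀ b, P.Obj (M b)} (f : p ⟶ p')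
    (g : ∀ b, y b ⟶ y' b) :
    HEq (Q.relabelMap (Equiv.refl A) (Equiv.sigmaCongrRight d) (Q.actMap f g))
      (Q.actMap f fun b => P.relabelMap (d b) (g b))
  act_unit {A B : Type} [Finite A] [Finite B] (p : Q.Obj A B) :
    Q.relabel (Equiv.refl A) (Equiv.sigmaPUnit B) (Q.act p fun _ => P.unit) = p
  actMap_unit {A B : Type} [Finite A] [Finite B] {p p' : Q.Obj A B} (f : p ⟶ p') :
    HEq (Q.relabelMap (Equiv.refl A) (Equiv.sigmaPUnit B) (Q.actMap f fun _ => 𝟙 P.unit)) f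
  act_act {A B : Type} {M : B → Type} {N : ∀ b, M b → Type} [Finite A] [Finite B]
    [∀ b, Finite (M b)] [∀ b m, Finite (N b m)] (p : Q.Obj A B) (y : ∀ b, P.Obj (M b))
    (z : ∀ b m, P.Obj (N b m)) :
    Q.relabel (Equiv.refl A) (Equiv.sigmaAssoc N) (Q.act (Q.act p y) fun i => z i.1 i.2) =
      Q.act p fun b => P.comp (y b) (z b)
  actMap_actMap {A B : Type} {M : B → Type} {N : ∀ b, M b → Type} [Finite A] [Finite B]
    [∀ b, Finite (M b)] [∀ b m, Finite (N b m)] {p p' : Q.Obj A B} {y y' : ∀ b, P.Obj (M b)}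
    {z z' : ∀ b m, P.Obj (N b m)} (f : p ⟶ p') (g : ∀ b, y b ⟶ y' b)
    (h : ∀ b m, z b m ⟶ z' b m) :
    HEq (Q.relabelMap (Equiv.refl A) (Equiv.sigmaAssoc N)
        (Q.actMap (Q.actMap f g) fun i => h i.1 i.2))
      (Q.actMap f fun b => P.compMap (g b) (h b))
  -- the composition
  compMap_id {A B : Type} {K L : A → Type} [Finite A] [Finite B] [∀ a, Finite (K a)]
    [∀ a, Finite (L a)] (p : Q.Obj A B) (q : ∀ a, Q.Obj (K a) (L a)) :
    Q.compMap (𝟙 p) (fun a => 𝟙 (q a)) = 𝟙 (Q.comp p q)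
  compMap_comp {A B : Type} {K L : A → Type} [Finite A] [Finite B] [∀ a, Finite (K a)]
    [∀ a, Finite (L a)] {p p' p'' : Q.Obj A B} {q q' q'' : ∀ a, Q.Obj (K a) (L a)}
    (f : p ⟶ p') (f' : p' ⟶ p'') (g : ∀ a, q a ⟶ q' a) (g' : ∀ a, q' a ⟶ q'' a) :
    Q.compMap (f ≫ f') (fun a => g a ≫ g' a) = Q.compMap f g ≫ Q.compMap f' g'
  comp_relabel_left {A A' B B' : Type} {K L : A' → Type} [Finite A] [Finite B]
    [∀ a, Finite (K a)] [∀ a, Finite (L a)] (e : A ≃ A') (e' : B ≃ B') (p : Q.Obj A B)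
    (q : ∀ a, Q.Obj (K a) (L a)) :
    Q.relabel (Equiv.sigmaCongrLeft e) (Equiv.sumCongr e' (Equiv.sigmaCongrLeft e))
        (Q.comp p fun a => q (e a)) =
      Q.comp (Q.relabel e e' p) q
  compMap_relabel_left {A A' B B' : Type} {K L : A' → Type} [Finite A] [Finite B]
    [∀ a, Finite (K a)] [∀ a, Finite (L a)] (e : A ≃ A') (e' : B ≃ B') {p p' : Q.Obj A B}
    {q q' : ∀ a, Q.Obj (K a) (L a)} (f : p ⟶ p') (g : ∀ a, q a ⟶ q' a) :
    HEq (Q.relabelMap (Equiv.sigmaCongrLeft e) (Equiv.sumCongr e' (Equiv.sigmaCongrLeft e))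
        (Q.compMap f fun a => g (e a)))
      (Q.compMap (Q.relabelMap e e' f) g)
  comp_relabel_right {A B : Type} {K K' L L' : A → Type} [Finite A] [Finite B]
    [∀ a, Finite (K a)] [∀ a, Finite (L a)] (e : ∀ a, K a ≃ K' a) (d : ∀ a, L a ≃ L' a)
    (p : Q.Obj A B) (q : ∀ a, Q.Obj (K a) (L a)) :
    Q.relabel (Equiv.sigmaCongrRight e)
        (Equiv.sumCongr (Equiv.refl B) (Equiv.sigmaCongrRight d)) (Q.comp p q) =
      Q.comp p fun a => Q.relabel (e a) (d a) (q a)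
  compMap_relabel_right {A B : Type} {K K' L L' : A → Type} [Finite A] [Finite B]
    [∀ a, Finite (K a)] [∀ a, Finite (L a)] (e : ∀ a, K a ≃ K' a) (d : ∀ a, L a ≃ L' a)
    {p p' : Q.Obj A B} {q q' : ∀ a, Q.Obj (K a) (L a)} (f : p ⟶ p') (g : ∀ a, q a ⟶ q' a) :
    HEq (Q.relabelMap (Equiv.sigmaCongrRight e)
        (Equiv.sumCongr (Equiv.refl B) (Equiv.sigmaCongrRight d)) (Q.compMap f g))
      (Q.compMap f fun a => Q.relabelMap (e a) (d a) (g a))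
  unit_comp {K L : Type} [Finite K] [Finite L] (q : Q.Obj K L) :
    Q.relabel (Equiv.uniqueSigma fun _ : Unit => K)
      ((Equiv.emptySum Empty _).trans (Equiv.uniqueSigma fun _ : Unit => L))
      (Q.comp Q.unit fun _ => q) = q
  unit_compMap {K L : Type} [Finite K] [Finite L] {q q' : Q.Obj K L} (g : q ⟶ q') :
    HEq (Q.relabelMap (Equiv.uniqueSigma fun _ : Unit => K)
      ((Equiv.emptySum Empty _).trans (Equiv.uniqueSigma fun _ : Unit => L))
      (Q.compMap (𝟙 Q.unit) fun _ => g)) g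
  comp_unit {A B : Type} [Finite A] [Finite B] (p : Q.Obj A B) :
    Q.relabel (Equiv.sigmaPUnit A) (sumEmptyFamily A B)
      (Q.comp p fun _ => Q.unit) = p
  compMap_unit {A B : Type} [Finite A] [Finite B] {p p' : Q.Obj A B} (f : p ⟶ p') :
    HEq (Q.relabelMap (Equiv.sigmaPUnit A) (sumEmptyFamily A B)
      (Q.compMap f fun _ => 𝟙 Q.unit)) f
  comp_assoc {A B : Type} {K L : A → Type} {K' L' : ∀ a, K a → Type} [Finite A] [Finite B]
    [∀ a, Finite (K a)] [∀ a, Finite (L a)] [∀ a k, Finite (K' a k)] [∀ a k, Finite (L' a k)]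
    (p : Q.Obj A B) (q : ∀ a, Q.Obj (K a) (L a)) (r : ∀ a k, Q.Obj (K' a k) (L' a k)) :
    Q.relabel (Equiv.sigmaAssoc K') (closedAssoc L')
        (Q.comp (Q.comp p q) fun i => r i.1 i.2) =
      Q.comp p fun a => Q.comp (q a) (r a)
  compMap_assoc {A B : Type} {K L : A → Type} {K' L' : ∀ a, K a → Type} [Finite A] [Finite B]
    [∀ a, Finite (K a)] [∀ a, Finite (L a)] [∀ a k, Finite (K' a k)] [∀ a k, Finite (L' a k)]
    {p p' : Q.Obj A B} {q q' : ∀ a, Q.Obj (K a) (L a)} {r r' : ∀ a k, Q.Obj (K' a k) (L' a k)}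
    (f : p ⟶ p') (g : ∀ a, q a ⟶ q' a) (h : ∀ a k, r a k ⟶ r' a k) :
    HEq (Q.relabelMap (Equiv.sigmaAssoc K') (closedAssoc L')
        (Q.compMap (Q.compMap f g) fun i => h i.1 i.2))
      (Q.compMap f fun a => Q.compMap (g a) (h a))
  -- the composition is a morphism of right modules
  act_comp {A B : Type} {K L : A → Type} {M : B → Type} {M' : ∀ a, L a → Type} [Finite A]
    [Finite B] [∀ a, Finite (K a)] [∀ a, Finite (L a)] [∀ b, Finite (M b)]
    [∀ a l, Finite (M' a l)] (p : Q.Obj A B) (q : ∀ a, Q.Obj (K a) (L a))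
    (y : ∀ b, P.Obj (M b)) (z : ∀ a l, P.Obj (M' a l)) :
    Q.relabel (Equiv.refl _) (sumLabelsEquiv M M') (Q.act (Q.comp p q) (sumFamily P.Obj y z)) =
      Q.comp (Q.act p y) fun a => Q.act (q a) (z a)
  actMap_compMap {A B : Type} {K L : A → Type} {M : B → Type} {M' : ∀ a, L a → Type} [Finite A]
    [Finite B] [∀ a, Finite (K a)] [∀ a, Finite (L a)] [∀ b, Finite (M b)]
    [∀ a l, Finite (M' a l)] {p p' : Q.Obj A B} {q q' : ∀ a, Q.Obj (K a) (L a)}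
    {y y' : ∀ b, P.Obj (M b)} {z z' : ∀ a l, P.Obj (M' a l)} (f : p ⟶ p')
    (g : ∀ a, q a ⟶ q' a) (h : ∀ b, y b ⟶ y' b) (k : ∀ a l, z a l ⟶ z' a l) :
    HEq (Q.relabelMap (Equiv.refl _) (sumLabelsEquiv M M')
        (Q.actMap (Q.compMap f g) (sumFamilyMap h k)))
      (Q.compMap (Q.actMap f h) fun a => Q.actMap (g a) (k a))

/-- The operad `PaB₊` of parenthesized braids. -/
def PaBPlus : OperadData where
  Obj := PaB
  grpd := inferInstance
  relabel := PaB.relabel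
  relabelMap := PaB.relabelMap
  unit := PaB.unit
  comp := PaB.comp
  compMap := PaB.compMap

/-! ### The collection `PaPB'₊` -/

/-- Objects of the groupoid `PaPB'₊(A, B)`. The balanced product
`(PaP₊ × PaB₊) ×_Σ PaSh₊` is taken with respect to a free action, and every class has exactly one
representative `[u, x, μ]` such that the open letters and the closed letters of `μ` occur in the standard
order. The class is recorded by this `u` and this `x`, which carry the labels, and by the tree `μ`, where
the `i`-th open letter is replaced by the `i`-th letter of `u`, and the `i`-th closed letter by the
`i`-th letter of `x`. With these letters, the condition for belonging to `PaPB'₊`, that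
`U (μ (*, …, *))` and `x` are the same up to a permutation of the letters, becomes the equality
`closed_eq` (which contains the equality of the orders of the closed letters). -/
@[ext]
structure PaPB' (A B : Type) where
  u : PaP A
  x : PaB B
  μ : MagmaMagma A B
  open_eq : μ.openOrder = u.word.order
  closed_eq : μ.closedPart = x.word

namespace PaPB'

variable {A B : Type}

/-- A morphism is a class of triples of morphisms of `PaP₊`, `PaB₊` and `PaSh₊`. The last one contains
no information: up to the letters which are added according to the source and to the target of the other
two, it goes from a shuffle of parenthesized words to another one, and there is exactly one
such morphism. -/
instance (A B : Type) : Groupoid (PaPB' A B) where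
  Hom p p' := (p.u ⟶ p'.u) × (p.x ⟶ p'.x)
  id p := (𝟙 p.u, 𝟙 p.x)
  comp f g := (f.1 ≫ g.1, f.2 ≫ g.2)
  inv f := (Groupoid.inv f.1, Groupoid.inv f.2)

def relabel {A' B' : Type} (e : A ≃ A') (e' : B ≃ B') (p : PaPB' A B) : PaPB' A' B' where
  u := p.u.relabel e
  x := p.x.relabel e'
  μ := p.μ.relabel e e'
  open_eq := by
    rw [MagmaMagma.openOrder_relabel, p.open_eq, PaP.relabel, OmegaPlus.order_relabel]
  closed_eq := by
    rw [PaB.relabel, ← p.closed_eq]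
    exact Subtype.ext (OMag.closedPart_relabel _ _ _)

def relabelMap {A' B' : Type} (e : A ≃ A') (e' : B ≃ B') {p p' : PaPB' A B} (f : p ⟶ p') :
    relabel e e' p ⟶ relabel e e' p' :=
  (PaP.relabelMap e f.1, PaB.relabelMap e' f.2)

/-- The right `PaB₊`-module structure `[u, x, μ] (y) = [u, x (y), μ (y)]`, where in the third entry
only the parenthesizations (the objects of `y`) matter. The partial operation `∘ᵢ` is the case where
all the `y b` with `b ≠ i` are units. -/
def act {M : B → Type} (p : PaPB' A B) (y : ∀ b, PaB (M b)) : PaPB' A (Σ b, M b) where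
  u := p.u
  x := p.x.comp y
  μ := p.μ.act fun b => (y b).word
  open_eq := by rw [MagmaMagma.openOrder_act, p.open_eq]
  closed_eq := by
    rw [PaB.comp, ← p.closed_eq]
    exact Subtype.ext (OMag.closedPart_substClosed _ _)

def actMap {M : B → Type} {p p' : PaPB' A B} {y y' : ∀ b, PaB (M b)} (f : p ⟶ p')
    (g : ∀ b, y b ⟶ y' b) : act p y ⟶ act p' y' :=
  (f.1, PaB.compMap f.2 g)

/-- The map `ρ` from `PaPB'₊(A, B)` to the shifted operad `PaB₊[A](B) = PaB₊(A ⊔ B)`, on objects: all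
letters of `μ`, with their parenthesization. -/
def rho (p : PaPB' A B) : PaB (A ⊕ B) := ⟨p.μ.flat⟩

/-- The map `ρ` on morphisms: first all terrestrial strands move to the left, in front of the
aerial strands; then the terrestrial strands (which carry the identity braid of the morphism `u` of
`PaP₊`) stand to the left of the braid `x`; finally the terrestrial strands move to their places, again
in front of the aerial strands. -/
def rhoMap {p p' : PaPB' A B} (f : p ⟶ p') : rho p ⟶ rho p' :=
  ⟨BraidGroup.gather (Nat.card (A ⊕ B)) 0 0 p.μ.flat.order *
      BraidGroup.place (Nat.card B) (Nat.card (A ⊕ B)) (Nat.card A) f.2.1 *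
      (BraidGroup.gather (Nat.card (A ⊕ B)) 0 0 p'.μ.flat.order)⁻¹, by
    have h0 : ∀ p : PaPB' A B, (BraidGroup.gather (Nat.card (A ⊕ B)) 0 0 p.μ.flat.order).Carries
        p.μ.flat.order (p.u.word.order.map Sum.inl ++ p.x.word.order.map Sum.inr) := by
      intro p
      have := BraidGroup.carries_gather (N := Nat.card (A ⊕ B)) p.μ.flat.order [] []
        (by simp [OmegaPlus.length_order])
      rw [← p.open_eq, ← p.closed_eq, MagmaMagma.order_closedPart]
      simpa [MagmaMagma.openOrder, MagmaMagma.closedOrder] using this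
    have hN : Nat.card A + Nat.card B ≤ Nat.card (A ⊕ B) := by
      have h1 := congrArg List.length (show p.μ.flat.order.filterMap Sum.getLeft? = _ from p.open_eq)
      have h2 : p.μ.closedPart.order.length = _ := congrArg (fun w => (OmegaPlus.order w).length)
        p.closed_eq
      have h3 : ∀ l : List (A ⊕ B), (l.filterMap Sum.getLeft?).length +
          (l.filterMap Sum.getRight?).length = l.length := by
        intro l
        induction l with
        | nil => rfl
        | cons c l ih => rcases c with c | c <;> simp [List.filterMap_cons] <;> omega
      have h4 := h3 p.μ.flat.order
      rw [MagmaMagma.order_closedPart, MagmaMagma.closedOrder] at h2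
      simp only [OmegaPlus.length_order] at h1 h2 h4
      omega
    refine ((h0 p).mul ?_).mul (h0 p').inv
    have := (f.2.2.map (Sum.inr : B → A ⊕ B)).place (N := Nat.card (A ⊕ B)) (k := Nat.card A)
      (by rw [List.length_map, OmegaPlus.length_order])
      (by rw [List.length_map, OmegaPlus.length_order]) hN (p.u.word.order.map Sum.inl) []
      (by rw [List.length_map, OmegaPlus.length_order])
    rw [← show p.u.word.order = p'.u.word.order from f.1.down]
    simpa using this⟩

def unit : PaPB' Unit Empty where
  u := PaP.unit
  x := ⟨⟨1, by simp [IsLin]⟩⟩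
  μ := MagmaMagma.unit
  open_eq := rfl
  closed_eq := rfl

/-- In the shifted operad, the closed inputs of `w ∈ PaB₊(A ⊔ B)` keep the identity. -/
abbrev shiftLabels {A : Type} (B : Type) (L : A → Type) : A ⊕ B → Type := Sum.elim L fun _ => Unit

def shiftFamily {L : A → Type} (y : ∀ a, PaB (L a)) : ∀ c, PaB (shiftLabels B L c)
  | Sum.inl a => y a
  | Sum.inr _ => PaB.unit

def shiftFamilyMap {L : A → Type} {y y' : ∀ a, PaB (L a)} (g : ∀ a, y a ⟶ y' a) :
    ∀ c : A ⊕ B, shiftFamily y c ⟶ shiftFamily y' c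
  | Sum.inl a => g a
  | Sum.inr _ => 𝟙 PaB.unit

def shiftEquiv {A : Type} (B : Type) (L : A → Type) :
    (Σ c, shiftLabels B L c) ≃ B ⊕ Σ a, L a :=
  (Equiv.sumSigmaDistrib _).trans
    ((Equiv.sumComm _ _).trans (Equiv.sumCongr (Equiv.sigmaPUnit B) (Equiv.refl _)))

/-- The composite `w (y)` in the shifted operad, for `w ∈ PaB₊[A](B)` and `y a ∈ PaB₊[0](L a)`. -/
def shiftComp {L : A → Type} (w : PaB (A ⊕ B)) (y : ∀ a, PaB (L a)) : PaB (B ⊕ Σ a, L a) :=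
  (w.comp (shiftFamily y)).relabel (shiftEquiv B L)

def shiftCompMap {L : A → Type} {w w' : PaB (A ⊕ B)} {y y' : ∀ a, PaB (L a)} (f : w ⟶ w')
    (g : ∀ a, y a ⟶ y' a) : shiftComp w y ⟶ shiftComp w' y' :=
  PaB.relabelMap (shiftEquiv B L) (PaB.compMap f (shiftFamilyMap g))

/-- The composition `[u, x, μ] ([vₐ, yₐ, νₐ]) = [u (v), ρ[u, x, μ] (y), μ (ν)]`. (With the convention on
representatives which is used here, the relabelling of the closed inputs of `ρ[u, x, μ]` is trivial.) -/
def comp {K L : A → Type} (p : PaPB' A B) (q : ∀ a, PaPB' (K a) (L a)) :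
    PaPB' (Σ a, K a) (B ⊕ Σ a, L a) where
  u := p.u.comp fun a => (q a).u
  x := shiftComp p.rho fun a => (q a).x
  μ := p.μ.comp fun a => (q a).μ
  open_eq := by
    rw [MagmaMagma.openOrder_comp, p.open_eq, PaP.comp, OmegaPlus.order_comp]
    simp only [(q _).open_eq]
  closed_eq := by
    refine Subtype.ext ?_
    refine (OMag.closedPart_substOpen _ _).trans ?_
    change _ = Mag.map _ (Mag.lift _ _)
    rw [Mag.map_lift]
    refine congrFun (congrArg _ (congrArg _ ?_)) _
    funext c
    rcases c with a | b
    · have : OMag.closedPart (q a).μ.1 = (q a).x.word.1 := congrArg Subtype.val (q a).closed_eq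
      have h : Mag.map (shiftEquiv B L)
          (Mag.map (fun l : L a => (⟨Sum.inl a, l⟩ : Σ c, shiftLabels B L c)) (q a).x.word.1) =
          Mag.map (fun l : L a => (Sum.inr ⟨a, l⟩ : B ⊕ Σ a, L a)) (q a).x.word.1 :=
        Mag.map_map _ _ _
      exact (congrArg _ this).trans h.symm
    · rfl

def compMap {K L : A → Type} {p p' : PaPB' A B} {q q' : ∀ a, PaPB' (K a) (L a)} (f : p ⟶ p')
    (g : ∀ a, q a ⟶ q' a) : comp p q ⟶ comp p' q' :=
  (PaP.compMap f.1 fun a => (g a).1, shiftCompMap (rhoMap f) fun a => (g a).2)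

end PaPB'

/-- The collection `PaPB'₊` with its right `PaB₊`-module structure, its unit and its composition. -/
def PaPBPrimePlus : RelativeOperadData PaBPlus where
  Obj := PaPB'
  grpd := inferInstance
  relabel := PaPB'.relabel
  relabelMap := PaPB'.relabelMap
  act := PaPB'.act
  actMap := PaPB'.actMap
  unit := PaPB'.unit
  comp := PaPB'.comp
  compMap := PaPB'.compMap

end

/-!
A morphism of `PaB₊` is determined by its ends and its braid. In `PaPB'₊`, an object `[u, x, μ]` is
determined by `u` and `μ`, and a morphism by its ends and the braid in its second entry. Hence the
equations between objects are identities between substitutions of words (`OMag.substOpen_assoc` and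
its companions), and each equation between morphisms becomes one between two braids. Relabelling only
changes the expression for the number of strands; the corresponding identification of braid groups is
`place _ _ 0`.

*Operad `PaB₊`.* Composition is `BraidGroup.insert`: the braids to be inserted stand side by side,
followed by a cabled braid. Cabling is functorial with respect to rows of labels (`cableL_mul`), it can
be iterated (`cableL_cableL`), and braids inside of the cables slide along them
(`sideBySide_mul_cableL`). Functoriality (`insert_mul`) and associativity (`insert_insert`) of the
composition follow from these facts.

*Relative operad.* A composition in `PaPB'₊` is a composition in `PaB₊` with `ρ [u, x, μ]`, so that
everything reduces to the compatibility of `ρ` with the structure: it is functorial (`rhoMap_comp`),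
and it sends composites to composites (`rhoMap_compMap_val`, `rhoMap_actMap_val`). Associativity of the
composition of `PaPB'₊` is then associativity of insertion. Both compatibilities are instances of
`rhoBraid_insert`, in which every strand of `ρ (x)` is replaced by a block of strands. Its essential
step compares two ways of sorting strands of three kinds, namely the terrestrial strands inside of the
blocks of terrestrial letters, the aerial strands inside of these blocks, and the aerial strands outside
of these blocks: one may first separate the first kind from the other two, or first separate the last
kind from the other two. In both cases every pair of strands of different kinds crosses
at most once and in the same direction, and the resulting braids agree (`blockGather_three`). The
difference between the two ways is a braid which only depends on the order of the open letters, and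
which does not involve the strands that `x` moves; as the order is the same at both ends, it cancels
(`blockGather_mul_cableL_rhoBraid`).
-/

namespace BraidGroup

/-! ### Placing braids, and moving braids through crossings of blocks -/

theorem place_σ {n N k i : ℕ} (h : k + n ≤ N) (hi : i + 1 < n) :
    place n N k (σ n i) = σ N (k + i) := by
  rw [place, dif_pos h, lift_σ _ _ _ _ _ hi]

theorem place_pass {n N k j b : ℕ} (h : k + n ≤ N) (hj : j + b + 1 ≤ n) :
    place n N k (pass n j b) = pass N (k + j) b := by
  induction b with
  | zero => simp [pass]
  | succ b ih => rw [pass, pass, map_mul, ih (by omega), place_σ h (by omega), add_assoc]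

theorem place_cross {n N k j a b : ℕ} (h : k + n ≤ N) (hj : j + a + b ≤ n) :
    place n N k (cross n j a b) = cross N (k + j) a b := by
  induction a with
  | zero => simp [cross]
  | succ a ih =>
    rw [cross, cross, map_mul, ih (by omega), place_pass h (by omega), add_assoc]

theorem hom_ext {n : ℕ} {G : Type} [Group G] {f g : BraidGroup n →* G}
    (h : ∀ i, i + 1 < n → f (σ n i) = g (σ n i)) (b : BraidGroup n) : f b = g b := by
  induction b using BraidGroup.induction with
  | hσ i hi => exact h i hi
  | one => simp
  | mul b c hb hc => rw [map_mul, map_mul, hb, hc]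
  | inv b hb => rw [map_inv, map_inv, hb]

theorem place_place {m n N j k : ℕ} (hj : j + m ≤ n) (h : k + n ≤ N) (b : BraidGroup m) :
    place n N k (place m n j b) = place m N (k + j) b :=
  hom_ext (f := (place n N k).comp (place m n j)) (fun i hi => by
    rw [MonoidHom.comp_apply, place_σ hj hi, place_σ h (by omega), place_σ (by omega) hi,
      add_assoc]) b

theorem place_self {n : ℕ} (b : BraidGroup n) : place n n 0 b = b :=
  hom_ext (g := MonoidHom.id _) (fun i hi => by
    rw [place_σ (by omega) hi, zero_add]; rfl) b

theorem eq_one_of_le_one {n : ℕ} (h : n ≤ 1) (b : BraidGroup n) : b = 1 :=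
  hom_ext (f := MonoidHom.id _) (g := 1) (fun i hi => by omega) b

/-- If the generators at positions `k, k + 1, …` slide through `c` to the positions `k', k' + 1, …`,
then so do all braids on these strands. -/
theorem semiconj_place {n N k k' : ℕ} {c : BraidGroup N} (h : k + n ≤ N) (h' : k' + n ≤ N)
    (hc : ∀ i, i + 1 < n → σ N (k + i) * c = c * σ N (k' + i)) (b : BraidGroup n) :
    place n N k b * c = c * place n N k' b := by
  induction b using BraidGroup.induction with
  | hσ i hi => rw [place_σ h hi, place_σ h' hi, hc i hi]
  | one => simp
  | mul b d hb hd => rw [map_mul, map_mul, mul_assoc, hd, ← mul_assoc, hb, mul_assoc]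
  | inv b hb =>
    rw [map_inv, map_inv, inv_mul_eq_iff_eq_mul, ← mul_assoc, hb, mul_assoc, mul_inv_cancel,
      mul_one]

theorem place_comm {n m N k j : ℕ} (h : k + n ≤ j) (hj : j + m ≤ N) (b : BraidGroup n)
    (c : BraidGroup m) : place n N k b * place m N j c = place m N j c * place n N k b := by
  refine semiconj_place (by omega) (by omega) (fun i hi => ?_) b
  refine (semiconj_place hj hj (fun i' hi' => ?_) c).symm
  exact (σ_far N _ _ (by omega)).symm

theorem cross_add_left (N k a a' b : ℕ) :
    cross N k (a + a') b = cross N (k + a) a' b * cross N k a b := by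
  induction a' with
  | zero => simp [cross]
  | succ a' ih => rw [← add_assoc, cross, ih, cross, mul_assoc, add_assoc]

theorem σ_cross_left_one (N k a j : ℕ) (h1 : k ≤ j) (h2 : j + 1 < k + a) (h3 : k + a < N) :
    σ N j * cross N k a 1 = cross N k a 1 * σ N (j + 1) := by
  induction a with
  | zero => omega
  | succ a ih =>
    have hp : pass N (k + a) 1 = σ N (k + a) := by simp [pass]
    rw [cross, hp]
    rcases Nat.lt_or_ge (j + 1) (k + a) with h | h
    · rw [← mul_assoc, σ_far N j (k + a) (by omega), mul_assoc, ih h (by omega), mul_assoc]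
    · obtain ⟨c, rfl⟩ : ∃ c, a = c + 1 := ⟨a - 1, by omega⟩
      obtain rfl : j = k + c := by omega
      have hq : pass N (k + c) 1 = σ N (k + c) := by simp [pass]
      have hb := σ_braid N (k + c) (by omega)
      have hf := σ_cross_far N k c 1 (k + c + 1) le_rfl
      rw [cross, hq, ← add_assoc, ← mul_assoc, ← mul_assoc, hb, mul_assoc, hf]
      simp only [mul_assoc]

/-- The strands of the front block stay parallel when it crosses another block. -/
theorem σ_cross_left (N k a b j : ℕ) (h1 : k ≤ j) (h2 : j + 1 < k + a) (h3 : k + a + b ≤ N) :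
    σ N j * cross N k a b = cross N k a b * σ N (j + b) := by
  induction b with
  | zero => simp [cross_zero_right]
  | succ b ih =>
    rw [cross_add_right, ← mul_assoc, ih (by omega), mul_assoc,
      σ_cross_left_one N (k + b) a (j + b) (by omega) (by omega) (by omega), mul_assoc, add_assoc]

theorem place_cross_left {N k n c : ℕ} (h : k + n + c ≤ N) (b : BraidGroup n) :
    place n N k b * cross N k n c = cross N k n c * place n N (k + c) b :=
  semiconj_place (by omega) (by omega) (fun i hi => by
    rw [σ_cross_left N k n c _ (by omega) (by omega) (by omega), add_right_comm]) b

theorem place_cross_right {N k a n : ℕ} (h : k + a + n ≤ N) (b : BraidGroup n) :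
    place n N (k + a) b * cross N k a n = cross N k a n * place n N k b :=
  semiconj_place (by omega) (by omega) (fun i hi => by
    rw [← cross_slide N k a n (k + i) (by omega) (by omega) (by omega), add_right_comm]) b

/-- Crossings only involve the strands of the two blocks. -/
theorem cross_eq_place {N k a b : ℕ} (h : k + a + b ≤ N) :
    cross N k a b = place (a + b) N k (cross (a + b) 0 a b) := by
  rw [place_cross (by omega) (by omega), add_zero]

theorem place_cross_comm {n N k j a b : ℕ} (h : k + n ≤ j) (hj : j + a + b ≤ N)
    (c : BraidGroup n) :
    place n N k c * cross N j a b = cross N j a b * place n N k c := by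
  rw [cross_eq_place hj, place_comm h (by omega)]

theorem cross_place_comm {n N k j a b : ℕ} (h : k + a + b ≤ j) (hj : j + n ≤ N)
    (c : BraidGroup n) :
    place n N j c * cross N k a b = cross N k a b * place n N j c := by
  rw [cross_eq_place (by omega), place_comm (by omega) hj]

end BraidGroup

namespace BraidGroup

/-! ### Cabling along lists of labels -/

section
variable {X Y : Type} {r N : ℕ}

theorem Carries.unique {b : BraidGroup r} {l l' l'' : List X} (h : Carries b l l')
    (h' : Carries b l l'') : l' = l'' :=
  List.ext_getElem? fun p => by rw [h p, h' p]

theorem Carries.length {b : BraidGroup r} {l l' : List X} (h : Carries b l l')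
    (hl : l.length = r) : l'.length = r := by
  have h1 : ∀ p, l'.length ≤ p ↔ r ≤ p := fun p => by
    rw [← List.getElem?_eq_none_iff, h p, List.getElem?_eq_none_iff, hl]
    constructor
    · intro hp
      by_contra hlt
      have := perm_lt b p (by omega)
      omega
    · intro hp
      rw [perm_of_ge b p hp]; exact hp
  have h2 := h1 r
  have h3 := h1 l'.length
  omega

theorem exists_carries (b : BraidGroup r) (l : List X) (hl : l.length = r) :
    ∃ l', Carries b l l' := by
  refine ⟨List.ofFn fun p : Fin r => l[perm r b p]'(hl ▸ perm_lt b p p.2), fun p => ?_⟩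
  rw [List.getElem?_ofFn]
  split_ifs with hp
  · exact (List.getElem?_eq_getElem _).symm
  · rw [perm_of_ge b p (by omega), List.getElem?_eq_none (by omega)]

/-- Induction over braids together with the labels at their ends. -/
theorem Carries.induction {C : BraidGroup r → List X → List X → Prop}
    (hσ : ∀ (pre post : List X) (x y : X), pre.length + 2 + post.length = r →
      C (σ r pre.length) (pre ++ x :: y :: post) (pre ++ y :: x :: post))
    (one : ∀ l, l.length = r → C 1 l l)
    (mul : ∀ b c l l' l'', l.length = r → l'.length = r → Carries b l l' → Carries c l' l'' →
      C b l l' → C c l' l'' → C (b * c) l l'')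
    (inv : ∀ b l l', l.length = r → l'.length = r → Carries b l l' → C b l l' → C b⁻¹ l' l)
    {b : BraidGroup r} {l l' : List X} (hl : l.length = r) (h : Carries b l l') : C b l l' := by
  induction b using BraidGroup.induction generalizing l l' with
  | hσ i hi =>
    obtain ⟨pre, x, y, post, rfl, rfl⟩ :
        ∃ pre x y post, l = pre ++ x :: y :: post ∧ pre.length = i := by
      refine ⟨l.take i, l[i], l[i + 1], l.drop (i + 2), ?_, by simp; omega⟩
      rw [List.cons_getElem_drop_succ, List.cons_getElem_drop_succ, List.take_append_drop]
    obtain rfl := h.unique (carries_σ hi pre post x y rfl)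
    refine hσ pre post x y ?_
    simp at hl; omega
  | one =>
    rw [h.unique (Carries.one l)]
    exact one l hl
  | mul b c hb hc =>
    obtain ⟨m, hm⟩ := exists_carries b l hl
    have hml := hm.length hl
    obtain ⟨m', hm'⟩ := exists_carries c m hml
    obtain rfl := h.unique (hm.mul hm')
    exact mul b c l m l' hl hml hm hm' (hb hl hm) (hc hml hm')
  | inv b hb =>
    have h' : Carries b l' l := by simpa using h.inv
    have hl' := h.length hl
    exact inv b l' l hl' hl h' (hb hl' h')

theorem Carries.perm {b : BraidGroup r} {l l' : List X} (hl : l.length = r)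
    (h : Carries b l l') : l.Perm l' := by
  refine Carries.induction (C := fun _ l l' => l.Perm l') ?_ ?_ ?_ ?_ hl h
  · intro pre post x y _
    exact List.Perm.append_left _ (List.Perm.swap _ _ _)
  · intro l _; exact List.Perm.refl l
  · intro b c l l' l'' _ _ _ _ h h'; exact h.trans h'
  · intro b l l' _ _ _ h; exact h.symm

/-- The total width of a row of cables does not depend on their order. -/
theorem Carries.sum_eq {b : BraidGroup r} {l l' : List X} (hl : l.length = r)
    (h : Carries b l l') (n : X → ℕ) : (l'.map n).sum = (l.map n).sum :=
  (((h.perm hl).map n).sum_eq).symm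

theorem sum_range_elim (n : X → ℕ) (l : List X) (i : ℕ) :
    ∑ p ∈ Finset.range i, (l[p]?).elim 0 n = ((l.take i).map n).sum := by
  induction i with
  | zero => simp
  | succ i ih =>
    rw [Finset.sum_range_succ, ih, List.take_add_one, List.map_append, List.sum_append]
    rcases l[i]? with _ | x <;> simp

/-- Cabling of a braid whose starting points are labelled by the list `l`: the strand labelled by `x` is
replaced by `n x` parallel strands. -/
def cableL (r N : ℕ) (b : BraidGroup r) (n : X → ℕ) (l : List X) : BraidGroup N :=
  cable r N b fun p => (l[p]?).elim 0 n

theorem cableL_one (n : X → ℕ) (l : List X) : cableL r N 1 n l = 1 := cable_one _ _ _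

theorem cableL_mul {b c : BraidGroup r} {l l' : List X} (n : X → ℕ) (h : Carries b l l') :
    cableL r N (b * c) n l = cableL r N b n l * cableL r N c n l' := by
  rw [cableL, cable_mul]
  congr 2
  funext p
  rw [h p]; rfl

theorem cableL_inv {b : BraidGroup r} {l l' : List X} (n : X → ℕ) (h : Carries b l l') :
    cableL r N b⁻¹ n l' = (cableL r N b n l)⁻¹ := by
  refine eq_inv_of_mul_eq_one_left ?_
  rw [← cableL_mul n h.inv, inv_mul_cancel, cableL_one]

theorem cableL_map (b : BraidGroup r) (n : Y → ℕ) (e : X → Y) (l : List X) :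
    cableL r N b n (l.map e) = cableL r N b (fun x => n (e x)) l := by
  unfold cableL
  congr 1
  funext p
  rw [List.getElem?_map]
  rcases l[p]? with _ | x <;> rfl

theorem cableL_congr (b : BraidGroup r) {n n' : X → ℕ} {l : List X} (h : ∀ x ∈ l, n x = n' x) :
    cableL r N b n l = cableL r N b n' l := by
  unfold cableL
  congr 1
  funext p
  rcases e : l[p]? with _ | x
  · rfl
  · exact h x (List.mem_of_getElem? e)

theorem cableL_σ {n : X → ℕ} {pre post : List X} {x y : X}
    (hr : pre.length + 2 + post.length = r)
    (hN : ((pre ++ x :: y :: post).map n).sum ≤ N) :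
    cableL r N (σ r pre.length) n (pre ++ x :: y :: post) =
      cross N (pre.map n).sum (n x) (n y) := by
  rw [cableL, cable_σ _ _ _ (by omega), sum_range_elim]
  · simp
  · rw [sum_range_elim, List.take_of_length_le (by simp; omega)]
    exact hN

theorem cableL_pass {n : X → ℕ} {pre B post : List X} {x : X}
    (hr : pre.length + 1 + B.length + post.length = r)
    (hN : ((pre ++ x :: (B ++ post)).map n).sum ≤ N) :
    cableL r N (pass r pre.length B.length) n (pre ++ x :: (B ++ post)) =
      cross N (pre.map n).sum (n x) (B.map n).sum := by
  induction B using List.reverseRecOn generalizing post with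
  | nil => rw [List.length_nil, pass, cableL_one]; simp [cross_zero_right]
  | append_singleton B y ih =>
    simp only [List.length_append, List.length_cons, List.length_nil, zero_add] at hr ⊢
    simp only [List.append_assoc, List.singleton_append] at hN ⊢
    have h1 := carries_pass (N := r) (k := pre.length) pre B (y :: post) x rfl (by omega)
    rw [pass, cableL_mul n h1, ih (by simp; omega) hN]
    have h2 := cableL_σ (N := N) (n := n) (r := r) (pre := pre ++ B) (post := post) (x := x)
      (y := y) (by simp; omega) (by simp at hN ⊢; omega)
    simp only [List.length_append, List.append_assoc, List.map_append, List.sum_append] at h2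
    rw [h2, List.map_append, List.sum_append, cross_add_right]
    simp

theorem cableL_cross {n : X → ℕ} {pre A B post : List X}
    (hr : pre.length + A.length + B.length + post.length = r)
    (hN : ((pre ++ (A ++ (B ++ post))).map n).sum ≤ N) :
    cableL r N (cross r pre.length A.length B.length) n (pre ++ (A ++ (B ++ post))) =
      cross N (pre.map n).sum (A.map n).sum (B.map n).sum := by
  induction A using List.reverseRecOn generalizing post with
  | nil => rw [List.length_nil, cross, cableL_one]; simp [cross]
  | append_singleton A x ih =>
    simp only [List.length_append, List.length_cons, List.length_nil, zero_add] at hr ⊢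
    simp only [List.append_assoc, List.singleton_append] at hN ⊢
    have h1 := carries_pass (N := r) (k := pre.length + A.length) (pre ++ A) B post x (by simp)
      (by omega)
    simp only [List.append_assoc] at h1
    rw [cross, cableL_mul n h1, ih (by simp; omega) (by simp at hN ⊢; omega)]
    have h2 := cableL_pass (N := N) (n := n) (r := r) (pre := pre ++ A) (B := B) (post := post)
      (x := x) (by simp; omega) (by simp at hN ⊢; omega)
    simp only [List.length_append, List.append_assoc, List.map_append, List.sum_append] at h2
    rw [h2, List.map_append, List.sum_append, cross_add_left]
    simp

theorem Carries.cableL {b : BraidGroup r} {l l' : List X} (hl : l.length = r)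
    (h : Carries b l l') (F : X → List Y) (hN : (l.flatMap F).length ≤ N) :
    Carries (cableL r N b (fun x => (F x).length) l) (l.flatMap F) (l'.flatMap F) := by
  have h1 := carries_cable (N := N) b (fun p => (l[p]?).elim [] F)
    (by rw [← length_flatMap_range, flatMap_range _ _ _ hl]; exact hN)
  have e : (fun p : ℕ => (l[p]?).elim [] F) ∘ BraidGroup.perm _ b =
      fun p : ℕ => (l'[p]?).elim [] F := by
    funext p
    rw [h p]; rfl
  have e' : (fun p : ℕ => ((l[p]?).elim [] F).length) =
      fun p : ℕ => (l[p]?).elim 0 fun x => (F x).length := by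
    funext p
    rcases l[p]? with _ | x <;> rfl
  rw [e, flatMap_range _ _ _ hl, flatMap_range _ _ _ (h.length hl), e'] at h1
  exact h1

/-- Cabling of braids which are trivial outside of some interval. -/
theorem cableL_place {m M : ℕ} {n : X → ℕ} {pre l post : List X} {b : BraidGroup m}
    (hm : l.length = m) (hM : (l.map n).sum = M) (hr : pre.length + m + post.length = r)
    (hN : ((pre ++ (l ++ post)).map n).sum ≤ N) :
    cableL r N (place m r pre.length b) n (pre ++ (l ++ post)) =
      place M N (pre.map n).sum (cableL m M b n l) := by
  obtain ⟨l', hl'⟩ := exists_carries b l hm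
  have := Carries.induction (C := fun b l l' => (l.map n).sum = M →
      ((pre ++ (l ++ post)).map n).sum ≤ N →
      cableL r N (place m r pre.length b) n (pre ++ (l ++ post)) =
      place M N (pre.map n).sum (BraidGroup.cableL m M b n l)) ?_ ?_ ?_ ?_ hm hl'
  · exact this hM hN
  · intro pre' post' x y hm hM hN
    subst hM
    rw [place_σ (by omega) (by omega), cableL_σ hm le_rfl]
    have := cableL_σ (N := N) (n := n) (r := r) (pre := pre ++ pre') (post := post' ++ post)
      (x := x) (y := y) (by simp; omega) (by simp at hN ⊢; omega)
    simp only [List.length_append, List.append_assoc, List.map_append, List.sum_append] at this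
    rw [place_cross (by simp at hN ⊢; omega) (by simp; omega), List.append_assoc, List.cons_append,
      List.cons_append, this]
  · intro l _ _ _
    rw [map_one, cableL_one, cableL_one, map_one]
  · intro b c l l' l'' hl hl' h h' hb hc hM hN
    have e := h.sum_eq hl n
    have hp := h.place (N := r) (k := pre.length) hl hl' (by omega) pre post rfl
    simp only [List.append_assoc] at hp
    rw [map_mul, cableL_mul n hp, cableL_mul n h, map_mul, hb hM hN, hc (e.trans hM)
      (by simp only [List.map_append, List.sum_append] at hN ⊢; omega)]
  · intro b l l' hl hl' h hb hM hN
    have e := h.sum_eq hl n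
    have hp := h.place (N := r) (k := pre.length) hl hl' (by omega) pre post rfl
    simp only [List.append_assoc] at hp
    rw [map_inv, cableL_inv n hp, cableL_inv n h, map_inv, hb (e.symm.trans hM)
      (by simp only [List.map_append, List.sum_append] at hN ⊢; omega)]

/-- Replacing every strand by a single strand changes nothing. -/
theorem cableL_one_width {b : BraidGroup r} {n : X → ℕ} {l : List X} (hl : l.length = r)
    (hn : ∀ x ∈ l, n x = 1) (hN : r ≤ N) : cableL r N b n l = place r N 0 b := by
  rw [cableL_congr b hn]
  obtain ⟨l', hl'⟩ := exists_carries b l hl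
  refine Carries.induction (C := fun b l _ =>
    BraidGroup.cableL r N b (fun _ => 1) l = place r N 0 b) ?_ ?_ ?_ ?_ hl hl'
  · intro pre post x y h
    rw [cableL_σ h (by simp; omega), place_σ (by omega) (by omega)]
    simp [cross, pass]
  · intro l _
    rw [map_one, cableL_one]
  · intro b c l l' l'' hl hl' h h' hb hc
    rw [cableL_mul _ h, map_mul, hb, hc]
  · intro b l l' hl hl' h hb
    rw [cableL_inv _ h, map_inv, hb]

/-- Iterated cabling. -/
theorem cableL_cableL {R : ℕ} {b : BraidGroup r} {m : X → ℕ} {F : X → List Y} {n : Y → ℕ}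
    {l : List X} (hl : l.length = r) (hm : ∀ x, (F x).length = m x)
    (hR : (l.flatMap F).length = R) (hN : ((l.flatMap F).map n).sum ≤ N) :
    cableL R N (cableL r R b m l) n (l.flatMap F) =
      cableL r N b (fun x => ((F x).map n).sum) l := by
  obtain rfl : (fun x => (F x).length) = m := funext hm
  obtain ⟨l', hl'⟩ := exists_carries b l hl
  refine Carries.induction (C := fun b l l' => (l.flatMap F).length = R →
    ((l.flatMap F).map n).sum ≤ N →
    BraidGroup.cableL R N (BraidGroup.cableL r R b (fun x => (F x).length) l) n (l.flatMap F) =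
      BraidGroup.cableL r N b (fun x => ((F x).map n).sum) l) ?_ ?_ ?_ ?_ hl hl' hR hN
  · intro pre post x y h hR hN
    have e : ∀ l : List X, ((l.flatMap F).map n).sum =
        (l.map fun x => ((F x).map n).sum).sum := fun l => by
      induction l with
      | nil => rfl
      | cons x l ih => simp [ih]
    have e1 : ∀ l : List X, (l.flatMap F).length = (l.map fun x => (F x).length).sum :=
      fun l => by simp [List.length_flatMap]
    rw [cableL_σ h (by rw [← e1, hR]), cableL_σ h (by rw [← e]; exact hN), ← e1, ← e,
      List.flatMap_append, List.flatMap_cons, List.flatMap_cons]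
    refine cableL_cross ?_ ?_
    · simp only [List.flatMap_append, List.flatMap_cons, List.length_append] at hR
      omega
    · simpa [List.flatMap_append, List.flatMap_cons] using hN
  · intro l _ _ _
    rw [cableL_one, cableL_one, cableL_one]
  · intro b c l l' l'' hl hl' h h' hb hc hR hN
    have hF := h.cableL hl F hR.le
    have hR' := hF.length hR
    have hN' := hF.sum_eq hR n
    rw [cableL_mul _ h, cableL_mul _ h, cableL_mul n hF, hb hR hN, hc hR' (hN'.trans_le hN)]
  · intro b l l' hl hl' h hb hR hN
    have hR1 := (h.perm hl).flatMap_right F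
    have hR' := hR1.length_eq.trans hR
    have hF := h.cableL hl F hR'.le
    have hN' := ((hR1.map n).sum_eq).trans_le hN
    rw [cableL_inv _ h, cableL_inv _ h, cableL_inv n hF, hb hR' hN']

theorem place_cableL {M : ℕ} {b : BraidGroup r} {n : X → ℕ} {l : List X} (hl : l.length = r)
    (hM : (l.map n).sum = M) (hN : M ≤ N) :
    place M N 0 (cableL r M b n l) = cableL r N b n l := by
  have := cableL_place (N := N) (r := r) (pre := []) (post := []) (n := n) (b := b) hl hM
    (by simp) (by simpa [hM])
  simp only [List.length_nil, List.nil_append, List.append_nil, List.map_nil, List.sum_nil,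
    place_self] at this
  exact this.symm

end

end BraidGroup

namespace BraidGroup

/-! ### Braids side by side -/

section
variable {X Y : Type} {r N : ℕ}

theorem sideBySide_append (n : X → ℕ) (g : ∀ x, BraidGroup (n x)) (k : ℕ) (l l' : List X) :
    sideBySide N n g k (l ++ l') =
      sideBySide N n g k l * sideBySide N n g (k + (l.map n).sum) l' := by
  induction l generalizing k with
  | nil => simp [sideBySide]
  | cons x l ih => simp [sideBySide, ih, mul_assoc, add_assoc]

theorem sideBySide_congr {n n' : X → ℕ} {g : ∀ x, BraidGroup (n x)} {g' : ∀ x, BraidGroup (n' x)}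
    {l : List X} (hn : ∀ x ∈ l, n x = n' x)
    (h : ∀ x ∈ l, ∀ k, k + n x ≤ N → place (n x) N k (g x) = place (n' x) N k (g' x)) {k : ℕ}
    (hN : k + (l.map n).sum ≤ N) :
    sideBySide N n g k l = sideBySide N n' g' k l := by
  induction l generalizing k with
  | nil => rfl
  | cons x l ih =>
    simp only [List.map_cons, List.sum_cons] at hN
    rw [sideBySide, sideBySide, h x (by simp) k (by omega), hn x (by simp),
      ih (fun y hy => hn y (by simp [hy])) (fun y hy => h y (by simp [hy]))]
    rw [← hn x (by simp)]; omega

theorem sideBySide_map (n : Y → ℕ) (g : ∀ y, BraidGroup (n y)) (e : X → Y) (k : ℕ) (l : List X) :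
    sideBySide N n g k (l.map e) = sideBySide N (fun x => n (e x)) (fun x => g (e x)) k l := by
  induction l generalizing k with
  | nil => rfl
  | cons x l ih => rw [List.map_cons, sideBySide, sideBySide, ih]

theorem sideBySide_one (n : X → ℕ) (k : ℕ) (l : List X) :
    sideBySide N n (fun _ => 1) k l = 1 := by
  induction l generalizing k with
  | nil => rfl
  | cons x l ih => rw [sideBySide, ih, map_one, mul_one]

theorem sideBySide_eq_one {n : X → ℕ} {g : ∀ x, BraidGroup (n x)} {l : List X}
    (h : ∀ x ∈ l, g x = 1) (k : ℕ) : sideBySide N n g k l = 1 := by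
  induction l generalizing k with
  | nil => rfl
  | cons x l ih =>
    rw [sideBySide, h x (by simp), ih fun y hy => h y (by simp [hy]), map_one, mul_one]

theorem place_sideBySide {M j : ℕ} {n : X → ℕ} {g : ∀ x, BraidGroup (n x)} {k : ℕ} {l : List X}
    (hM : k + (l.map n).sum ≤ M) (hN : j + M ≤ N) :
    place M N j (sideBySide M n g k l) = sideBySide N n g (j + k) l := by
  induction l generalizing k with
  | nil => simp [sideBySide]
  | cons x l ih =>
    simp only [List.map_cons, List.sum_cons] at hM
    rw [sideBySide, sideBySide, map_mul, place_place (by omega) hN, ih (by omega), add_assoc]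

theorem sideBySide_eq_place {n : X → ℕ} {g : ∀ x, BraidGroup (n x)} {k : ℕ} {l : List X}
    (hN : k + (l.map n).sum ≤ N) :
    sideBySide N n g k l = place (l.map n).sum N k (sideBySide (l.map n).sum n g 0 l) := by
  rw [place_sideBySide (by simp) hN, add_zero]

theorem sideBySide_mul {n : X → ℕ} (g g' : ∀ x, BraidGroup (n x)) {k : ℕ} {l : List X}
    (hN : k + (l.map n).sum ≤ N) :
    sideBySide N n (fun x => g x * g' x) k l =
      sideBySide N n g k l * sideBySide N n g' k l := by
  induction l generalizing k with
  | nil => simp [sideBySide]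
  | cons x l ih =>
    simp only [List.map_cons, List.sum_cons] at hN
    rw [sideBySide, sideBySide, sideBySide, map_mul, ih (by omega)]
    rw [sideBySide_eq_place (g := g) (k := k + n x) (by omega)]
    simp only [mul_assoc]
    rw [← mul_assoc (place (n x) N k (g' x)), place_comm le_rfl (by omega)]
    simp only [mul_assoc]

theorem sideBySide_inv {n : X → ℕ} (g : ∀ x, BraidGroup (n x)) {k : ℕ} {l : List X}
    (hN : k + (l.map n).sum ≤ N) :
    sideBySide N n (fun x => (g x)⁻¹) k l = (sideBySide N n g k l)⁻¹ := by
  refine eq_inv_of_mul_eq_one_left ?_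
  rw [← sideBySide_mul _ _ hN]
  simp only [inv_mul_cancel]
  exact sideBySide_one _ _ _

theorem sum_flatMap (n : Y → ℕ) (F : X → List Y) (l : List X) :
    ((l.flatMap F).map n).sum = (l.map fun x => ((F x).map n).sum).sum := by
  induction l with
  | nil => rfl
  | cons x l ih => simp [ih]

/-- Rows of rows of braids. -/
theorem sideBySide_flatMap {n : Y → ℕ} {g : ∀ y, BraidGroup (n y)} {F : X → List Y} {k : ℕ}
    {l : List X} (hN : k + ((l.flatMap F).map n).sum ≤ N) :
    sideBySide N n g k (l.flatMap F) =
      sideBySide N (fun x => ((F x).map n).sum)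
        (fun x => sideBySide ((F x).map n).sum n g 0 (F x)) k l := by
  induction l generalizing k with
  | nil => rfl
  | cons x l ih =>
    simp only [List.flatMap_cons, List.map_append, List.sum_append] at hN
    rw [List.flatMap_cons, sideBySide_append, ih (by omega), sideBySide,
      sideBySide_eq_place (l := F x) (by omega)]

/-- Cabling a row of braids. -/
theorem cableL_sideBySide {m : X → ℕ} {g : ∀ x, BraidGroup (m x)} {F F' : X → List Y}
    {n : Y → ℕ} (hg : ∀ x, Carries (g x) (F x) (F' x)) (hF : ∀ x, (F x).length = m x)
    {l : List X} {pre : List Y} (hr : pre.length + (l.flatMap F).length = r)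
    (hN : ((pre ++ l.flatMap F).map n).sum ≤ N) :
    cableL r N (sideBySide r m g pre.length l) n (pre ++ l.flatMap F) =
      sideBySide N (fun x => ((F x).map n).sum)
        (fun x => cableL (m x) ((F x).map n).sum (g x) n (F x)) (pre.map n).sum l := by
  induction l generalizing pre with
  | nil => rw [sideBySide, cableL_one, sideBySide]
  | cons x l ih =>
    simp only [List.flatMap_cons, List.length_append] at hr hN ⊢
    have hF' := (hg x).length (hF x)
    have hx := hF x
    have h1 := (hg x).place (N := r) (k := pre.length) (hF x) hF' (by omega) pre (l.flatMap F) rfl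
    have hs := (hg x).sum_eq (hF x) n
    rw [List.append_assoc, List.append_assoc] at h1
    rw [sideBySide, sideBySide, cableL_mul n h1,
      cableL_place (hF x) rfl (by omega) hN]
    have h2 := ih (pre := pre ++ F' x) (by simp only [List.length_append]; omega)
      (by simp only [List.map_append, List.sum_append] at hN ⊢; omega)
    rw [List.length_append, hF', List.append_assoc, List.map_append, List.sum_append, hs] at h2
    rw [h2]

/-- Braids inside of cables slide along the cables. -/
theorem sideBySide_mul_cableL {n : X → ℕ} (g : ∀ x, BraidGroup (n x)) {b : BraidGroup r}
    {l l' : List X} (hl : l.length = r) (h : Carries b l l') (hN : (l.map n).sum ≤ N) :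
    sideBySide N n g 0 l * cableL r N b n l = cableL r N b n l * sideBySide N n g 0 l' := by
  refine Carries.induction (C := fun b l l' => (l.map n).sum ≤ N →
    sideBySide N n g 0 l * cableL r N b n l = cableL r N b n l * sideBySide N n g 0 l')
    ?_ ?_ ?_ ?_ hl h hN
  · intro pre post x y hr hN
    rw [cableL_σ hr hN]
    have hN' := hN
    simp only [List.map_append, List.map_cons, List.sum_append, List.sum_cons] at hN'
    simp only [sideBySide_append, sideBySide, zero_add]
    rw [sideBySide_eq_place (k := 0) (by omega), add_right_comm _ (n y) (n x),
      sideBySide_eq_place (l := post) (by omega)]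
    simp only [mul_assoc]
    rw [cross_place_comm (by omega) (by omega), ← mul_assoc (place (n y) N _ _),
      place_cross_right (by omega), ← mul_assoc (place (n x) N _ _),
      ← mul_assoc (place (n x) N _ _), place_cross_left (by omega)]
    simp only [← mul_assoc]
    rw [place_cross_comm (by omega) (by omega)]
    simp only [mul_assoc]
    rw [← mul_assoc (place (n x) N _ _) (place (n y) N _ _),
      ← place_comm (c := g x) (by omega) (by omega)]
    simp only [mul_assoc]
  · intro l _ _
    rw [cableL_one, one_mul, mul_one]
  · intro b c l l' l'' hl hl' h h' hb hc hN
    rw [cableL_mul n h, ← mul_assoc, hb hN, mul_assoc, hc ((h.sum_eq hl n).trans_le hN), mul_assoc]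
  · intro b l l' hl hl' h hb hN
    have := hb ((h.sum_eq hl n).symm.trans_le hN)
    rw [cableL_inv n h, mul_inv_eq_iff_eq_mul, mul_assoc, this, inv_mul_cancel_left]

/-- The insertion of the braids `g x` into the strands of the braid `b` whose starting points
are labelled by `l`. -/
def insert (r N : ℕ) (n : X → ℕ) (l : List X) (b : BraidGroup r) (g : ∀ x, BraidGroup (n x)) :
    BraidGroup N :=
  sideBySide N n g 0 l * cableL r N b n l

theorem insert_one (n : X → ℕ) (l : List X) : insert r N n l 1 (fun _ => 1) = 1 := by
  rw [insert, sideBySide_one, cableL_one, one_mul]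

theorem insert_mul {n : X → ℕ} {l l' : List X} {b c : BraidGroup r} (g g' : ∀ x, BraidGroup (n x))
    (hl : l.length = r) (h : Carries b l l') (hN : (l.map n).sum ≤ N) :
    insert r N n l (b * c) (fun x => g x * g' x) = insert r N n l b g * insert r N n l' c g' := by
  rw [insert, insert, insert, sideBySide_mul _ _ (by simpa), cableL_mul n h]
  simp only [mul_assoc]
  rw [← mul_assoc (sideBySide N n g' 0 l), sideBySide_mul_cableL g' hl h hN]
  simp only [mul_assoc]

theorem insert_map (n : Y → ℕ) (e : X → Y) (l : List X) (b : BraidGroup r)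
    (g : ∀ y, BraidGroup (n y)) :
    insert r N n (l.map e) b g = insert r N (fun x => n (e x)) l b fun x => g (e x) := by
  rw [insert, insert, sideBySide_map, cableL_map]

theorem insert_congr {n n' : X → ℕ} {l : List X} {b : BraidGroup r} {g : ∀ x, BraidGroup (n x)}
    {g' : ∀ x, BraidGroup (n' x)} (hn : ∀ x ∈ l, n x = n' x)
    (h : ∀ x ∈ l, ∀ k, k + n x ≤ N → place (n x) N k (g x) = place (n' x) N k (g' x))
    (hN : (l.map n).sum ≤ N) :
    insert r N n l b g = insert r N n' l b g' := by
  rw [insert, insert, sideBySide_congr hn h (by simpa), cableL_congr b hn]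

theorem place_insert {M : ℕ} {n : X → ℕ} {l : List X} {b : BraidGroup r}
    {g : ∀ x, BraidGroup (n x)} (hl : l.length = r) (hM : (l.map n).sum = M) (hN : M ≤ N) :
    place M N 0 (insert r M n l b g) = insert r N n l b g := by
  rw [insert, map_mul, place_cableL hl hM hN, place_sideBySide (by simp [hM]) (by simpa), insert]

/-- Insertion does not depend on the identification of the braid groups on equally many strands. -/
theorem insert_place {r' : ℕ} {n : X → ℕ} {l : List X} {b : BraidGroup r}
    {g : ∀ x, BraidGroup (n x)} (hr : r = r') :
    insert r' N n l (place r r' 0 b) g = insert r N n l b g := by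
  subst hr
  rw [place_self]

/-- Associativity of insertion. -/
theorem insert_insert {R : ℕ} {n : X → ℕ} {m : Y → ℕ} {l : List X} {F F' : X → List Y}
    {b : BraidGroup r} {g : ∀ x, BraidGroup (n x)} {h : ∀ y, BraidGroup (m y)}
    (hl : l.length = r) (hg : ∀ x, Carries (g x) (F x) (F' x)) (hF : ∀ x, (F x).length = n x)
    (hR : (l.map n).sum = R) (hN : ((l.flatMap F).map m).sum ≤ N) :
    insert R N m (l.flatMap F) (insert r R n l b g) h =
      insert r N (fun x => ((F x).map m).sum) l b
        fun x => insert (n x) ((F x).map m).sum m (F x) (g x) h := by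
  have hR' : (l.flatMap F).length = R := by
    rw [List.length_flatMap, ← hR]; simp [hF]
  have hC : Carries (sideBySide R n g 0 l) (l.flatMap F) (l.flatMap F') := by
    simpa using carries_sideBySide (N := R) (pre := []) hg hF (fun x => (hg x).length (hF x)) l
      (by simp [hR'])
  have hF' := fun x => (hg x).length (hF x)
  have hs : ((l.flatMap F').map m).sum = ((l.flatMap F).map m).sum := hC.sum_eq hR' m
  have h1 := cableL_sideBySide (N := N) (r := R) (n := m) (pre := []) (l := l) hg hF
    (by simpa using hR') (by simpa using hN)
  simp only [List.length_nil, List.nil_append, List.map_nil, List.sum_nil] at h1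
  rw [insert, insert, cableL_mul m hC, cableL_cableL hl hF' (hC.length hR') (hs.trans_le hN), h1,
    sideBySide_flatMap (by simpa), insert]
  rw [sum_flatMap] at hN
  simp only [insert]
  rw [sideBySide_mul _ _ (by simpa)]
  simp only [mul_assoc]
  congr 2
  exact cableL_congr _ fun x _ => (hg x).sum_eq (hF x) m

end

end BraidGroup

/-! ### The operad of parenthesized braids -/

namespace Mag

theorem lift_congr {A M : Type} [MulOneClass M] {f g : A → M} (h : ∀ a, f a = g a) (t : Mag A) :
    lift f t = lift g t := by rw [funext h]

theorem lift_of_eq {A : Type} (t : Mag A) : lift of t = t := by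
  induction t using Mag.induction with
  | one => simp
  | of a => simp
  | mul s t hs ht => rw [map_mul, hs, ht]

end Mag

namespace OmegaPlus

variable {A B : Type}

theorem relabel_refl (x : OmegaPlus A) : x.relabel (Equiv.refl A) = x :=
  Subtype.ext (Mag.lift_of_eq x.1)

theorem relabel_trans {C : Type} (e : A ≃ B) (e' : B ≃ C) (x : OmegaPlus A) :
    x.relabel (e.trans e') = (x.relabel e).relabel e' :=
  Subtype.ext (Mag.map_map e e' x.1).symm

theorem comp_relabel_left {K : B → Type} (e : A ≃ B) (x : OmegaPlus A)
    (y : ∀ b, OmegaPlus (K b)) :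
    (x.comp fun a => y (e a)).relabel (Equiv.sigmaCongrLeft e) = (x.relabel e).comp y := by
  refine Subtype.ext ?_
  change Mag.map _ (Mag.lift _ _) = Mag.lift _ (Mag.map _ _)
  rw [Mag.map_lift, Mag.lift_map]
  exact Mag.lift_congr (fun a => Mag.map_map _ _ _) _

theorem comp_relabel_right {K K' : A → Type} (e : ∀ a, K a ≃ K' a) (x : OmegaPlus A)
    (y : ∀ a, OmegaPlus (K a)) :
    (x.comp y).relabel (Equiv.sigmaCongrRight e) = x.comp fun a => (y a).relabel (e a) := by
  refine Subtype.ext ((Mag.map_lift _ _ _).trans (Mag.lift_congr (fun a => ?_) _))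
  change _ = Mag.map _ (Mag.map _ _)
  rw [Mag.map_map, Mag.map_map]
  rfl

theorem unit_comp {K : Type} (y : OmegaPlus K) :
    (unit.comp fun _ => y).relabel (Equiv.uniqueSigma fun _ : Unit => K) = y :=
  Subtype.ext <| (Mag.map_map _ _ _).trans (Mag.lift_of_eq _)

theorem comp_unit (x : OmegaPlus A) :
    (x.comp fun _ => unit).relabel (Equiv.sigmaPUnit A) = x :=
  Subtype.ext <| (Mag.map_lift _ _ _).trans (Mag.lift_of_eq _)

theorem comp_assoc {K : A → Type} {M : ∀ a, K a → Type} (x : OmegaPlus A)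
    (y : ∀ a, OmegaPlus (K a)) (z : ∀ a k, OmegaPlus (M a k)) :
    ((x.comp y).comp fun i => z i.1 i.2).relabel (Equiv.sigmaAssoc M) =
      x.comp fun a => (y a).comp (z a) :=
  Subtype.ext <| (congrArg _ (Mag.lift_lift _ _ _)).trans <| (Mag.map_lift _ _ _).trans <|
    Mag.lift_congr (fun a => by
      rw [Mag.lift_map, Mag.map_lift]
      refine Eq.trans (Mag.lift_congr (fun k => ?_) _) (Mag.map_lift _ _ _).symm
      rw [Mag.map_map, Mag.map_map]
      rfl) _

theorem sum_card {K : A → Type} (x : OmegaPlus A) (y : ∀ a, OmegaPlus (K a)) :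
    (x.order.map fun a => Nat.card (K a)).sum = Nat.card (Σ a, K a) := by
  rw [← (x.comp y).length_order, order_comp, List.length_flatMap]
  simp [length_order]

end OmegaPlus

namespace PaB

variable {A B : Type}

theorem hom_ext {x x' : PaB A} {f g : x ⟶ x'} (h : f.1 = g.1) : f = g := Subtype.ext h

/-- Morphisms with equal sources and equal targets are equal if their braids are. -/
theorem hom_heq {x x' z z' : PaB A} (h : x = z) (h' : x' = z') {f : x ⟶ x'} {g : z ⟶ z'}
    (e : f.1 = g.1) : HEq f g := by
  subst h h'
  exact heq_of_eq (hom_ext e)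

theorem compMap_val {K : A → Type} {x x' : PaB A} {y y' : ∀ a, PaB (K a)} (f : x ⟶ x')
    (g : ∀ a, y a ⟶ y' a) :
    (compMap f g).1 = BraidGroup.insert (Nat.card A) (Nat.card (Σ a, K a))
      (fun a => Nat.card (K a)) x.word.order f.1 fun a => (g a).1 := rfl

theorem sum_card {K : A → Type} (x : PaB A) (y : ∀ a, PaB (K a)) :
    (x.word.order.map fun a => Nat.card (K a)).sum = Nat.card (Σ a, K a) :=
  x.word.sum_card fun a => (y a).word

theorem relabel_refl (x : PaB A) : relabel (Equiv.refl A) x = x :=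
  PaB.ext (OmegaPlus.relabel_refl _)

theorem relabel_trans {C : Type} (e : A ≃ B) (e' : B ≃ C) (x : PaB A) :
    relabel (e.trans e') x = relabel e' (relabel e x) :=
  PaB.ext (OmegaPlus.relabel_trans _ _ _)

theorem compMap_id {K : A → Type} (x : PaB A) (y : ∀ a, PaB (K a)) :
    compMap (𝟙 x) (fun a => 𝟙 (y a)) = 𝟙 (comp x y) :=
  hom_ext (BraidGroup.insert_one _ _)

theorem compMap_comp {K : A → Type} {x x' x'' : PaB A} {y y' y'' : ∀ a, PaB (K a)} (f : x ⟶ x')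
    (f' : x' ⟶ x'') (g : ∀ a, y a ⟶ y' a) (g' : ∀ a, y' a ⟶ y'' a) :
    compMap (f ≫ f') (fun a => g a ≫ g' a) = compMap f g ≫ compMap f' g' :=
  hom_ext (BraidGroup.insert_mul _ _ x.word.length_order f.2 (sum_card x y).le)

theorem relabelMap_id (e : A ≃ B) (x : PaB A) : relabelMap e (𝟙 x) = 𝟙 (relabel e x) :=
  hom_ext (map_one _)

theorem relabelMap_comp (e : A ≃ B) {x x' x'' : PaB A} (f : x ⟶ x') (f' : x' ⟶ x'') :
    relabelMap e (f ≫ f') = relabelMap e f ≫ relabelMap e f' :=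
  hom_ext (map_mul _ _ _)

theorem relabelMap_relabelMap_val {C : Type} (e : A ≃ B) (e' : B ≃ C) {x x' : PaB A} (f : x ⟶ x') :
    (relabelMap e' (relabelMap e f)).1 = BraidGroup.place (Nat.card A) (Nat.card C) 0 f.1 :=
  BraidGroup.place_place (by simp [Nat.card_congr e]) (by simp [Nat.card_congr e']) _

theorem comp_relabel_left {K : B → Type} (e : A ≃ B) (x : PaB A) (y : ∀ b, PaB (K b)) :
    relabel (Equiv.sigmaCongrLeft e) (comp x fun a => y (e a)) = comp (relabel e x) y :=
  PaB.ext (OmegaPlus.comp_relabel_left e x.word fun b => (y b).word)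

theorem comp_relabel_right {K K' : A → Type} (e : ∀ a, K a ≃ K' a) (x : PaB A)
    (y : ∀ a, PaB (K a)) :
    relabel (Equiv.sigmaCongrRight e) (comp x y) = comp x fun a => relabel (e a) (y a) :=
  PaB.ext (OmegaPlus.comp_relabel_right e x.word fun b => (y b).word)

theorem unit_comp {K : Type} (y : PaB K) :
    relabel (Equiv.uniqueSigma fun _ : Unit => K) (comp unit fun _ => y) = y :=
  PaB.ext (OmegaPlus.unit_comp y.word)

theorem comp_unit (x : PaB A) :
    relabel (Equiv.sigmaPUnit A) (comp x fun _ => unit) = x :=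
  PaB.ext (OmegaPlus.comp_unit x.word)

theorem comp_assoc {K : A → Type} {M : ∀ a, K a → Type} (x : PaB A)
    (y : ∀ a, PaB (K a)) (z : ∀ a k, PaB (M a k)) :
    relabel (Equiv.sigmaAssoc M) (comp (comp x y) fun i => z i.1 i.2) =
      comp x fun a => comp (y a) (z a) :=
  PaB.ext (OmegaPlus.comp_assoc x.word (fun a => (y a).word) fun a k => (z a k).word)

theorem compMap_relabel_left_val {K : B → Type} (e : A ≃ B) {x x' : PaB A} {y y' : ∀ b, PaB (K b)}
    (f : x ⟶ x') (g : ∀ b, y b ⟶ y' b) :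
    (relabelMap (Equiv.sigmaCongrLeft e) (compMap f fun a => g (e a))).1 =
      (compMap (relabelMap e f) g).1 := by
  change BraidGroup.place _ _ 0 (BraidGroup.insert _ _ _ _ _ _) =
    BraidGroup.insert _ _ _ (x.word.relabel e).order (BraidGroup.place _ _ 0 f.1) _
  rw [OmegaPlus.order_relabel, BraidGroup.insert_map,
    BraidGroup.insert_place (Nat.card_congr e),
    BraidGroup.place_insert x.word.length_order (sum_card x fun a => y (e a))
      (Nat.card_congr (Equiv.sigmaCongrLeft e)).le]

theorem compMap_relabel_right_val {K K' : A → Type} (e : ∀ a, K a ≃ K' a) {x x' : PaB A}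
    {y y' : ∀ a, PaB (K a)} (f : x ⟶ x') (g : ∀ a, y a ⟶ y' a) :
    (relabelMap (Equiv.sigmaCongrRight e) (compMap f g)).1 =
      (compMap f fun a => relabelMap (e a) (g a)).1 := by
  change BraidGroup.place _ _ 0 (BraidGroup.insert _ _ _ _ _ _) =
    BraidGroup.insert _ _ _ x.word.order f.1 _
  have hc := Nat.card_congr (Equiv.sigmaCongrRight e)
  rw [BraidGroup.place_insert x.word.length_order (sum_card x y) hc.le]
  refine BraidGroup.insert_congr (fun a _ => Nat.card_congr (e a)) (fun a _ k hk => ?_)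
    ((sum_card x y).trans hc).le
  have := Nat.card_congr (e a)
  change _ = BraidGroup.place _ _ k (BraidGroup.place _ _ 0 (g a).1)
  rw [BraidGroup.place_place (by omega) (by omega), add_zero]

theorem unit_compMap_val {K : Type} {y y' : PaB K} (g : y ⟶ y') :
    (relabelMap (Equiv.uniqueSigma fun _ : Unit => K) (compMap (𝟙 unit) fun _ => g)).1 = g.1 := by
  have hc := Nat.card_congr (Equiv.uniqueSigma fun _ : Unit => K)
  refine (BraidGroup.place_insert (OmegaPlus.length_order _) (sum_card unit fun _ => y)
    hc.le).trans ?_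
  change BraidGroup.sideBySide _ _ _ 0 [()] * BraidGroup.cableL _ _ 1 _ _ = g.1
  rw [BraidGroup.cableL_one, mul_one, BraidGroup.sideBySide, BraidGroup.sideBySide, mul_one]
  exact BraidGroup.place_self _

theorem compMap_unit_val {x x' : PaB A} (f : x ⟶ x') :
    (relabelMap (Equiv.sigmaPUnit A) (compMap f fun _ => 𝟙 unit)).1 = f.1 := by
  have hc := Nat.card_congr (Equiv.sigmaPUnit A)
  refine (BraidGroup.place_insert x.word.length_order (sum_card x fun _ => unit) hc.le).trans ?_
  refine (congrArg (· * _) (BraidGroup.sideBySide_one _ _ _)).trans ?_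
  rw [one_mul, BraidGroup.cableL_one_width x.word.length_order (fun _ _ => by simp) le_rfl]
  exact BraidGroup.place_self _

theorem compMap_assoc_val {K : A → Type} {M : ∀ a, K a → Type} {x x' : PaB A}
    {y y' : ∀ a, PaB (K a)} {z z' : ∀ a k, PaB (M a k)} (f : x ⟶ x') (g : ∀ a, y a ⟶ y' a)
    (h : ∀ a k, z a k ⟶ z' a k) :
    (relabelMap (Equiv.sigmaAssoc M) (compMap (compMap f g) fun i => h i.1 i.2)).1 =
      (compMap f fun a => compMap (g a) (h a)).1 := by
  have hc := Nat.card_congr (Equiv.sigmaAssoc M)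
  have hs := sum_card (comp x y) fun i => z i.1 i.2
  refine (BraidGroup.place_insert (OmegaPlus.length_order _) hs hc.le).trans ?_
  have ho : (comp x y).word.order =
      x.word.order.flatMap fun a => (y a).word.order.map (Sigma.mk a) :=
    OmegaPlus.order_comp _ _
  rw [ho] at hs
  rw [compMap_val f g, ho, BraidGroup.insert_insert x.word.length_order
    (fun a => (g a).2.map (Sigma.mk a)) (fun a => by rw [List.length_map, OmegaPlus.length_order])
    (sum_card x y) (hs.trans hc).le, compMap_val]
  have hn : ∀ a, (((y a).word.order.map (Sigma.mk a)).map
      fun i => Nat.card (M i.1 i.2)).sum = Nat.card (Σ k, M a k) := fun a => by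
    rw [List.map_map]
    exact sum_card (y a) (z a)
  refine BraidGroup.insert_congr (fun a _ => hn a) (fun a _ k hk => ?_) ?_
  · rw [BraidGroup.insert_map, compMap_val, hn a]
  · rw [← BraidGroup.sum_flatMap]
    exact (hs.trans hc).le

theorem isOperad : IsOperad PaBPlus where
  relabelMap_id e x := relabelMap_id e x
  relabelMap_comp e _ _ _ f f' := relabelMap_comp e f f'
  relabel_refl := relabel_refl
  relabelMap_refl _ := hom_heq (relabel_refl _) (relabel_refl _) (BraidGroup.place_self _)
  relabel_trans := relabel_trans
  relabelMap_trans e e' _ _ f := hom_heq (relabel_trans _ _ _) (relabel_trans _ _ _)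
    (relabelMap_relabelMap_val e e' f).symm
  compMap_id := compMap_id
  compMap_comp := compMap_comp
  comp_relabel_left := comp_relabel_left
  compMap_relabel_left e _ _ _ _ f g := hom_heq (comp_relabel_left _ _ _)
    (comp_relabel_left _ _ _) (compMap_relabel_left_val e f g)
  comp_relabel_right := comp_relabel_right
  compMap_relabel_right e _ _ _ _ f g := hom_heq (comp_relabel_right _ _ _)
    (comp_relabel_right _ _ _) (compMap_relabel_right_val e f g)
  unit_comp := unit_comp
  unit_compMap g := hom_heq (unit_comp _) (unit_comp _) (unit_compMap_val g)
  comp_unit := comp_unit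
  compMap_unit f := hom_heq (comp_unit _) (comp_unit _) (compMap_unit_val f)
  comp_assoc := comp_assoc
  compMap_assoc f g h := hom_heq (comp_assoc _ _ _) (comp_assoc _ _ _) (compMap_assoc_val f g h)

end PaB

namespace BraidGroup

/-! ### Gathering blocks of strands -/

section
variable {X Y A B : Type} {r N : ℕ}

/-- The version of `gather` for a row of blocks: the block `x` consists of `α x` terrestrial strands
followed by `β x` aerial ones. All terrestrial strands move to the left, in front of the
aerial ones. -/
def blockGather (N : ℕ) (α β : X → ℕ) : ℕ → ℕ → List X → BraidGroup N
  | _, _, [] => 1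
  | t, a, x :: l => (cross N t (α x) a)⁻¹ * blockGather N α β (t + α x) (a + β x) l

theorem blockGather_append (α β : X → ℕ) (t a : ℕ) (l l' : List X) :
    blockGather N α β t a (l ++ l') = blockGather N α β t a l *
      blockGather N α β (t + (l.map α).sum) (a + (l.map β).sum) l' := by
  induction l generalizing t a with
  | nil => simp [blockGather]
  | cons x l ih => simp [blockGather, ih, mul_assoc, add_assoc]

theorem blockGather_concat (α β : X → ℕ) (t a : ℕ) (l : List X) (x : X) :
    blockGather N α β t a (l ++ [x]) = blockGather N α β t a l *
      (cross N (t + (l.map α).sum) (α x) (a + (l.map β).sum))⁻¹ := by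
  rw [blockGather_append, blockGather, blockGather, mul_one]

theorem blockGather_filterMap_left (α β : A → ℕ) (t a : ℕ) (l : List (A ⊕ B)) :
    blockGather N (Sum.elim α fun _ => 0) (Sum.elim β fun _ => 0) t a l =
      blockGather N α β t a (l.filterMap Sum.getLeft?) := by
  induction l generalizing t a with
  | nil => rfl
  | cons c l ih => rcases c with c | c <;> simp [blockGather, ih, cross, List.filterMap_cons]

theorem gather_eq_blockGather (t a : ℕ) (l : List (A ⊕ B)) :
    gather N t a l = blockGather N (Sum.elim (fun _ => 1) fun _ => 0)
      (Sum.elim (fun _ => 0) fun _ => 1) t a l := by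
  induction l generalizing t a with
  | nil => rfl
  | cons c l ih => rcases c with c | c <;> simp [blockGather, gather, ih, cross]

theorem gather_map {A' B' : Type} (e : A → A') (d : B → B') (t a : ℕ) (l : List (A ⊕ B)) :
    gather N t a (l.map (Sum.map e d)) = gather N t a l := by
  induction l generalizing t a with
  | nil => rfl
  | cons c l ih => rcases c with c | c <;> simp [gather, ih]

theorem place_blockGather {n k : ℕ} {α β : X → ℕ} {t a : ℕ} {l : List X}
    (h : t + a + (l.map α).sum + (l.map β).sum ≤ n) (hN : k + n ≤ N) :
    place n N k (blockGather n α β t a l) = blockGather N α β (k + t) a l := by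
  induction l generalizing t a with
  | nil => simp [blockGather]
  | cons x l ih =>
    simp only [List.map_cons, List.sum_cons] at h
    rw [blockGather, blockGather, map_mul, map_inv, place_cross hN (by omega), ih (by omega),
      add_assoc]

theorem blockGather_eq_place {n : ℕ} {α β : X → ℕ} {t a : ℕ} {l : List X}
    (h : a + (l.map α).sum + (l.map β).sum = n) (hN : t + n ≤ N) :
    blockGather N α β t a l = place n N t (blockGather n α β 0 a l) := by
  rw [place_blockGather (by omega) hN, add_zero]

/-- If the gathering starts behind `t` terrestrial and `a` aerial strands, the row may first be
gathered on its own before its terrestrial strands pass in front of these `a` aerial strands. -/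
theorem blockGather_start {α β : X → ℕ} {t a : ℕ} {l : List X}
    (hN : t + a + (l.map α).sum + (l.map β).sum ≤ N) :
    blockGather N α β t a l =
      blockGather N α β (t + a) 0 l * (cross N t (l.map α).sum a)⁻¹ := by
  induction l using List.reverseRecOn with
  | nil => simp [blockGather, cross]
  | append_singleton l x ih =>
    simp only [List.map_append, List.map_cons, List.map_nil, List.sum_append, List.sum_cons,
      List.sum_nil, add_zero] at hN ⊢
    rw [blockGather_concat, blockGather_concat, ih (by omega), mul_assoc, mul_assoc,
      ← mul_inv_rev, ← mul_inv_rev, cross_add_right, cross_add_left, mul_assoc, mul_assoc, zero_add,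
      add_right_comm t a]
    congr 3
    exact (cross_far N t _ a _ _ _ (by omega)).symm

/-- Gathering a row of rows: each row may first be gathered on its own. -/
theorem blockGather_flatMap {α β : Y → ℕ} {F : X → List Y} {t a : ℕ} {l : List X}
    (hN : t + a + ((l.flatMap F).map α).sum + ((l.flatMap F).map β).sum ≤ N) :
    blockGather N α β t a (l.flatMap F) =
      sideBySide N (fun x => ((F x).map α).sum + ((F x).map β).sum)
          (fun x => blockGather (((F x).map α).sum + ((F x).map β).sum) α β 0 0 (F x)) (t + a) l *
        blockGather N (fun x => ((F x).map α).sum) (fun x => ((F x).map β).sum) t a l := by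
  induction l generalizing t a with
  | nil => simp [blockGather, sideBySide]
  | cons x l ih =>
    simp only [List.flatMap_cons, List.map_append, List.sum_append] at hN ⊢
    have hs : (l.map fun x => ((F x).map α).sum + ((F x).map β).sum).sum =
        ((l.flatMap F).map α).sum + ((l.flatMap F).map β).sum := by
      rw [sum_flatMap, sum_flatMap, List.sum_map_add]
    rw [blockGather_append, blockGather_start (by omega), ih (by omega), sideBySide, blockGather,
      place_blockGather (by omega) (by omega), add_zero]
    have e : t + ((F x).map α).sum + (a + ((F x).map β).sum) =
        t + a + (((F x).map α).sum + ((F x).map β).sum) := by omega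
    rw [e]
    simp only [mul_assoc]
    congr 1
    rw [← mul_assoc, ← mul_assoc]
    congr 1
    rw [inv_mul_eq_iff_eq_mul, ← mul_assoc, eq_mul_inv_iff_mul_eq,
      sideBySide_eq_place (by omega), cross_place_comm (by omega) (by omega)]

/-- Three kinds of strands: if every block consists of strands of kinds `α`, `β`, `γ`, then gathering
`α` in front of `β` and `γ`, and then `β` in front of `γ`, is the same as gathering `α` and `β`
in front of `γ`, and then `α` in front of `β`. -/
theorem blockGather_three {α β γ : X → ℕ} {l : List X}
    (hN : (l.map α).sum + (l.map β).sum + (l.map γ).sum ≤ N) :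
    blockGather N α (fun x => β x + γ x) 0 0 l * blockGather N β γ (l.map α).sum 0 l =
      blockGather N (fun x => α x + β x) γ 0 0 l * blockGather N α β 0 0 l := by
  induction l using List.reverseRecOn with
  | nil => simp [blockGather]
  | append_singleton l x ih =>
    simp only [List.map_append, List.map_cons, List.map_nil, List.sum_append, List.sum_cons,
      List.sum_nil, add_zero] at hN ⊢
    simp only [blockGather_concat, List.sum_map_add, zero_add]
    have ih' := ih (by omega)
    set P := (l.map α).sum
    set Q := (l.map β).sum
    set R := (l.map γ).sum
    -- the strands of kinds `β` and `γ` slide through the block of strands `α x` in front of them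
    have h1 : blockGather N β γ (P + α x) 0 l * cross N P (α x) (Q + R) =
        cross N P (α x) (Q + R) * blockGather N β γ P 0 l := by
      rw [blockGather_eq_place (n := Q + R) (by simp only [Q, R]; omega) (by omega),
        place_cross_right (by omega), ← blockGather_eq_place (by simp only [Q, R]; omega) (by omega)]
    have h2 : blockGather N α β 0 0 l * cross N (P + Q) (α x + β x) R =
        cross N (P + Q) (α x + β x) R * blockGather N α β 0 0 l := by
      rw [blockGather_eq_place (n := P + Q) (by simp only [P, Q]; omega) (by omega),
        place_cross_comm (by omega) (by omega)]
    have h1' : (cross N P (α x) (Q + R))⁻¹ * blockGather N β γ (P + α x) 0 l =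
        blockGather N β γ P 0 l * (cross N P (α x) (Q + R))⁻¹ := by
      rw [inv_mul_eq_iff_eq_mul, ← mul_assoc, ← h1, mul_inv_cancel_right]
    have h2' : (cross N (P + Q) (α x + β x) R)⁻¹ * blockGather N α β 0 0 l =
        blockGather N α β 0 0 l * (cross N (P + Q) (α x + β x) R)⁻¹ := by
      rw [inv_mul_eq_iff_eq_mul, ← mul_assoc, ← h2, mul_inv_cancel_right]
    have h3 : (cross N P (α x) (Q + R))⁻¹ * (cross N (P + α x + Q) (β x) R)⁻¹ =
        (cross N (P + Q) (α x + β x) R)⁻¹ * (cross N P (α x) Q)⁻¹ := by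
      rw [← mul_inv_rev, ← mul_inv_rev, cross_add_right, cross_add_left, ← mul_assoc, ← mul_assoc,
        cross_far N P (α x) Q _ _ _ (by omega), add_right_comm P (α x) Q]
    calc _ = blockGather N α (fun x => β x + γ x) 0 0 l *
          ((cross N P (α x) (Q + R))⁻¹ * blockGather N β γ (P + α x) 0 l) *
          (cross N (P + α x + Q) (β x) R)⁻¹ := by simp only [mul_assoc]
      _ = blockGather N α (fun x => β x + γ x) 0 0 l * blockGather N β γ P 0 l *
          ((cross N P (α x) (Q + R))⁻¹ * (cross N (P + α x + Q) (β x) R)⁻¹) := by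
            rw [h1']; simp only [mul_assoc]
      _ = blockGather N (fun x => α x + β x) γ 0 0 l *
          (blockGather N α β 0 0 l * (cross N (P + Q) (α x + β x) R)⁻¹) *
          (cross N P (α x) Q)⁻¹ := by rw [ih', h3]; simp only [mul_assoc]
      _ = _ := by rw [← h2']; simp only [mul_assoc]

/-- Braids on the aerial strands of the blocks slide through the gathering. -/
theorem sideBySide_mul_blockGather {α β : X → ℕ} (g : ∀ x, BraidGroup (β x)) {l : List X}
    (hN : (l.map α).sum + (l.map β).sum ≤ N) :
    sideBySide N (fun x => α x + β x) (fun x => place (β x) (α x + β x) (α x) (g x)) 0 l *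
        blockGather N α β 0 0 l =
      blockGather N α β 0 0 l * sideBySide N β g (l.map α).sum l := by
  induction l using List.reverseRecOn with
  | nil => simp [blockGather, sideBySide]
  | append_singleton l x ih =>
    simp only [List.map_append, List.map_cons, List.map_nil, List.sum_append, List.sum_cons,
      List.sum_nil, add_zero] at hN ⊢
    have ih' := ih (by omega)
    rw [blockGather_concat, sideBySide_append, sideBySide_append, List.sum_map_add]
    simp only [sideBySide, mul_one, zero_add]
    set P := (l.map α).sum
    set Q := (l.map β).sum
    rw [place_place (by omega) (by omega)]
    have h1 : place (β x) N (P + Q + α x) (g x) * blockGather N α β 0 0 l =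
        blockGather N α β 0 0 l * place (β x) N (P + Q + α x) (g x) := by
      rw [blockGather_eq_place (n := P + Q) (by simp only [P, Q]; omega) (by omega),
        ← place_comm (by omega) (by omega)]
    have h2 : sideBySide N β g (P + α x) l * cross N P (α x) Q =
        cross N P (α x) Q * sideBySide N β g P l := by
      rw [sideBySide_eq_place (by omega), place_cross_right (by omega),
        ← sideBySide_eq_place (by omega)]
    have h3 : place (β x) N (P + Q + α x) (g x) * cross N P (α x) Q =
        cross N P (α x) Q * place (β x) N (P + Q + α x) (g x) :=
      cross_place_comm (by omega) (by omega) _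
    rw [mul_assoc, ← mul_assoc (place _ _ _ _), h1, mul_assoc, ← mul_assoc, ih', mul_assoc,
      mul_assoc]
    congr 1
    rw [eq_inv_mul_iff_mul_eq, ← mul_assoc, ← mul_assoc, ← h2,
      mul_assoc (sideBySide N β g (P + α x) l), ← h3, add_right_comm P Q]
    simp only [mul_assoc, mul_inv_cancel, mul_one]

/-- Cabling turns the gathering of strands into the gathering of blocks. -/
theorem cableL_gather {m : A ⊕ B → ℕ} {T E l : List (A ⊕ B)}
    (hr : T.length + E.length + l.length = r) (hN : ((T ++ (E ++ l)).map m).sum ≤ N) :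
    cableL r N (gather r T.length E.length l) m (T ++ (E ++ l)) =
      blockGather N (Sum.elim (fun a => m (Sum.inl a)) fun _ => 0)
        (Sum.elim (fun _ => 0) fun b => m (Sum.inr b)) (T.map m).sum (E.map m).sum l := by
  induction l generalizing T E with
  | nil => rw [gather, cableL_one, blockGather]
  | cons c l ih =>
    rcases c with c | c
    · have h1 := ih (T := T ++ [Sum.inl c]) (E := E) (by simp at *; omega) (by simp at *; omega)
      have h2 := carries_cross (N := r) T [Sum.inl c] E l rfl (by simp at *; omega)
      have h3 := cableL_cross (N := N) (r := r) (n := m) (pre := T) (A := [Sum.inl c]) (B := E)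
        (post := l) (by simp at *; omega) (by simp at *; omega)
      simp only [List.length_append, List.length_cons, List.length_nil, zero_add] at h1 h2 h3
      simp only [List.append_assoc, List.singleton_append] at h1 h2 h3
      rw [gather, cableL_mul m h2.inv, cableL_inv m h2, h3, h1, blockGather]
      simp
    · have h1 := ih (T := T) (E := E ++ [Sum.inr c]) (by simp at *; omega) (by simp at *; omega)
      simp only [List.length_append, List.length_cons, List.length_nil, zero_add,
        List.append_assoc, List.singleton_append] at h1
      rw [gather, h1, blockGather]
      simp [cross]

end

end BraidGroup

namespace BraidGroup

/-! ### Braids of aerial strands between gatherings -/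

section
variable {X A B A' B' : Type} {r N a b : ℕ}

theorem blockGather_congr {α α' β β' : X → ℕ} {l : List X} (hα : ∀ x ∈ l, α x = α' x)
    (hβ : ∀ x ∈ l, β x = β' x) (t s : ℕ) :
    blockGather N α β t s l = blockGather N α' β' t s l := by
  induction l generalizing t s with
  | nil => rfl
  | cons x l ih =>
    rw [blockGather, blockGather, hα x (by simp), hβ x (by simp),
      ih (fun y hy => hα y (by simp [hy])) fun y hy => hβ y (by simp [hy])]

theorem blockGather_zero_left {α : X → ℕ} {l : List X} (hα : ∀ x ∈ l, α x = 0) (β : X → ℕ)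
    (t s : ℕ) : blockGather N α β t s l = 1 := by
  rw [blockGather_congr hα (fun _ _ => rfl)]
  induction l generalizing s with
  | nil => rfl
  | cons x l ih => simp [blockGather, cross, ih fun y hy => hα y (by simp [hy])]

theorem sum_elim_left (f : A → ℕ) (l : List (A ⊕ B)) :
    (l.map (Sum.elim f fun _ => 0)).sum = ((l.filterMap Sum.getLeft?).map f).sum := by
  induction l with
  | nil => rfl
  | cons c l ih => rcases c with c | c <;> simp [List.filterMap_cons, ih]

theorem sum_elim_right (f : B → ℕ) (l : List (A ⊕ B)) :
    (l.map (Sum.elim (fun _ => 0) f)).sum = ((l.filterMap Sum.getRight?).map f).sum := by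
  induction l with
  | nil => rfl
  | cons c l ih => rcases c with c | c <;> simp [List.filterMap_cons, ih]

theorem sum_elim (m : A ⊕ B → ℕ) (l : List (A ⊕ B)) :
    (l.map m).sum = ((l.filterMap Sum.getLeft?).map fun a => m (Sum.inl a)).sum +
      ((l.filterMap Sum.getRight?).map fun b => m (Sum.inr b)).sum := by
  induction l with
  | nil => rfl
  | cons c l ih => rcases c with c | c <;> simp [List.filterMap_cons, ih] <;> omega

theorem sideBySide_filterMap_right {n : A ⊕ B → ℕ} (g : ∀ c, BraidGroup (n c))
    (hn : ∀ a, n (Sum.inl a) = 0) (k : ℕ) (l : List (A ⊕ B)) :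
    sideBySide N n g k l = sideBySide N (fun b => n (Sum.inr b)) (fun b => g (Sum.inr b)) k
      (l.filterMap Sum.getRight?) := by
  induction l generalizing k with
  | nil => rfl
  | cons c l ih =>
    rcases c with c | c
    · have h := eq_one_of_le_one (by rw [hn c]; omega) (g (Sum.inl c))
      simp [sideBySide, List.filterMap_cons, ih, h, hn c]
    · simp [sideBySide, ih]

/-- The braid which gathers the terrestrial strands of the row `l` in front of the aerial ones,
applies `x` to the aerial strands, and moves the terrestrial strands to their places in the row `l'`.
The number `a` is the position of the first aerial strand, that is, the number of terrestrial strands. -/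
def rhoBraid (N a : ℕ) (l l' : List (A ⊕ B)) (x : BraidGroup b) : BraidGroup N :=
  gather N 0 0 l * place b N a x * (gather N 0 0 l')⁻¹

theorem length_filterMap_add (l : List (A ⊕ B)) :
    (l.filterMap Sum.getLeft?).length + (l.filterMap Sum.getRight?).length = l.length := by
  simpa using (sum_elim (fun _ => 1) l).symm

theorem carries_gather_zero {l : List (A ⊕ B)} (hl : l.length ≤ r) :
    Carries (gather r 0 0 l) l ((l.filterMap Sum.getLeft?).map Sum.inl ++
      (l.filterMap Sum.getRight?).map Sum.inr) := by
  simpa using carries_gather (N := r) l [] [] (by simpa)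

theorem carries_place_append {u : List A} {v v' : List B} {x : BraidGroup b} (hu : u.length = a)
    (hv : v.length = b) (hr : a + b ≤ r) (h : Carries x v v') :
    Carries (place b r a x) (u.map Sum.inl ++ v.map Sum.inr)
      (u.map Sum.inl ++ v'.map (Sum.inr : B → A ⊕ B)) := by
  have := (h.map (Sum.inr : B → A ⊕ B)).place (N := r) (by simpa) (by simpa using h.length hv) hr
    (u.map Sum.inl) [] (by simpa)
  simpa using this

theorem carries_rhoBraid {l l' : List (A ⊕ B)} {x : BraidGroup b} (hl : l.length = r)
    (hu : (l.filterMap Sum.getLeft?).length = a) (hb : a + b = r)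
    (ho : l.filterMap Sum.getLeft? = l'.filterMap Sum.getLeft?)
    (hx : Carries x (l.filterMap Sum.getRight?) (l'.filterMap Sum.getRight?)) :
    Carries (rhoBraid r a l l' x) l l' := by
  have h1 := length_filterMap_add l
  have h2 := length_filterMap_add l'
  have h3 := hx.length (by omega)
  have h4 := congrArg List.length ho
  have hp := carries_place_append (r := r) hu (by omega) (by omega) hx
  refine ((carries_gather_zero hl.le).mul hp).mul ?_
  rw [ho]
  exact (carries_gather_zero (by omega)).inv

/-- Cabling of a braid of aerial strands between gatherings. -/
theorem cableL_rhoBraid {l l' : List (A ⊕ B)} {x : BraidGroup b} {m : A ⊕ B → ℕ} {M : ℕ}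
    (hl : l.length = r)
    (hu : (l.filterMap Sum.getLeft?).length = a) (hb : a + b = r)
    (ho : l.filterMap Sum.getLeft? = l'.filterMap Sum.getLeft?)
    (hx : Carries x (l.filterMap Sum.getRight?) (l'.filterMap Sum.getRight?))
    (hM : ((l.filterMap Sum.getRight?).map fun b => m (Sum.inr b)).sum = M)
    (hN : (l.map m).sum ≤ N) :
    cableL r N (rhoBraid r a l l' x) m l =
      blockGather N (Sum.elim (fun a => m (Sum.inl a)) fun _ => 0)
          (Sum.elim (fun _ => 0) fun b => m (Sum.inr b)) 0 0 l *
        place M N ((l.filterMap Sum.getLeft?).map fun a => m (Sum.inl a)).sum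
          (cableL b M x (fun b => m (Sum.inr b)) (l.filterMap Sum.getRight?)) *
        (blockGather N (Sum.elim (fun a => m (Sum.inl a)) fun _ => 0)
          (Sum.elim (fun _ => 0) fun b => m (Sum.inr b)) 0 0 l')⁻¹ := by
  have h1 := length_filterMap_add l
  have h2 := length_filterMap_add l'
  have hb' : (l.filterMap Sum.getRight?).length = b := by omega
  have h3 := hx.length hb'
  have h4 := congrArg List.length ho
  have hp := carries_place_append (r := r) hu hb' (by omega) hx
  have hg := carries_gather_zero (l := l) hl.le
  have hg' := carries_gather_zero (l := l') (r := r) (by omega)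
  rw [← ho] at hg'
  have hN' : (l'.map m).sum ≤ N := by
    rw [sum_elim m l', ← ho, hx.sum_eq hb', ← sum_elim]; exact hN
  rw [sum_elim m l] at hN
  have c1 := cableL_gather (N := N) (r := r) (m := m) (T := []) (E := []) (l := l)
    (by simpa) (by rw [List.nil_append, List.nil_append, sum_elim]; exact hN)
  have c2 := cableL_gather (N := N) (r := r) (m := m) (T := []) (E := []) (l := l')
    (by simp; omega) (by simpa)
  have c3 := cableL_place (N := N) (r := r) (n := m)
    (pre := (l.filterMap Sum.getLeft?).map Sum.inl)
    (l := (l.filterMap Sum.getRight?).map Sum.inr) (post := []) (b := x) (M := M)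
    (by simpa) (by rw [List.map_map]; exact hM) (by simp; omega)
    (by rw [List.append_nil, List.map_append, List.sum_append, List.map_map, List.map_map]
        exact hN)
  simp only [List.length_nil, List.nil_append, List.map_nil, List.sum_nil] at c1 c2
  rw [List.length_map, hu, List.append_nil, List.map_map, cableL_map] at c3
  rw [rhoBraid, cableL_mul m (hg.mul hp), cableL_mul m hg, cableL_inv m hg', c1, c2, c3]
  rfl

/-- The comparison of the two ways in which the terrestrial strands of a composite pass the aerial
strands: either first all the terrestrial strands of the blocks (`κ`) pass all the aerial strands (`ν`
in the blocks, `μ` outside of the blocks), or first the blocks pass the aerial strands outside of the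
blocks. The two ways differ by a braid `H` on the strands of the blocks, which is the same for `l` and
for `l'`, and which commutes with the cabling of `x`. -/
theorem blockGather_mul_cableL_rhoBraid {l l' : List (A ⊕ B)} {x : BraidGroup b}
    {κ ν : A → ℕ} {μ : B → ℕ} {M P : ℕ} (hl : l.length = r)
    (hu : (l.filterMap Sum.getLeft?).length = a) (hb : a + b = r)
    (ho : l.filterMap Sum.getLeft? = l'.filterMap Sum.getLeft?)
    (hx : Carries x (l.filterMap Sum.getRight?) (l'.filterMap Sum.getRight?))
    (hP : (l.map (Sum.elim κ fun _ => 0)).sum = P)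
    (hM : (l.map (Sum.elim ν μ)).sum = M) (hN : P + M ≤ N) :
    blockGather N (Sum.elim κ fun _ => 0) (Sum.elim ν μ) 0 0 l *
        place M N P (cableL r M (rhoBraid r a l l' x) (Sum.elim ν μ) l) *
        (blockGather N (Sum.elim κ fun _ => 0) (Sum.elim ν μ) 0 0 l')⁻¹ =
      cableL r N (rhoBraid r a l l' x) (Sum.elim (fun a => κ a + ν a) μ) l := by
  have hb' : (l.filterMap Sum.getRight?).length = b := by
    have := length_filterMap_add l; omega
  set xs := l.filterMap Sum.getRight? with hxs
  set u := l.filterMap Sum.getLeft? with hu'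
  set Q := (xs.map μ).sum with hQ
  set V := (u.map ν).sum with hV
  have hsM : (l.map (Sum.elim ν μ)).sum = V + Q := sum_elim _ l
  have hsP : (l.map (Sum.elim κ fun _ => 0)).sum = (u.map κ).sum := sum_elim_left κ l
  have hsP' : (l'.map (Sum.elim κ fun _ => 0)).sum = (u.map κ).sum :=
    ho ▸ sum_elim_left κ l'
  have hsν : (l.map (Sum.elim ν fun _ => 0)).sum = V := sum_elim_left ν l
  have hsν' : (l'.map (Sum.elim ν fun _ => 0)).sum = V := by
    rw [hV, ho]; exact sum_elim_left ν l'
  have hsμ : (l.map (Sum.elim (fun _ => 0) μ)).sum = Q := sum_elim_right μ l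
  have hsμ' : (l'.map (Sum.elim (fun _ => 0) μ)).sum = Q :=
    (sum_elim_right μ l').trans (hx.sum_eq hb' μ)
  have hsum : (l.map (Sum.elim (fun a => κ a + ν a) μ)).sum ≤ N := by
    have : (l.map (Sum.elim (fun a => κ a + ν a) μ)).sum =
        (u.map fun a => κ a + ν a).sum + Q := sum_elim _ l
    rw [List.sum_map_add] at this
    omega
  have c1 : cableL r M (rhoBraid r a l l' x) (Sum.elim ν μ) l =
      blockGather M (Sum.elim ν fun _ => 0) (Sum.elim (fun _ => 0) μ) 0 0 l *
        place Q M V (cableL b Q x μ xs) *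
        (blockGather M (Sum.elim ν fun _ => 0) (Sum.elim (fun _ => 0) μ) 0 0 l')⁻¹ :=
    cableL_rhoBraid hl hu hb ho hx rfl hM.le
  have c2 : cableL r N (rhoBraid r a l l' x) (Sum.elim (fun a => κ a + ν a) μ) l =
      blockGather N (Sum.elim (fun a => κ a + ν a) fun _ => 0) (Sum.elim (fun _ => 0) μ) 0 0 l *
        place Q N (u.map fun a => κ a + ν a).sum (cableL b Q x μ xs) *
        (blockGather N (Sum.elim (fun a => κ a + ν a) fun _ => 0)
          (Sum.elim (fun _ => 0) μ) 0 0 l')⁻¹ :=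
    cableL_rhoBraid hl hu hb ho hx rfl hsum
  have hPκ : (u.map κ).sum = P := by rw [← hP, hsP]
  rw [List.sum_map_add, hPκ, ← hV] at c2
  have e : (Sum.elim ν μ : A ⊕ B → ℕ) =
      fun c => (Sum.elim ν fun _ => 0) c + (Sum.elim (fun _ => 0) μ : A ⊕ B → ℕ) c := by
    funext c; rcases c with c | c <;> simp
  have e' : (Sum.elim (fun a => κ a + ν a) fun _ => 0 : A ⊕ B → ℕ) =
      fun c => (Sum.elim κ fun _ => 0 : A ⊕ B → ℕ) c + (Sum.elim ν fun _ => 0) c := by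
    funext c; rcases c with c | c <;> simp
  have t1 := blockGather_three (N := N) (α := (Sum.elim κ fun _ => 0 : A ⊕ B → ℕ))
    (β := Sum.elim ν fun _ => 0) (γ := Sum.elim (fun _ => 0) μ) (l := l) (by omega)
  have t2 := blockGather_three (N := N) (α := (Sum.elim κ fun _ => 0 : A ⊕ B → ℕ))
    (β := Sum.elim ν fun _ => 0) (γ := Sum.elim (fun _ => 0) μ) (l := l') (by omega)
  rw [← e, ← e', blockGather_filterMap_left κ ν] at t1 t2
  rw [← ho] at t2
  rw [hP] at t1
  rw [hsP', hPκ] at t2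
  rw [c1, c2, map_mul, map_mul, map_inv, place_blockGather (by omega) hN,
    place_blockGather (by omega) hN, place_place (by omega) hN, add_zero]
  set H := blockGather N κ ν 0 0 u with hH
  set z := cableL b Q x μ xs
  have hc : H * place Q N (P + V) z = place Q N (P + V) z * H := by
    rw [hH, blockGather_eq_place (n := P + V) (by omega) (by omega),
      place_comm (by omega) (by omega)]
  have t2' := congrArg Inv.inv t2
  rw [mul_inv_rev, mul_inv_rev] at t2'
  calc _ = blockGather N (Sum.elim κ fun _ => 0) (Sum.elim ν μ) 0 0 l *
        blockGather N (Sum.elim ν fun _ => 0) (Sum.elim (fun _ => 0) μ) P 0 l *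
        place Q N (P + V) z *
        ((blockGather N (Sum.elim ν fun _ => 0) (Sum.elim (fun _ => 0) μ) P 0 l')⁻¹ *
          (blockGather N (Sum.elim κ fun _ => 0) (Sum.elim ν μ) 0 0 l')⁻¹) := by
        simp only [mul_assoc]
    _ = _ := by
      rw [t1, t2', mul_assoc _ H, hc]
      simp only [mul_assoc, mul_inv_cancel_left]

/-- The operation `ρ` is compatible with compositions: the insertion of the braids `ρ (γ c)` into
`ρ (x)` is `ρ` of the insertion of the braids `γ c` into `ρ (x)`. Here the row `l` is replaced by a
row of blocks `F c`, which consist of `κ c` terrestrial and `ν c` aerial points; the block of an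
aerial point has aerial points only. -/
theorem rhoBraid_insert {l l' : List (A ⊕ B)} {x : BraidGroup b} {κ ν : A ⊕ B → ℕ}
    {F F' : A ⊕ B → List (A' ⊕ B')} {M P : ℕ} (γ : ∀ c, BraidGroup (ν c)) (hl : l.length = r)
    (hu : (l.filterMap Sum.getLeft?).length = a) (hb : a + b = r)
    (ho : l.filterMap Sum.getLeft? = l'.filterMap Sum.getLeft?)
    (hx : Carries x (l.filterMap Sum.getRight?) (l'.filterMap Sum.getRight?))
    (hκ : ∀ b, κ (Sum.inr b) = 0)
    (hF : ∀ c, ((F c).filterMap Sum.getLeft?).length = κ c)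
    (hF' : ∀ c, ((F' c).filterMap Sum.getLeft?).length = κ c)
    (hG : ∀ c, ((F c).filterMap Sum.getRight?).length = ν c)
    (hG' : ∀ c, ((F' c).filterMap Sum.getRight?).length = ν c)
    (hP : (l.map κ).sum = P) (hM : (l.map ν).sum = M) (hN : P + M = N) :
    rhoBraid N P (l.flatMap F) (l'.flatMap F') (insert r M ν l (rhoBraid r a l l' x) γ) =
      insert r N (fun c => κ c + ν c) l (rhoBraid r a l l' x) fun c =>
        rhoBraid (κ c + ν c) (κ c) (F c) (F' c) (γ c) := by
  have hC := carries_rhoBraid hl hu hb ho hx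
  have hsκ := hC.sum_eq hl κ
  have hsν := hC.sum_eq hl ν
  have key : ∀ (F : A ⊕ B → List (A' ⊕ B')) (l : List (A ⊕ B)),
      (∀ c, ((F c).filterMap Sum.getLeft?).length = κ c) →
      (∀ c, ((F c).filterMap Sum.getRight?).length = ν c) →
      (l.map κ).sum + (l.map ν).sum ≤ N →
      gather N 0 0 (l.flatMap F) = sideBySide N (fun c => κ c + ν c)
        (fun c => gather (κ c + ν c) 0 0 (F c)) 0 l * blockGather N κ ν 0 0 l := by
    intro F l hF hG hN
    have e1 : ∀ c, ((F c).map (Sum.elim (fun _ => 1) fun _ => 0)).sum = κ c := fun c => by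
      rw [sum_elim_left]; simpa using hF c
    have e2 : ∀ c, ((F c).map (Sum.elim (fun _ => 0) fun _ => 1)).sum = ν c := fun c => by
      rw [sum_elim_right]; simpa using hG c
    have h := blockGather_flatMap (N := N) (α := (Sum.elim (fun _ => 1) fun _ => 0 : A' ⊕ B' → ℕ))
      (β := Sum.elim (fun _ => 0) fun _ => 1) (F := F) (t := 0) (a := 0) (l := l)
      (by
        rw [sum_flatMap, sum_flatMap]
        simp only [e1, e2, zero_add]
        exact hN)
    simp only [e1, e2] at h
    rw [gather_eq_blockGather, h]
    congr 1
    refine sideBySide_congr (fun c _ => by rw [e1, e2]) (fun c _ k _ => ?_) ?_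
    · rw [gather_eq_blockGather, e1, e2]
    · simp only [e1, e2]
      rw [List.sum_map_add]
      exact (zero_add _).trans_le hN
  have hκν : (Sum.elim (fun a => κ (Sum.inl a)) fun _ => 0 : A ⊕ B → ℕ) = κ := by
    funext c; rcases c with c | c
    · rfl
    · exact (hκ c).symm
  have hνν : (Sum.elim (fun a => ν (Sum.inl a)) fun b => ν (Sum.inr b) : A ⊕ B → ℕ) = ν := by
    funext c; rcases c with c | c <;> rfl
  have hκν' : (Sum.elim (fun a => κ (Sum.inl a) + ν (Sum.inl a)) fun b => ν (Sum.inr b) :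
      A ⊕ B → ℕ) = fun c => κ c + ν c := by
    funext c; rcases c with c | c
    · rfl
    · simp [hκ]
  have hbg := blockGather_mul_cableL_rhoBraid (N := N) (κ := fun a => κ (Sum.inl a))
    (ν := fun a => ν (Sum.inl a)) (μ := fun b => ν (Sum.inr b)) (M := M) (P := P) hl hu hb ho hx
    (by rw [hκν, hP]) (by rw [hνν, hM]) hN.le
  rw [hκν, hνν, hκν'] at hbg
  have hlN : (l.map fun c => κ c + ν c).sum ≤ N :=
    List.sum_map_add.trans_le (by rw [hP, hM, hN])
  have hsl := sideBySide_mul_blockGather (N := N) γ (l := l) (α := κ) (by omega)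
  have hi := sideBySide_mul_cableL (N := N)
    (fun c => gather (κ c + ν c) 0 0 (F' c)) hl hC hlN
  rw [rhoBraid, key F l hF hG (by omega), key F' l' hF' hG' (by omega), insert, map_mul,
    place_sideBySide (by omega) hN.le, add_zero, mul_inv_rev, insert]
  simp only [rhoBraid]
  rw [sideBySide_mul _ _ (by simpa using hlN), sideBySide_mul _ _ (by simpa using hlN),
    sideBySide_inv _ (by simpa using hlN), ← rhoBraid]
  set S := sideBySide N (fun c => κ c + ν c) (fun c => gather (κ c + ν c) 0 0 (F c)) 0 l
  set S' := sideBySide N (fun c => κ c + ν c) (fun c => gather (κ c + ν c) 0 0 (F' c)) 0 l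
  set S'' := sideBySide N (fun c => κ c + ν c) (fun c => gather (κ c + ν c) 0 0 (F' c)) 0 l'
  set U := sideBySide N (fun c => κ c + ν c)
    (fun c => place (ν c) (κ c + ν c) (κ c) (γ c)) 0 l
  set C := cableL r N (rhoBraid r a l l' x) (fun c => κ c + ν c) l
  have hi' : C * S''⁻¹ = S'⁻¹ * C := by
    rw [mul_inv_eq_iff_eq_mul, mul_assoc, ← hi, inv_mul_cancel_left]
  calc _ = S * (blockGather N κ ν 0 0 l * sideBySide N ν γ P l) *
        place M N P (cableL r M (rhoBraid r a l l' x) ν l) *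
        (blockGather N κ ν 0 0 l')⁻¹ * S''⁻¹ := by simp only [mul_assoc]
    _ = S * U * (blockGather N κ ν 0 0 l * place M N P (cableL r M (rhoBraid r a l l' x) ν l) *
        (blockGather N κ ν 0 0 l')⁻¹) * S''⁻¹ := by
        rw [← hP, ← hsl]; simp only [mul_assoc]
    _ = S * U * (C * S''⁻¹) := by rw [hbg]; simp only [mul_assoc]
    _ = _ := by rw [hi']; simp only [mul_assoc]

/-- Deletion of the terrestrial strands recovers `x` from `ρ (x)`. -/
theorem insert_rhoBraid_delete {l l' : List (A ⊕ B)} {x : BraidGroup b} {n : A ⊕ B → ℕ}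
    (g : ∀ c, BraidGroup (n c)) {M : ℕ} (hl : l.length = r)
    (hu : (l.filterMap Sum.getLeft?).length = a) (hb : a + b = r)
    (ho : l.filterMap Sum.getLeft? = l'.filterMap Sum.getLeft?)
    (hx : Carries x (l.filterMap Sum.getRight?) (l'.filterMap Sum.getRight?))
    (hn : ∀ a, n (Sum.inl a) = 0)
    (hM : ((l.filterMap Sum.getRight?).map fun b => n (Sum.inr b)).sum = M) :
    insert r M n l (rhoBraid r a l l' x) g =
      insert b M (fun b => n (Sum.inr b)) (l.filterMap Sum.getRight?) x fun b => g (Sum.inr b) := by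
  have hs := sum_elim n l
  simp only [hn, List.map_const', List.sum_replicate, smul_zero, zero_add] at hs
  have hz : ∀ c : A ⊕ B, (Sum.elim (fun a => n (Sum.inl a)) fun _ => 0 : A ⊕ B → ℕ) c = 0 := by
    rintro (c | c)
    · exact hn c
    · rfl
  rw [insert, insert, sideBySide_filterMap_right g hn,
    cableL_rhoBraid hl hu hb ho hx hM (hs.trans hM).le,
    blockGather_zero_left fun c _ => hz c, blockGather_zero_left fun c _ => hz c]
  simp [hn, place_self]

end

end BraidGroup

/-! ### Substitution in the relative magma operad -/

theorem FreeMagma.map_map' {A B C : Type} (f : A → B) (g : B → C) (s : FreeMagma A) :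
    FreeMagma.map g (FreeMagma.map f s) = FreeMagma.map (fun a => g (f a)) s := by
  induction s using FreeMagma.recOnMul with
  | ih1 a => rfl
  | ih2 s t hs ht => simp only [map_mul, hs, ht]

theorem FreeMagma.map_id' {A : Type} (s : FreeMagma A) : FreeMagma.map (fun a => a) s = s := by
  induction s using FreeMagma.recOnMul with
  | ih1 a => rfl
  | ih2 s t hs ht => simp only [map_mul, hs, ht]

namespace OMag

variable {A B : Type}

theorem f_coe (s : FreeMagma B) : (f (s : Mag B) : OMag A B) = Mag.of (Sum.inr s) := rfl

@[simp] theorem relabel_of_inl {A' B' : Type} (g : A → A') (h : B → B') (a : A) :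
    relabel g h (Mag.of (Sum.inl a)) = Mag.of (Sum.inl (g a)) := rfl

@[simp] theorem relabel_of_inr {A' B' : Type} (g : A → A') (h : B → B') (s : FreeMagma B) :
    relabel g h (Mag.of (Sum.inr s)) = Mag.of (Sum.inr (FreeMagma.map h s)) := rfl

theorem relabel_f {A' B' : Type} (g : A → A') (h : B → B') (t : Mag B) :
    relabel g h (f t) = f (Mag.map h t) := by
  induction t using WithOne.recOneCoe with
  | one => simp [f]
  | coe s => rw [f_coe, relabel_of_inr, ← coe_map, f_coe]

theorem substOpen_f {K L : A → Type} (t : Mag B) (ν : ∀ a, OMag (K a) (L a)) :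
    substOpen (f t) ν = f (Mag.map Sum.inl t) := by
  induction t using WithOne.recOneCoe with
  | one => simp [f, substOpen]
  | coe s => rw [← coe_map, f_coe]; rfl

theorem substClosed_f {M : B → Type} (t : Mag B) (y : ∀ b, Mag (M b)) :
    substClosed (f t : OMag A B) y = f (Mag.lift (fun b => Mag.map (Sigma.mk b) (y b)) t) := by
  induction t using WithOne.recOneCoe with
  | one => simp [f, substClosed]
  | coe s => rfl

theorem relabel_id (μ : OMag A B) : relabel (fun a => a) (fun b => b) μ = μ := by
  refine (Mag.lift_congr (fun c => ?_) μ).trans (Mag.lift_of_eq μ)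
  rcases c with a | s
  · rfl
  · exact congrArg (fun s => Mag.of (Sum.inr s)) (FreeMagma.map_id' s)

theorem relabel_relabel {A' A'' B' B'' : Type} (g : A → A') (h : B → B') (g' : A' → A'')
    (h' : B' → B'') (μ : OMag A B) :
    relabel g' h' (relabel g h μ) = relabel (fun a => g' (g a)) (fun b => h' (h b)) μ := by
  refine (Mag.lift_lift _ _ μ).trans (Mag.lift_congr (fun c => ?_) μ)
  rcases c with a | s
  · rfl
  · exact congrArg (fun s => Mag.of (Sum.inr s)) (FreeMagma.map_map' _ _ s)

/-- All operations on `OMag` are homomorphisms; two of them agree if they agree on letters. -/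
theorem hom_ext {M : Type} [MulOneClass M] {φ ψ : OMag A B →* M}
    (h : ∀ c, φ (Mag.of c) = ψ (Mag.of c)) (μ : OMag A B) : φ μ = ψ μ := by
  induction μ using Mag.induction with
  | one => rw [map_one, map_one]
  | of c => exact h c
  | mul s t hs ht => rw [map_mul, map_mul, hs, ht]

/-- `substOpen` as a homomorphism. -/
def substOpenHom {K L : A → Type} (ν : ∀ a, OMag (K a) (L a)) :
    OMag A B →* OMag (Σ a, K a) (B ⊕ Σ a, L a) :=
  Mag.lift (Sum.elim (fun a => relabel (Sigma.mk a) (fun l => Sum.inr ⟨a, l⟩) (ν a))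
    fun s => Mag.of (Sum.inr (FreeMagma.map Sum.inl s)))

/-- `substClosed` as a homomorphism. -/
def substClosedHom {M : B → Type} (t : ∀ b, Mag (M b)) : OMag A B →* OMag A (Σ b, M b) :=
  Mag.lift (Sum.elim (fun a => Mag.of (Sum.inl a))
    fun s : FreeMagma B => f (Mag.lift (fun b => Mag.map (Sigma.mk b) (t b)) (s : Mag B)))

theorem substOpen_relabel_left {A' B' : Type} {K L : A' → Type} (e : A ≃ A') (e' : B ≃ B')
    (μ : OMag A B) (ν : ∀ a, OMag (K a) (L a)) :
    relabel (Equiv.sigmaCongrLeft e) (Equiv.sumCongr e' (Equiv.sigmaCongrLeft e))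
        (substOpen μ fun a => ν (e a)) = substOpen (relabel e e' μ) ν :=
  hom_ext (φ := (relabel _ _).comp (substOpenHom fun a => ν (e a)))
    (ψ := (substOpenHom ν).comp (relabel e e')) (fun c => by
      rcases c with a | s
      · exact relabel_relabel _ _ _ _ _
      · change Mag.of (Sum.inr _) = Mag.of (Sum.inr _)
        rw [FreeMagma.map_map', FreeMagma.map_map']
        rfl) μ

theorem substOpen_relabel_right {K K' L L' : A → Type} (e : ∀ a, K a ≃ K' a)
    (d : ∀ a, L a ≃ L' a) (μ : OMag A B) (ν : ∀ a, OMag (K a) (L a)) :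
    relabel (Equiv.sigmaCongrRight e) (Equiv.sumCongr (Equiv.refl B) (Equiv.sigmaCongrRight d))
        (substOpen μ ν) = substOpen μ fun a => relabel (e a) (d a) (ν a) :=
  hom_ext (φ := (relabel _ _).comp (substOpenHom ν))
    (ψ := substOpenHom fun a => relabel (e a) (d a) (ν a)) (fun c => by
      rcases c with a | s
      · change relabel _ _ (relabel _ _ _) = relabel _ _ (relabel _ _ _)
        rw [relabel_relabel, relabel_relabel]
        rfl
      · change Mag.of (Sum.inr _) = Mag.of (Sum.inr _)
        rw [FreeMagma.map_map']
        rfl) μ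

theorem unit_substOpen {K L : Type} (ν : OMag K L) :
    relabel (Equiv.uniqueSigma fun _ : Unit => K)
      ((Equiv.emptySum Empty _).trans (Equiv.uniqueSigma fun _ : Unit => L))
      (substOpen (Mag.of (Sum.inl ()) : OMag Unit Empty) fun _ => ν) = ν :=
  (relabel_relabel _ _ _ _ _).trans (relabel_id ν)

theorem substOpen_unit (μ : OMag A B) :
    relabel (Equiv.sigmaPUnit A) (sumEmptyFamily A B)
      (substOpen μ fun _ => (Mag.of (Sum.inl ()) : OMag Unit Empty)) = μ :=
  hom_ext (φ := (relabel _ _).comp (substOpenHom fun _ => _)) (ψ := MonoidHom.id _) (fun c => by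
      rcases c with a | s
      · rfl
      · change Mag.of (Sum.inr _) = Mag.of (Sum.inr s)
        rw [FreeMagma.map_map']
        exact congrArg (fun s => Mag.of (Sum.inr s)) (FreeMagma.map_id' s)) μ

theorem substOpen_assoc {K L : A → Type} {K' L' : ∀ a, K a → Type} (μ : OMag A B)
    (ν : ∀ a, OMag (K a) (L a)) (ξ : ∀ a k, OMag (K' a k) (L' a k)) :
    relabel (Equiv.sigmaAssoc K') (closedAssoc L')
        (substOpen (substOpen μ ν) fun i => ξ i.1 i.2) =
      substOpen μ fun a => substOpen (ν a) (ξ a) :=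
  hom_ext (φ := ((relabel (Equiv.sigmaAssoc K') (closedAssoc L')).comp
      (substOpenHom fun i => ξ i.1 i.2)).comp (substOpenHom ν))
    (ψ := substOpenHom fun a => substOpen (ν a) (ξ a)) (fun c => by
      rcases c with a | s
      · refine hom_ext (φ := ((relabel (Equiv.sigmaAssoc K') (closedAssoc L')).comp
          (substOpenHom fun i => ξ i.1 i.2)).comp
            (relabel (Sigma.mk a) fun l => Sum.inr ⟨a, l⟩))
          (ψ := (relabel (Sigma.mk a) fun l => Sum.inr ⟨a, l⟩).comp (substOpenHom (ξ a)))
          (fun c => ?_) (ν a)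
        rcases c with k | s
        · change relabel _ _ (relabel _ _ _) = relabel _ _ (relabel _ _ _)
          rw [relabel_relabel, relabel_relabel]
          rfl
        · change Mag.of (Sum.inr _) = Mag.of (Sum.inr _)
          rw [FreeMagma.map_map', FreeMagma.map_map', FreeMagma.map_map']
          rfl
      · change Mag.of (Sum.inr _) = Mag.of (Sum.inr _)
        rw [FreeMagma.map_map', FreeMagma.map_map']
        rfl) μ

theorem substClosed_relabel_left {A' B' : Type} {M : B' → Type} (e : A ≃ A') (e' : B ≃ B')
    (μ : OMag A B) (t : ∀ b, Mag (M b)) :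
    relabel e (Equiv.sigmaCongrLeft e') (substClosed μ fun b => t (e' b)) =
      substClosed (relabel e e' μ) t :=
  hom_ext (φ := (relabel e (Equiv.sigmaCongrLeft e')).comp (substClosedHom fun b => t (e' b)))
    (ψ := (substClosedHom t).comp (relabel e e')) (fun c => by
      rcases c with a | s
      · rfl
      · refine (relabel_f _ _ _).trans (congrArg f ?_)
        rw [coe_map, Mag.lift_map, Mag.map_lift]
        exact Mag.lift_congr (fun b => Mag.map_map _ _ _) _) μ

theorem substClosed_relabel_right {M M' : B → Type} (d : ∀ b, M b ≃ M' b) (μ : OMag A B)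
    (t : ∀ b, Mag (M b)) :
    relabel (Equiv.refl A) (Equiv.sigmaCongrRight d) (substClosed μ t) =
      substClosed μ fun b => Mag.map (d b) (t b) :=
  hom_ext (φ := (relabel (Equiv.refl A) (Equiv.sigmaCongrRight d)).comp (substClosedHom t))
    (ψ := substClosedHom fun b => Mag.map (d b) (t b)) (fun c => by
      rcases c with a | s
      · rfl
      · refine (relabel_f _ _ _).trans (congrArg f ?_)
        rw [Mag.map_lift]
        refine Mag.lift_congr (fun b => ?_) _
        rw [Mag.map_map, Mag.map_map]
        rfl) μ

theorem substClosed_unit (μ : OMag A B) :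
    relabel (Equiv.refl A) (Equiv.sigmaPUnit B) (substClosed μ fun _ => Mag.of ()) = μ :=
  hom_ext (φ := (relabel (Equiv.refl A) (Equiv.sigmaPUnit B)).comp (substClosedHom fun _ => _))
    (ψ := MonoidHom.id _) (fun c => by
      rcases c with a | s
      · rfl
      · refine (relabel_f _ _ _).trans ?_
        rw [Mag.map_lift]
        exact congrArg f (Mag.lift_of_eq _)) μ

theorem substClosed_substClosed {M : B → Type} {N : ∀ b, M b → Type} (μ : OMag A B)
    (t : ∀ b, Mag (M b)) (z : ∀ b m, Mag (N b m)) :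
    relabel (Equiv.refl A) (Equiv.sigmaAssoc N)
        (substClosed (substClosed μ t) fun i => z i.1 i.2) =
      substClosed μ fun b => Mag.lift (fun m => Mag.map (Sigma.mk m) (z b m)) (t b) :=
  hom_ext (φ := ((relabel (Equiv.refl A) (Equiv.sigmaAssoc N)).comp
      (substClosedHom fun i => z i.1 i.2)).comp (substClosedHom t))
    (ψ := substClosedHom fun b => Mag.lift (fun m => Mag.map (Sigma.mk m) (z b m)) (t b))
    (fun c => by
      rcases c with a | s
      · rfl
      · refine (congrArg _ (substClosed_f _ _)).trans ((relabel_f _ _ _).trans (congrArg f ?_))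
        rw [Mag.lift_lift, Mag.map_lift]
        refine Mag.lift_congr (fun b => ?_) _
        rw [Mag.lift_map, Mag.map_lift, Mag.map_lift]
        refine Mag.lift_congr (fun m => ?_) _
        rw [Mag.map_map, Mag.map_map]
        rfl) μ

theorem substClosed_substOpen {K L : A → Type} {M : B → Type} {M' : ∀ a, L a → Type}
    (μ : OMag A B) (ν : ∀ a, OMag (K a) (L a)) (t : ∀ c, Mag (sumLabels M M' c)) :
    relabel (Equiv.refl _) (sumLabelsEquiv M M') (substClosed (substOpen μ ν) t) =
      substOpen (substClosed μ fun b => t (Sum.inl b))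
        fun a => substClosed (ν a) fun l => t (Sum.inr ⟨a, l⟩) :=
  hom_ext (φ := ((relabel (Equiv.refl _) (sumLabelsEquiv M M')).comp
      (substClosedHom t)).comp (substOpenHom ν))
    (ψ := (substOpenHom fun a => substClosed (ν a) fun l => t (Sum.inr ⟨a, l⟩)).comp
      (substClosedHom fun b => t (Sum.inl b)))
    (fun c => by
      rcases c with a | s
      · refine hom_ext (φ := ((relabel (Equiv.refl _) (sumLabelsEquiv M M')).comp
          (substClosedHom t)).comp (relabel (Sigma.mk a) fun l => Sum.inr ⟨a, l⟩))
          (ψ := (relabel (Sigma.mk a) fun i => Sum.inr ⟨a, i⟩).comp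
            (substClosedHom fun l => t (Sum.inr ⟨a, l⟩)))
          (fun c => ?_) (ν a)
        rcases c with k | s
        · rfl
        · refine (relabel_f _ _ _).trans (Eq.trans (congrArg f ?_) (relabel_f _ _ _).symm)
          rw [coe_map, Mag.lift_map, Mag.map_lift, Mag.map_lift]
          refine Mag.lift_congr (fun m => ?_) _
          rw [Mag.map_map, Mag.map_map]
          rfl
      · refine (relabel_f _ _ _).trans (Eq.trans (congrArg f ?_) (substOpen_f _ _).symm)
        rw [coe_map, Mag.lift_map, Mag.map_lift, Mag.map_lift]
        refine Mag.lift_congr (fun m => ?_) _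
        rw [Mag.map_map]
        exact (Mag.map_map (Sigma.mk m) Sum.inl (t (Sum.inl m) : Mag (M m))).symm) μ

end OMag

/-! ### The objects and morphisms of the relative operad -/

namespace BraidGroup

theorem insert_singleton {X : Type} {r N : ℕ} (n : X → ℕ) (x : X) (g : ∀ x, BraidGroup (n x)) :
    insert r N n [x] 1 g = place (n x) N 0 (g x) := by
  rw [insert, cableL_one, mul_one, sideBySide, sideBySide, mul_one]

theorem rhoBraid_map {A B A' B' : Type} {N a b : ℕ} (e : A → A') (d : B → B')
    (l l' : List (A ⊕ B)) (x : BraidGroup b) :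
    rhoBraid N a (l.map (Sum.map e d)) (l'.map (Sum.map e d)) x = rhoBraid N a l l' x := by
  rw [rhoBraid, gather_map, gather_map, rhoBraid]

theorem place_eq_of_le_one {n n' N k : ℕ} (hn : n ≤ 1) (hn' : n' ≤ 1) (b : BraidGroup n)
    (b' : BraidGroup n') : place n N k b = place n' N k b' := by
  rw [eq_one_of_le_one hn b, eq_one_of_le_one hn' b', map_one, map_one]

end BraidGroup

namespace PaPB'

variable {A B : Type}

/-- The entry `x` of an object `[u, x, μ]` is determined by `μ`. -/
theorem ext_of {p q : PaPB' A B} (hu : p.u = q.u) (hμ : p.μ.1 = q.μ.1) : p = q := by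
  have hμ' : p.μ = q.μ := Subtype.ext hμ
  refine PaPB'.ext hu (PaB.ext ?_) hμ'
  rw [← p.closed_eq, ← q.closed_eq, hμ']

theorem hom_ext {p p' : PaPB' A B} {f g : p ⟶ p'} (h : f.2.1 = g.2.1) : f = g :=
  Prod.ext (PLift.down_injective (Subsingleton.elim _ _)) (PaB.hom_ext h)

/-- Morphisms with equal sources and equal targets are equal if their braids are. -/
theorem hom_heq {p p' z z' : PaPB' A B} (h : p = z) (h' : p' = z') {f : p ⟶ p'} {g : z ⟶ z'}
    (e : f.2.1 = g.2.1) : HEq f g := by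
  subst h h'
  exact heq_of_eq (hom_ext e)

/-- The row of all letters. -/
abbrev row (p : PaPB' A B) : List (A ⊕ B) := p.rho.word.order

theorem row_left (p : PaPB' A B) : p.row.filterMap Sum.getLeft? = p.u.word.order := p.open_eq

theorem row_right (p : PaPB' A B) : p.row.filterMap Sum.getRight? = p.x.word.order := by
  rw [← p.closed_eq, MagmaMagma.order_closedPart]
  rfl

theorem length_row (p : PaPB' A B) : p.row.length = Nat.card (A ⊕ B) := p.rho.word.length_order

theorem length_row_left (p : PaPB' A B) :
    (p.row.filterMap Sum.getLeft?).length = Nat.card A := by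
  rw [row_left, OmegaPlus.length_order]

theorem length_row_right (p : PaPB' A B) :
    (p.row.filterMap Sum.getRight?).length = Nat.card B := by
  rw [row_right, OmegaPlus.length_order]

theorem card_add (p : PaPB' A B) : Nat.card A + Nat.card B = Nat.card (A ⊕ B) := by
  rw [← p.length_row, ← BraidGroup.length_filterMap_add, p.length_row_left, p.length_row_right]

theorem row_left_eq {p p' : PaPB' A B} (f : p ⟶ p') :
    p.row.filterMap Sum.getLeft? = p'.row.filterMap Sum.getLeft? := by
  rw [row_left, row_left]
  exact f.1.down

theorem carries_right {p p' : PaPB' A B} (f : p ⟶ p') :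
    f.2.1.Carries (p.row.filterMap Sum.getRight?) (p'.row.filterMap Sum.getRight?) := by
  rw [row_right, row_right]
  exact f.2.2

theorem rhoMap_val {p p' : PaPB' A B} (f : p ⟶ p') :
    (rhoMap f).1 = BraidGroup.rhoBraid (Nat.card (A ⊕ B)) (Nat.card A) p.row p'.row f.2.1 := rfl

theorem rhoMap_id (p : PaPB' A B) : rhoMap (𝟙 p) = 𝟙 p.rho := by
  refine PaB.hom_ext ?_
  change BraidGroup.gather _ 0 0 _ * BraidGroup.place _ _ _ 1 * _ = 1
  rw [map_one, mul_one]
  exact mul_inv_cancel _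

theorem rhoMap_comp {p p' p'' : PaPB' A B} (f : p ⟶ p') (g : p' ⟶ p'') :
    rhoMap (f ≫ g) = rhoMap f ≫ rhoMap g := by
  refine PaB.hom_ext ?_
  change BraidGroup.gather _ 0 0 _ * BraidGroup.place _ _ _ (f.2.1 * g.2.1) * _ =
    (BraidGroup.gather _ 0 0 _ * BraidGroup.place _ _ _ f.2.1 * _) *
      (BraidGroup.gather _ 0 0 _ * BraidGroup.place _ _ _ g.2.1 * _)
  rw [map_mul]
  simp only [mul_assoc, inv_mul_cancel_left]

theorem row_relabel {A' B' : Type} (e : A ≃ A') (e' : B ≃ B') (p : PaPB' A B) :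
    (p.relabel e e').row = p.row.map (Sum.map e e') :=
  (congrArg Mag.leaves (OMag.flat_relabel e e' p.μ.1)).trans (Mag.leaves_map _ _)

theorem rhoMap_relabelMap_val {A' B' : Type} (e : A ≃ A') (e' : B ≃ B') {p p' : PaPB' A B}
    (f : p ⟶ p') :
    (rhoMap (relabelMap e e' f)).1 =
      BraidGroup.place (Nat.card (A ⊕ B)) (Nat.card (A' ⊕ B')) 0 (rhoMap f).1 := by
  rw [rhoMap_val, row_relabel, row_relabel, BraidGroup.rhoBraid_map]
  change BraidGroup.rhoBraid _ _ _ _ (BraidGroup.place (Nat.card B) (Nat.card B') 0 f.2.1) = _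
  rw [rhoMap_val]
  have h1 := Nat.card_congr (e.sumCongr e')
  have h2 := Nat.card_congr e
  have h3 := Nat.card_congr e'
  have key : ∀ n m k : ℕ, Nat.card (A ⊕ B) = n → Nat.card A = m → Nat.card B = k →
      BraidGroup.rhoBraid n m p.row p'.row (BraidGroup.place (Nat.card B) k 0 f.2.1) =
        BraidGroup.place (Nat.card (A ⊕ B)) n 0
          (BraidGroup.rhoBraid (Nat.card (A ⊕ B)) (Nat.card A) p.row p'.row f.2.1) := by
    rintro _ _ _ rfl rfl rfl
    rw [BraidGroup.place_self, BraidGroup.place_self]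
  exact key _ _ _ h1 h2 h3

/-! ### The composition in the shifted operad -/

theorem card_shiftLabels_inr (L : A → Type) (b : B) :
    Nat.card (shiftLabels B L (Sum.inr b)) = 1 :=
  Nat.card_unique (α := Unit)

theorem sum_shiftLabels {L : A → Type} (w : PaB (A ⊕ B)) (y : ∀ a, PaB (L a)) :
    (w.word.order.map fun c => Nat.card (shiftLabels B L c)).sum = Nat.card (B ⊕ Σ a, L a) :=
  (PaB.sum_card w (shiftFamily y)).trans (Nat.card_congr (shiftEquiv B L))

theorem shiftCompMap_val {L : A → Type} {w w' : PaB (A ⊕ B)} {y y' : ∀ a, PaB (L a)}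
    (f : w ⟶ w') (g : ∀ a, y a ⟶ y' a) :
    (shiftCompMap f g).1 = BraidGroup.insert (Nat.card (A ⊕ B)) (Nat.card (B ⊕ Σ a, L a))
      (fun c => Nat.card (shiftLabels B L c)) w.word.order f.1 fun c => (shiftFamilyMap g c).1 :=
  BraidGroup.place_insert w.word.length_order (PaB.sum_card w (shiftFamily y))
    (Nat.card_congr (shiftEquiv B L)).le

theorem shiftCompMap_id {L : A → Type} (w : PaB (A ⊕ B)) (y : ∀ a, PaB (L a)) :
    shiftCompMap (𝟙 w) (fun a => 𝟙 (y a)) = 𝟙 (shiftComp w y) := by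
  have : shiftFamilyMap (B := B) (fun a => 𝟙 (y a)) = fun c => 𝟙 (shiftFamily y c) := by
    funext c
    rcases c with a | b <;> rfl
  rw [shiftCompMap, this, PaB.compMap_id, PaB.relabelMap_id]
  rfl

theorem shiftCompMap_comp {L : A → Type} {w w' w'' : PaB (A ⊕ B)} {y y' y'' : ∀ a, PaB (L a)}
    (f : w ⟶ w') (f' : w' ⟶ w'') (g : ∀ a, y a ⟶ y' a) (g' : ∀ a, y' a ⟶ y'' a) :
    shiftCompMap (f ≫ f') (fun a => g a ≫ g' a) = shiftCompMap f g ≫ shiftCompMap f' g' := by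
  have : shiftFamilyMap (B := B) (fun a => g a ≫ g' a) =
      fun c => shiftFamilyMap g c ≫ shiftFamilyMap g' c := by
    funext c
    rcases c with a | b
    · rfl
    · exact (Category.comp_id _).symm
  rw [shiftCompMap, this, PaB.compMap_comp, PaB.relabelMap_comp]
  rfl

/-! ### The operation `ρ` of composites -/

/-- The row of letters which replaces a letter of `p` in a composite with the objects `q a`. -/
def compBlock {K L : A → Type} (q : ∀ a, PaPB' (K a) (L a)) :
    A ⊕ B → List ((Σ a, K a) ⊕ (B ⊕ Σ a, L a)) :=
  Sum.elim (fun a => (q a).row.map (Sum.map (Sigma.mk a) fun l => Sum.inr ⟨a, l⟩))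
    fun b => [Sum.inr (Sum.inl b)]

theorem row_comp {K L : A → Type} (p : PaPB' A B) (q : ∀ a, PaPB' (K a) (L a)) :
    (p.comp q).row = p.row.flatMap (compBlock q) := by
  refine (congrArg Mag.leaves (OMag.flat_substOpen _ _)).trans ((Mag.leaves_lift _ _).trans ?_)
  refine List.flatMap_congr fun c _ => ?_
  rcases c with a | b
  · exact Mag.leaves_map _ _
  · rfl

theorem filterMap_left_map {A' B' : Type} (e : A → A') (d : B → B') (l : List (A ⊕ B)) :
    (l.map (Sum.map e d)).filterMap Sum.getLeft? = (l.filterMap Sum.getLeft?).map e := by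
  induction l with
  | nil => rfl
  | cons c l ih => rcases c with c | c <;> simp [List.filterMap_cons, ih]

theorem filterMap_right_map {A' B' : Type} (e : A → A') (d : B → B') (l : List (A ⊕ B)) :
    (l.map (Sum.map e d)).filterMap Sum.getRight? = (l.filterMap Sum.getRight?).map d := by
  induction l with
  | nil => rfl
  | cons c l ih => rcases c with c | c <;> simp [List.filterMap_cons, ih]

theorem rhoBraid_cast {n n' a b : ℕ} (h : n = n') (N k : ℕ) (l l' : List (A ⊕ B))
    (x : BraidGroup b) :
    BraidGroup.place n N k (BraidGroup.rhoBraid n a l l' x) =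
      BraidGroup.place n' N k (BraidGroup.rhoBraid n' a l l' x) := by
  subst h; rfl

/-- `ρ` is a morphism of operads: `ρ` of a composite is the composite in `PaB₊` of the `ρ` of the
factors. -/
theorem rhoMap_compMap_val {K L : A → Type} {p p' : PaPB' A B} {q q' : ∀ a, PaPB' (K a) (L a)}
    (f : p ⟶ p') (g : ∀ a, q a ⟶ q' a) :
    (rhoMap (compMap f g)).1 =
      BraidGroup.insert (Nat.card (A ⊕ B)) (Nat.card ((Σ a, K a) ⊕ (B ⊕ Σ a, L a)))
        (fun c => Nat.card (shiftLabels B (fun a => K a ⊕ L a) c)) p.row (rhoMap f).1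
        fun c => (shiftFamilyMap (fun a => rhoMap (g a)) c).1 := by
  have hL : ∀ (q : ∀ a, PaPB' (K a) (L a)) (c : A ⊕ B),
      ((compBlock q c).filterMap Sum.getLeft?).length =
        (Sum.elim (fun a => Nat.card (K a)) fun _ => 0 : A ⊕ B → ℕ) c := by
    rintro q (a | b)
    · change ((List.map _ _).filterMap _).length = _
      rw [filterMap_left_map, List.length_map, length_row_left]
      rfl
    · rfl
  have hR : ∀ (q : ∀ a, PaPB' (K a) (L a)) (c : A ⊕ B),
      ((compBlock q c).filterMap Sum.getRight?).length = Nat.card (shiftLabels B L c) := by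
    rintro q (a | b)
    · change ((List.map _ _).filterMap _).length = _
      rw [filterMap_right_map, List.length_map, length_row_right]
      rfl
    · exact (card_shiftLabels_inr _ _).symm
  have hP : (p.row.map (Sum.elim (fun a => Nat.card (K a)) fun _ => 0)).sum =
      Nat.card (Σ a, K a) := by
    rw [BraidGroup.sum_elim_left, row_left]
    exact p.u.word.sum_card fun a => (q a).u.word
  have hM := sum_shiftLabels p.rho fun a => (q a).x
  have hN := (comp p q).card_add
  rw [rhoMap_val, row_comp, row_comp]
  change BraidGroup.rhoBraid _ _ _ _ (shiftCompMap (rhoMap f) fun a => (g a).2).1 = _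
  rw [shiftCompMap_val, rhoMap_val, BraidGroup.rhoBraid_insert _ p.length_row p.length_row_left
    p.card_add (row_left_eq f) (carries_right f) (fun _ => rfl) (hL q) (hL q') (hR q) (hR q')
    hP hM hN]
  have hs : ∀ c : A ⊕ B, (Sum.elim (fun a => Nat.card (K a)) fun _ => 0 : A ⊕ B → ℕ) c +
      Nat.card (shiftLabels B L c) = Nat.card (shiftLabels B (fun a => K a ⊕ L a) c) := by
    rintro (a | b)
    · exact (q a).card_add
    · exact zero_add _
  refine BraidGroup.insert_congr (fun c _ => hs c) ?_ ?_
  · rintro (a | b) _ k _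
    · refine (rhoBraid_cast (hs _) _ _ _ _ _).trans (congrArg _ ?_)
      exact BraidGroup.rhoBraid_map _ _ _ _ _
    · exact BraidGroup.place_eq_of_le_one (by rw [hs, card_shiftLabels_inr])
        (card_shiftLabels_inr _ _).le _ _
  · rw [List.sum_map_add, hP, ← hN]
    exact (congrArg _ hM).le

/-- The label sets for the action on a word in all letters: the open inputs are kept. -/
abbrev actLabels (A : Type) {B : Type} (M : B → Type) : A ⊕ B → Type := Sum.elim (fun _ => Unit) M

theorem card_actLabels_inl (M : B → Type) (a : A) : Nat.card (actLabels A M (Sum.inl a)) = 1 :=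
  Nat.card_unique (α := Unit)

/-- The family which consists of units for the open inputs and of a given family for the closed
inputs. -/
def actFamily {M : B → Type} (y : ∀ b, PaB (M b)) : ∀ c, PaB (actLabels A M c)
  | Sum.inl _ => PaB.unit
  | Sum.inr b => y b

/-- The morphisms of families `actFamily`. -/
def actFamilyMap {M : B → Type} {y y' : ∀ b, PaB (M b)} (g : ∀ b, y b ⟶ y' b) :
    ∀ c : A ⊕ B, actFamily y c ⟶ actFamily y' c
  | Sum.inl _ => 𝟙 PaB.unit
  | Sum.inr b => g b

/-- The row of letters which replaces a letter of `p` under the action of the objects `y b`. -/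
def actBlock {M : B → Type} (y : ∀ b, PaB (M b)) : A ⊕ B → List (A ⊕ Σ b, M b) :=
  Sum.elim (fun a => [Sum.inl a]) fun b => (y b).word.order.map fun m => Sum.inr ⟨b, m⟩

theorem row_act {M : B → Type} (p : PaPB' A B) (y : ∀ b, PaB (M b)) :
    (p.act y).row = p.row.flatMap (actBlock y) := by
  refine (congrArg Mag.leaves (OMag.flat_substClosed _ _)).trans ((Mag.leaves_lift _ _).trans ?_)
  refine List.flatMap_congr fun c _ => ?_
  rcases c with a | b
  · rfl
  · exact Mag.leaves_map _ _

theorem gather_map_inr {N t a : ℕ} (l : List B) :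
    BraidGroup.gather N t a (l.map (Sum.inr : B → A ⊕ B)) = 1 := by
  induction l generalizing a with
  | nil => rfl
  | cons b l ih => exact ih

/-- `ρ` is a morphism of right modules. The number `κ` of open letters and the number `ν` of closed
letters of the block which replaces a letter are `1`, `0` for an open letter, and `0`, `|M b|` for a
closed letter. -/
theorem rhoMap_actMap_val {M : B → Type} {p p' : PaPB' A B} {y y' : ∀ b, PaB (M b)} (f : p ⟶ p')
    (g : ∀ b, y b ⟶ y' b) :
    (rhoMap (actMap f g)).1 =
      BraidGroup.insert (Nat.card (A ⊕ B)) (Nat.card (A ⊕ Σ b, M b))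
        (fun c => Nat.card (actLabels A M c)) p.row (rhoMap f).1
        fun c => (actFamilyMap g c).1 := by
  let κ : A ⊕ B → ℕ := Sum.elim (fun _ => 1) fun _ => 0
  let ν : A ⊕ B → ℕ := Sum.elim (fun _ => 0) fun b => Nat.card (M b)
  let γ : ∀ c, BraidGroup (ν c)
    | Sum.inl _ => 1
    | Sum.inr b => (g b).1
  have e : ∀ (y : ∀ b, PaB (M b)) (b : B), actBlock (A := A) y (Sum.inr b) =
      ((y b).word.order.map (Sigma.mk b)).map Sum.inr := fun y b => List.map_map.symm
  have hL : ∀ (y : ∀ b, PaB (M b)) (c : A ⊕ B),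
      ((actBlock y c).filterMap Sum.getLeft?).length = κ c := by
    rintro y (a | b)
    · rfl
    · rw [e]
      simp [κ, List.filterMap_map, Function.comp_def]
  have hR : ∀ (y : ∀ b, PaB (M b)) (c : A ⊕ B),
      ((actBlock y c).filterMap Sum.getRight?).length = ν c := by
    rintro y (a | b)
    · rfl
    · rw [e]
      simp [ν, List.filterMap_map, Function.comp_def, OmegaPlus.length_order]
  have hP : (p.row.map κ).sum = Nat.card A := by
    rw [BraidGroup.sum_elim_left, row_left]
    simp [OmegaPlus.length_order]
  have hM' : ((p.row.filterMap Sum.getRight?).map fun b => Nat.card (M b)).sum =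
      Nat.card (Σ b, M b) := by
    rw [row_right]
    exact PaB.sum_card p.x y
  have hM : (p.row.map ν).sum = Nat.card (Σ b, M b) := by
    rw [BraidGroup.sum_elim_right]
    exact hM'
  have hN := (act p y).card_add
  have hx : (actMap f g).2.1 = BraidGroup.insert (Nat.card (A ⊕ B)) (Nat.card (Σ b, M b)) ν p.row
      (rhoMap f).1 γ := by
    rw [rhoMap_val, BraidGroup.insert_rhoBraid_delete γ p.length_row p.length_row_left
      p.card_add (row_left_eq f) (carries_right f) (fun _ => rfl) hM', row_right]
    rfl
  rw [rhoMap_val, row_act, row_act, hx, rhoMap_val, BraidGroup.rhoBraid_insert γ p.length_row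
    p.length_row_left p.card_add (row_left_eq f) (carries_right f) (fun _ => rfl) (hL y) (hL y')
    (hR y) (hR y') hP hM hN]
  have hs : ∀ c : A ⊕ B, κ c + ν c = Nat.card (actLabels A M c) := by
    rintro (a | b)
    · exact (card_actLabels_inl _ _).symm
    · exact zero_add _
  refine BraidGroup.insert_congr (fun c _ => hs c) ?_ ?_
  · rintro (a | b) _ k hk
    · exact BraidGroup.place_eq_of_le_one (by rw [hs, card_actLabels_inl])
        (card_actLabels_inl _ _).le _ _
    · rw [BraidGroup.rhoBraid, e, e, gather_map_inr, gather_map_inr, one_mul, inv_one, mul_one]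
      exact BraidGroup.place_place (le_of_eq rfl) hk _
  · rw [List.sum_map_add]
    exact ((congrArg₂ _ hP hM).trans hN).le

end PaPB'

/-! ### The axioms of the relative operad -/

namespace PaPB'

variable {A B : Type}

theorem relabel_refl (p : PaPB' A B) : relabel (Equiv.refl A) (Equiv.refl B) p = p :=
  ext_of (PaP.ext (OmegaPlus.relabel_refl _)) (OMag.relabel_id _)

theorem relabel_trans {A' A'' B' B'' : Type} (e : A ≃ A') (d : A' ≃ A'') (e' : B ≃ B')
    (d' : B' ≃ B'') (p : PaPB' A B) :
    relabel (e.trans d) (e'.trans d') p = relabel d d' (relabel e e' p) :=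
  ext_of (PaP.ext (OmegaPlus.relabel_trans _ _ _)) (OMag.relabel_relabel e e' d d' p.μ.1).symm

theorem act_relabel_left {A' B' : Type} {M : B' → Type} (e : A ≃ A') (e' : B ≃ B')
    (p : PaPB' A B) (y : ∀ b, PaB (M b)) :
    relabel e (Equiv.sigmaCongrLeft e') (act p fun b => y (e' b)) = act (relabel e e' p) y :=
  ext_of rfl (OMag.substClosed_relabel_left e e' p.μ.1 fun b => (y b).word.1)

theorem act_relabel_right {M M' : B → Type} (d : ∀ b, M b ≃ M' b) (p : PaPB' A B)
    (y : ∀ b, PaB (M b)) :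
    relabel (Equiv.refl A) (Equiv.sigmaCongrRight d) (act p y) =
      act p fun b => PaB.relabel (d b) (y b) :=
  ext_of (PaP.ext (OmegaPlus.relabel_refl _))
    (OMag.substClosed_relabel_right d p.μ.1 fun b => (y b).word.1)

theorem act_unit (p : PaPB' A B) :
    relabel (Equiv.refl A) (Equiv.sigmaPUnit B) (act p fun _ => PaB.unit) = p :=
  ext_of (PaP.ext (OmegaPlus.relabel_refl _)) (OMag.substClosed_unit p.μ.1)

theorem act_act {M : B → Type} {N : ∀ b, M b → Type} (p : PaPB' A B) (y : ∀ b, PaB (M b))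
    (z : ∀ b m, PaB (N b m)) :
    relabel (Equiv.refl A) (Equiv.sigmaAssoc N) (act (act p y) fun i => z i.1 i.2) =
      act p fun b => PaB.comp (y b) (z b) :=
  ext_of (PaP.ext (OmegaPlus.relabel_refl _))
    (OMag.substClosed_substClosed p.μ.1 (fun b => (y b).word.1) fun b m => (z b m).word.1)

theorem comp_relabel_left {A' B' : Type} {K L : A' → Type} (e : A ≃ A') (e' : B ≃ B')
    (p : PaPB' A B) (q : ∀ a, PaPB' (K a) (L a)) :
    relabel (Equiv.sigmaCongrLeft e) (Equiv.sumCongr e' (Equiv.sigmaCongrLeft e))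
        (comp p fun a => q (e a)) = comp (relabel e e' p) q :=
  ext_of (PaP.ext (OmegaPlus.comp_relabel_left e p.u.word fun a => (q a).u.word))
    (OMag.substOpen_relabel_left e e' p.μ.1 fun a => (q a).μ.1)

theorem comp_relabel_right {K K' L L' : A → Type} (e : ∀ a, K a ≃ K' a) (d : ∀ a, L a ≃ L' a)
    (p : PaPB' A B) (q : ∀ a, PaPB' (K a) (L a)) :
    relabel (Equiv.sigmaCongrRight e) (Equiv.sumCongr (Equiv.refl B) (Equiv.sigmaCongrRight d))
        (comp p q) = comp p fun a => relabel (e a) (d a) (q a) :=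
  ext_of (PaP.ext (OmegaPlus.comp_relabel_right e p.u.word fun a => (q a).u.word))
    (OMag.substOpen_relabel_right e d p.μ.1 fun a => (q a).μ.1)

theorem unit_comp {K L : Type} (q : PaPB' K L) :
    relabel (Equiv.uniqueSigma fun _ : Unit => K)
      ((Equiv.emptySum Empty _).trans (Equiv.uniqueSigma fun _ : Unit => L))
      (comp unit fun _ => q) = q :=
  ext_of (PaP.ext (OmegaPlus.unit_comp q.u.word)) (OMag.unit_substOpen q.μ.1)

theorem comp_unit (p : PaPB' A B) :
    relabel (Equiv.sigmaPUnit A) (sumEmptyFamily A B) (comp p fun _ => unit) = p :=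
  ext_of (PaP.ext (OmegaPlus.comp_unit p.u.word)) (OMag.substOpen_unit p.μ.1)

theorem comp_assoc {K L : A → Type} {K' L' : ∀ a, K a → Type} (p : PaPB' A B)
    (q : ∀ a, PaPB' (K a) (L a)) (r : ∀ a k, PaPB' (K' a k) (L' a k)) :
    relabel (Equiv.sigmaAssoc K') (closedAssoc L') (comp (comp p q) fun i => r i.1 i.2) =
      comp p fun a => comp (q a) (r a) :=
  ext_of (PaP.ext (OmegaPlus.comp_assoc p.u.word (fun a => (q a).u.word)
      fun a k => (r a k).u.word))
    (OMag.substOpen_assoc p.μ.1 (fun a => (q a).μ.1) fun a k => (r a k).μ.1)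

theorem act_comp {K L : A → Type} {M : B → Type} {M' : ∀ a, L a → Type} (p : PaPB' A B)
    (q : ∀ a, PaPB' (K a) (L a)) (y : ∀ b, PaB (M b)) (z : ∀ a l, PaB (M' a l)) :
    relabel (Equiv.refl _) (sumLabelsEquiv M M') (act (comp p q) (sumFamily PaB y z)) =
      comp (act p y) fun a => act (q a) (z a) :=
  ext_of (PaP.ext (OmegaPlus.relabel_refl _))
    (OMag.substClosed_substOpen p.μ.1 (fun a => (q a).μ.1)
      fun c => (sumFamily PaB y z c).word.1)

theorem compMap_id {K L : A → Type} (p : PaPB' A B) (q : ∀ a, PaPB' (K a) (L a)) :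
    compMap (𝟙 p) (fun a => 𝟙 (q a)) = 𝟙 (comp p q) := by
  refine hom_ext ?_
  change (shiftCompMap (rhoMap (𝟙 p)) fun a => 𝟙 (q a).x).1 = _
  rw [rhoMap_id, shiftCompMap_id]
  rfl

theorem compMap_comp {K L : A → Type} {p p' p'' : PaPB' A B} {q q' q'' : ∀ a, PaPB' (K a) (L a)}
    (f : p ⟶ p') (f' : p' ⟶ p'') (g : ∀ a, q a ⟶ q' a) (g' : ∀ a, q' a ⟶ q'' a) :
    compMap (f ≫ f') (fun a => g a ≫ g' a) = compMap f g ≫ compMap f' g' := by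
  refine hom_ext ?_
  change (shiftCompMap (rhoMap (f ≫ f')) fun a => (g a).2 ≫ (g' a).2).1 = _
  rw [rhoMap_comp, shiftCompMap_comp]
  rfl

theorem compMap_relabel_left_val {A' B' : Type} {K L : A' → Type} (e : A ≃ A') (e' : B ≃ B')
    {p p' : PaPB' A B} {q q' : ∀ a, PaPB' (K a) (L a)} (f : p ⟶ p') (g : ∀ a, q a ⟶ q' a) :
    (relabelMap (Equiv.sigmaCongrLeft e) (Equiv.sumCongr e' (Equiv.sigmaCongrLeft e))
        (compMap f fun a => g (e a))).2.1 = (compMap (relabelMap e e' f) g).2.1 := by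
  change BraidGroup.place _ _ 0 (shiftCompMap (rhoMap f) fun a => (g (e a)).2).1 =
    (shiftCompMap (rhoMap (relabelMap e e' f)) fun a => (g a).2).1
  have hc := Nat.card_congr (Equiv.sumCongr e' (Equiv.sigmaCongrLeft (β := L) e))
  have hs := sum_shiftLabels p.rho fun a => (q (e a)).x
  rw [shiftCompMap_val, shiftCompMap_val, rhoMap_relabelMap_val,
    BraidGroup.place_insert p.length_row hs hc.le,
    BraidGroup.insert_place (Nat.card_congr (e.sumCongr e'))]
  change _ = BraidGroup.insert _ _ _ (relabel e e' p).row _ _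
  rw [row_relabel, BraidGroup.insert_map]
  refine BraidGroup.insert_congr ?_ ?_ (hs.trans hc).le
  · rintro (a | b) _ <;> rfl
  · rintro (a | b) _ k _ <;> rfl

theorem compMap_relabel_right_val {K K' L L' : A → Type} (e : ∀ a, K a ≃ K' a)
    (d : ∀ a, L a ≃ L' a) {p p' : PaPB' A B} {q q' : ∀ a, PaPB' (K a) (L a)} (f : p ⟶ p')
    (g : ∀ a, q a ⟶ q' a) :
    (relabelMap (Equiv.sigmaCongrRight e)
        (Equiv.sumCongr (Equiv.refl B) (Equiv.sigmaCongrRight d)) (compMap f g)).2.1 =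
      (compMap f fun a => relabelMap (e a) (d a) (g a)).2.1 := by
  change BraidGroup.place _ _ 0 (shiftCompMap (rhoMap f) fun a => (g a).2).1 =
    (shiftCompMap (rhoMap f) fun a => PaB.relabelMap (d a) (g a).2).1
  have hc := Nat.card_congr (Equiv.sumCongr (Equiv.refl B) (Equiv.sigmaCongrRight d))
  have hs := sum_shiftLabels p.rho fun a => (q a).x
  rw [shiftCompMap_val, shiftCompMap_val, BraidGroup.place_insert p.length_row hs hc.le]
  refine BraidGroup.insert_congr ?_ ?_ (hs.trans hc).le
  · rintro (a | b) _
    · exact Nat.card_congr (d a)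
    · rfl
  · rintro (a | b) _ k hk
    · have := Nat.card_congr (d a)
      change k + Nat.card (L a) ≤ _ at hk
      change _ = BraidGroup.place _ _ k (BraidGroup.place (Nat.card (L a)) (Nat.card (L' a)) 0 _)
      rw [BraidGroup.place_place (by omega) (by omega)]
      rfl
    · rfl

theorem unit_compMap_val {K L : Type} {q q' : PaPB' K L} (g : q ⟶ q') :
    (relabelMap (Equiv.uniqueSigma fun _ : Unit => K)
      ((Equiv.emptySum Empty _).trans (Equiv.uniqueSigma fun _ : Unit => L))
      (compMap (𝟙 unit) fun _ => g)).2.1 = g.2.1 := by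
  have e := (Equiv.emptySum Empty (Σ _ : Unit, L)).trans (Equiv.uniqueSigma fun _ : Unit => L)
  have hc : Nat.card (Empty ⊕ Σ _ : Unit, L) = Nat.card L := Nat.card_congr e
  have hs := sum_shiftLabels (B := Empty) unit.rho fun _ => q.x
  change BraidGroup.place _ _ 0 (shiftCompMap (rhoMap (𝟙 unit)) fun _ => g.2).1 = _
  rw [shiftCompMap_val, BraidGroup.place_insert unit.length_row hs hc.le, rhoMap_id]
  refine (BraidGroup.insert_singleton _ _ _).trans ?_
  exact BraidGroup.place_self _

/-- Composition with units deletes the open strands of `ρ (f)`. -/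
theorem compMap_unit_val {p p' : PaPB' A B} (f : p ⟶ p') :
    (relabelMap (Equiv.sigmaPUnit A) (sumEmptyFamily A B) (compMap f fun _ => 𝟙 unit)).2.1 =
      f.2.1 := by
  have hc := Nat.card_congr (sumEmptyFamily A B)
  have hs := sum_shiftLabels p.rho fun _ => unit.x
  change BraidGroup.place _ _ 0 (shiftCompMap (rhoMap f) fun _ => 𝟙 unit.x).1 = _
  have hn : ∀ b : B, Nat.card (shiftLabels B (fun _ : A => Empty) (Sum.inr b)) = 1 :=
    card_shiftLabels_inr _
  rw [shiftCompMap_val, BraidGroup.place_insert p.length_row hs hc.le, rhoMap_val,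
    BraidGroup.insert_rhoBraid_delete _ p.length_row p.length_row_left p.card_add (row_left_eq f)
      (carries_right f) (fun _ => Nat.card_of_isEmpty (α := Empty))
      (by simp [p.length_row_right])]
  refine (congrArg (· * _) (BraidGroup.sideBySide_eq_one (fun _ _ => rfl) _)).trans ?_
  rw [one_mul, BraidGroup.cableL_one_width p.length_row_right (fun b _ => hn b) le_rfl,
    BraidGroup.place_self]

theorem carries_compBlock {K L : A → Type} {q q' : ∀ a, PaPB' (K a) (L a)}
    (g : ∀ a, q a ⟶ q' a) (c : A ⊕ B) :
    (shiftFamilyMap (fun a => rhoMap (g a)) c).1.Carries (compBlock q c) (compBlock q' c) := by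
  rcases c with a | b
  · exact (rhoMap (g a)).2.map _
  · exact BraidGroup.Carries.one _

theorem length_compBlock {K L : A → Type} (q : ∀ a, PaPB' (K a) (L a)) (c : A ⊕ B) :
    (compBlock q c).length = Nat.card (shiftLabels B (fun a => K a ⊕ L a) c) := by
  rcases c with a | b
  · exact (List.length_map _).trans (q a).length_row
  · exact (card_shiftLabels_inr _ _).symm

/-- As `ρ` of a composite is a composite, both sides are iterated insertions into `ρ (f)`. -/
theorem compMap_assoc_val {K L : A → Type} {K' L' : ∀ a, K a → Type} {p p' : PaPB' A B}
    {q q' : ∀ a, PaPB' (K a) (L a)} {r r' : ∀ a k, PaPB' (K' a k) (L' a k)} (f : p ⟶ p')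
    (g : ∀ a, q a ⟶ q' a) (h : ∀ a k, r a k ⟶ r' a k) :
    (relabelMap (Equiv.sigmaAssoc K') (closedAssoc L')
        (compMap (compMap f g) fun i => h i.1 i.2)).2.1 =
      (compMap f fun a => compMap (g a) (h a)).2.1 := by
  change BraidGroup.place _ _ 0
      (shiftCompMap (rhoMap (compMap f g)) fun i : Σ a, K a => (h i.1 i.2).2).1 =
    (shiftCompMap (rhoMap f) fun a => shiftCompMap (rhoMap (g a)) fun k => (h a k).2).1
  have hc := Nat.card_congr (closedAssoc (A := A) (B := B) (L := L) L')
  have hs := sum_shiftLabels (comp p q).rho fun i : Σ a, K a => (r i.1 i.2).x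
  rw [shiftCompMap_val, BraidGroup.place_insert (comp p q).length_row hs hc.le,
    rhoMap_compMap_val, shiftCompMap_val]
  change ((comp p q).row.map _).sum = _ at hs
  change BraidGroup.insert _ _ _ (comp p q).row _ _ = _
  rw [row_comp] at hs ⊢
  have hR : (p.row.map fun c => Nat.card (shiftLabels B (fun a => K a ⊕ L a) c)).sum =
      Nat.card ((Σ a, K a) ⊕ (B ⊕ Σ a, L a)) := by
    rw [← (comp p q).length_row, row_comp, List.length_flatMap]
    simp only [length_compBlock]
  rw [BraidGroup.insert_insert p.length_row (carries_compBlock g) (length_compBlock q) hR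
    (hs.trans hc).le]
  have hn : ∀ c : A ⊕ B, ((compBlock q c).map fun i : (Σ a, K a) ⊕ (B ⊕ Σ a, L a) =>
      Nat.card (shiftLabels (B ⊕ Σ a, L a) (fun i : Σ a, K a => L' i.1 i.2) i)).sum =
        Nat.card (shiftLabels B (fun a => L a ⊕ Σ k, L' a k) c) := by
    rintro (a | b)
    · refine (congrArg List.sum (List.map_map ..)).trans (Eq.trans (congrArg List.sum
        (List.map_congr_left ?_)) (sum_shiftLabels (q a).rho fun k => (r a k).x))
      rintro (k | l) _ <;> rfl
    · change Nat.card Unit + 0 = Nat.card Unit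
      rfl
  refine BraidGroup.insert_congr (fun c _ => hn c) ?_ ?_
  · rintro (a | b) _ k _
    · rw [hn]
      refine congrArg _ ?_
      refine (BraidGroup.insert_map _ _ _ _ _).trans ?_
      refine Eq.trans ?_ (shiftCompMap_val (rhoMap (g a)) fun k => (h a k).2).symm
      refine BraidGroup.insert_congr ?_ ?_ ?_
      · rintro (k | l) _ <;> rfl
      · rintro (k | l) _ _ _ <;> rfl
      · have e := hn (Sum.inl a)
        change (((q a).row.map _).map _).sum = _ at e
        rw [List.map_map] at e
        exact e.le
    · exact BraidGroup.place_eq_of_le_one (by rw [hn, card_shiftLabels_inr])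
        (card_shiftLabels_inr _ _).le _ _
  · rw [← BraidGroup.sum_flatMap]
    exact (hs.trans hc).le

end PaPB'

namespace PaPB'

variable {A B : Type}

/-- The row of letters which replaces a letter of `p` in a composite of the shifted operad with the
objects `y a`. -/
def shiftBlock {L : A → Type} (y : ∀ a, PaB (L a)) : A ⊕ B → List (B ⊕ Σ a, L a) :=
  Sum.elim (fun a => (y a).word.order.map fun l => Sum.inr ⟨a, l⟩) fun b => [Sum.inl b]

theorem order_shiftComp {L : A → Type} (w : PaB (A ⊕ B)) (y : ∀ a, PaB (L a)) :
    (shiftComp w y).word.order = w.word.order.flatMap (shiftBlock y) := by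
  refine (OmegaPlus.order_relabel _ _).trans ?_
  refine (congrArg _ (OmegaPlus.order_comp _ _)).trans ?_
  rw [List.map_flatMap]
  refine List.flatMap_congr fun c _ => ?_
  rcases c with a | b
  · exact List.map_map
  · rfl

theorem carries_shiftBlock {L : A → Type} {y y' : ∀ a, PaB (L a)} (g : ∀ a, y a ⟶ y' a)
    (c : A ⊕ B) : (shiftFamilyMap g c).1.Carries (shiftBlock y c) (shiftBlock y' c) := by
  rcases c with a | b
  · exact (g a).2.map _
  · exact BraidGroup.Carries.one _

theorem length_shiftBlock {L : A → Type} (y : ∀ a, PaB (L a)) (c : A ⊕ B) :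
    (shiftBlock y c).length = Nat.card (shiftLabels B L c) := by
  rcases c with a | b
  · exact (List.length_map _).trans (y a).word.length_order
  · exact (card_shiftLabels_inr _ _).symm

theorem carries_actBlock {M : B → Type} {y y' : ∀ b, PaB (M b)} (g : ∀ b, y b ⟶ y' b)
    (c : A ⊕ B) : (actFamilyMap g c).1.Carries (actBlock y c) (actBlock y' c) := by
  rcases c with a | b
  · exact BraidGroup.Carries.one _
  · exact (g b).2.map _

theorem length_actBlock {M : B → Type} (y : ∀ b, PaB (M b)) (c : A ⊕ B) :
    (actBlock y c).length = Nat.card (actLabels A M c) := by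
  rcases c with a | b
  · exact (card_actLabels_inl _ _).symm
  · exact (List.length_map _).trans (y b).word.length_order

/-- Both sides are the insertion of the composites `g a (k a)` and of the braids `h b` into
`ρ (f)`. -/
theorem actMap_compMap_val {K L : A → Type} {M : B → Type} {M' : ∀ a, L a → Type}
    {p p' : PaPB' A B} {q q' : ∀ a, PaPB' (K a) (L a)} {y y' : ∀ b, PaB (M b)}
    {z z' : ∀ a l, PaB (M' a l)} (f : p ⟶ p') (g : ∀ a, q a ⟶ q' a) (h : ∀ b, y b ⟶ y' b)
    (k : ∀ a l, z a l ⟶ z' a l) :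
    (relabelMap (Equiv.refl _) (sumLabelsEquiv M M')
        (actMap (y := sumFamily PaB y z) (y' := sumFamily PaB y' z') (compMap f g)
          (sumFamilyMap (P := PaBPlus) h k))).2.1 =
      (compMap (actMap f h) fun a => actMap (g a) (k a)).2.1 := by
  change BraidGroup.place _ _ 0 (PaB.compMap (shiftCompMap (rhoMap f) fun a => (g a).2)
      (y := sumFamily PaB y z) (y' := sumFamily PaB y' z')
      (sumFamilyMap (P := PaBPlus) h k)).1 =
    (shiftCompMap (rhoMap (actMap f h)) fun a => PaB.compMap (g a).2 (k a)).1
  have hc := Nat.card_congr (sumLabelsEquiv M M')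
  have hs := PaB.sum_card (shiftComp p.rho fun a => (q a).x) (sumFamily PaB y z)
  refine (BraidGroup.place_insert (OmegaPlus.length_order _) hs hc.le).trans ?_
  rw [shiftCompMap_val]
  have hR : (p.row.map fun c => Nat.card (shiftLabels B L c)).sum = Nat.card (B ⊕ Σ a, L a) :=
    sum_shiftLabels p.rho fun a => (q a).x
  rw [order_shiftComp] at hs ⊢
  rw [BraidGroup.insert_insert p.length_row (carries_shiftBlock fun a => (g a).2)
    (length_shiftBlock _) hR (hs.trans hc).le]
  have hs' := sum_shiftLabels (act p y).rho fun a => (q a).x.comp (z a)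
  rw [shiftCompMap_val, rhoMap_actMap_val]
  change ((act p y).row.map _).sum = _ at hs'
  change _ = BraidGroup.insert _ _ _ (act p y).row _ _
  rw [row_act] at hs' ⊢
  have hR' : (p.row.map fun c => Nat.card (actLabels A M c)).sum =
      Nat.card (A ⊕ Σ b, M b) := by
    rw [← (act p y).length_row, row_act, List.length_flatMap]
    simp only [length_actBlock]
  rw [BraidGroup.insert_insert p.length_row (carries_actBlock h) (length_actBlock y) hR'
    hs'.le]
  -- the insertions into `ρ (f)` agree letter by letter
  have hn : ∀ c : A ⊕ B, ((shiftBlock (fun a => (q a).x) c).map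
      fun i => Nat.card (sumLabels M M' i)).sum =
        (Sum.elim (fun a => Nat.card (Σ l, M' a l)) fun b => Nat.card (M b) : A ⊕ B → ℕ) c := by
    rintro (a | b)
    · refine (congrArg List.sum (List.map_map ..)).trans ?_
      exact PaB.sum_card (q a).x (z a)
    · rfl
  have hn' : ∀ c : A ⊕ B, ((actBlock y c).map fun i : A ⊕ Σ b, M b =>
      Nat.card (shiftLabels (Σ b, M b) (fun a => Σ l, M' a l) i)).sum =
        (Sum.elim (fun a => Nat.card (Σ l, M' a l)) fun b => Nat.card (M b) : A ⊕ B → ℕ) c := by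
    rintro (a | b)
    · rfl
    · refine (congrArg List.sum (List.map_map ..)).trans ?_
      refine (congrArg List.sum (List.map_congr_left fun m _ =>
        card_shiftLabels_inr (A := A) (fun a => Σ l, M' a l) (⟨b, m⟩ : Σ b, M b))).trans ?_
      rw [List.map_const', List.sum_replicate, smul_eq_mul, mul_one]
      exact (y b).word.length_order
  refine BraidGroup.insert_congr (fun c _ => (hn c).trans (hn' c).symm) ?_ ?_
  · rintro (a | b) _ j hj
    · rw [hn] at hj ⊢
      change j + Nat.card (Σ l, M' a l) ≤ _ at hj
      refine Eq.trans (b := BraidGroup.place (Nat.card (Σ l, M' a l)) _ j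
        (PaB.compMap (g a).2 (k a)).1) (congrArg _ (BraidGroup.insert_map ..)) ?_
      refine Eq.symm ((congrArg _ (BraidGroup.insert_singleton ..)).trans ?_)
      exact BraidGroup.place_place (le_of_eq (zero_add _)) hj _
    · rw [hn']
      rw [hn] at hj
      change j + Nat.card (M b) ≤ _ at hj
      refine (congrArg _ (BraidGroup.insert_singleton ..)).trans ?_
      refine (BraidGroup.place_place (le_of_eq (zero_add _)) hj _).trans (congrArg _ ?_)
      refine Eq.symm ((BraidGroup.insert_map ..).trans ?_)
      refine (congrArg (· * _) (BraidGroup.sideBySide_one ..)).trans ?_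
      refine (one_mul _).trans ((BraidGroup.cableL_one_width (y b).word.length_order
        (fun m _ => card_shiftLabels_inr _ _) le_rfl).trans (BraidGroup.place_self _))
  · rw [← BraidGroup.sum_flatMap]
    exact (hs.trans hc).le

theorem isRelativeOperad : IsRelativeOperad PaPBPrimePlus where
  isOperad := PaB.isOperad
  relabelMap_id _ e' p := hom_ext (congrArg Subtype.val (PaB.relabelMap_id e' p.x))
  relabelMap_comp _ e' _ _ _ f f' :=
    hom_ext (congrArg Subtype.val (PaB.relabelMap_comp e' f.2 f'.2))
  relabel_refl := relabel_refl
  relabelMap_refl _ := hom_heq (relabel_refl _) (relabel_refl _) (BraidGroup.place_self _)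
  relabel_trans := relabel_trans
  relabelMap_trans e d e' d' _ _ f := hom_heq (relabel_trans e d e' d' _)
    (relabel_trans e d e' d' _) (PaB.relabelMap_relabelMap_val e' d' f.2).symm
  actMap_id p y := hom_ext (congrArg Subtype.val (PaB.compMap_id p.x y))
  actMap_comp f f' g g' := hom_ext (congrArg Subtype.val (PaB.compMap_comp f.2 f'.2 g g'))
  act_relabel_left := act_relabel_left
  actMap_relabel_left e e' _ _ _ _ f g := hom_heq (act_relabel_left e e' _ _)
    (act_relabel_left e e' _ _) (PaB.compMap_relabel_left_val e' f.2 g)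
  act_relabel_right := act_relabel_right
  actMap_relabel_right d _ _ _ _ f g := hom_heq (act_relabel_right d _ _)
    (act_relabel_right d _ _) (PaB.compMap_relabel_right_val d f.2 g)
  act_unit := act_unit
  actMap_unit f := hom_heq (act_unit _) (act_unit _) (PaB.compMap_unit_val f.2)
  act_act := act_act
  actMap_actMap f g h := hom_heq (act_act _ _ _) (act_act _ _ _)
    (PaB.compMap_assoc_val f.2 g h)
  compMap_id := compMap_id
  compMap_comp := compMap_comp
  comp_relabel_left := comp_relabel_left
  compMap_relabel_left e e' _ _ _ _ f g := hom_heq (comp_relabel_left e e' _ _)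
    (comp_relabel_left e e' _ _) (compMap_relabel_left_val e e' f g)
  comp_relabel_right := comp_relabel_right
  compMap_relabel_right e d _ _ _ _ f g := hom_heq (comp_relabel_right e d _ _)
    (comp_relabel_right e d _ _) (compMap_relabel_right_val e d f g)
  unit_comp := unit_comp
  unit_compMap g := hom_heq (unit_comp _) (unit_comp _) (unit_compMap_val g)
  comp_unit := comp_unit
  compMap_unit f := hom_heq (comp_unit _) (comp_unit _) (compMap_unit_val f)
  comp_assoc := comp_assoc
  compMap_assoc f g h := hom_heq (comp_assoc _ _ _) (comp_assoc _ _ _) (compMap_assoc_val f g h)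
  act_comp := act_comp
  actMap_compMap f g h k := hom_heq (act_comp _ _ _ _) (act_comp _ _ _ _)
    (actMap_compMap_val f g h k)

end PaPB'

theorem mainTheorem8 :
    IsOperad PaBPlus ∧ IsRelativeOperad PaPBPrimePlus :=
  ⟨PaB.isOperad, PaPB'.isRelativeOperad⟩
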